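/- **Setting.** Let $\mathcal H$ be a real separable Hilbert space with orthonormal basis $(e_i)$, let $W=\{W(h):h\in\mathcal H\}$ be an isonormal Gaussian process over $\mathcal H$ on a probability space $(\Omega,\mathcal F,\mathbb P)$, that is, a centered jointly Gaussian family with $\mathbb E[W(h)W(g)]=\langle h,g\rangle_{\mathcal H}$. Let $I_n$ be the $n$-th multiple Wiener–Itô integral ($n\ge 1$) and $D$ the Malliavin derivative, i.e. the closure in $L^2(\Omega)\times L^2(\Omega;\mathcal H)$ of $\varphi(W(h_1),\dots,W(h_m))\mapsto\sum_i\partial_i\varphi(W(h_1),\dots,W(h_m))h_i$, where $\varphi$ is smooth and bounded with all its derivatives. Let $f_t\in\mathcal H^{\otimes n}$, $t\in[0,1]$, be symmetric kernels and let $X_t=I_n(f_t)$ be a process with almost surely continuous paths. For $0\le s\le t\le 1$ let $F_{s,t}\subset\mathcal H$ be the closed linear span of all contractions $\langle f_t-f_s,\,e_{i_1}\otimes\cdots\otimes e_{i_{n-1}}\rangle_{\mathcal H^{\otimes(n-1)}}$. **Regularity assumption.** $f_0=0$ and there are constants $C>0$, $\theta>1$ with $$0<\|f_t-f_s\|_{\mathcal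 H^{\otimes n}}\le C|t-s|^{\theta/2}\qquad(0\le s<t\le1).$$ **Block-form assumption.** There is a constant $\alpha\in(0,1)$ such that for all points $0\le t_0<t_1<\dots<t_m\le1$, all subdivisions $0=s_0<s_1<\dots<s_k=t_0$ of $[0,t_0]$, all points $t_m=r_0<r_1<\dots<r_l\le1$ (with $k=0$ or $l=0$ allowed), all reals $a_1,\dots,a_m$ and all $\xi_i\in F_{t_{i-1},t_i}$ such that $v=\sum_{i=1}^m a_i\xi_i\neq0$, $$\|v-Pv\|_{\mathcal H}^2>\alpha\,\|v\|_{\mathcal H}^2,$$ where $P$ is the orthogonal projection onto the closed linear span of $F_{s_0,s_1},\dots,F_{s_{k-1},s_k},F_{r_0,r_1},\dots,F_{r_{l-1},r_l}$. **Proposition.** Under these two assumptions let $\rho,\tau\ge 0$ satisfy $\rho<\theta/2$ and $\tau+\rho>1$, and let $\{g_t\}_{0\le t\le1}$ be a real process whose paths are almost surely $\tau$-Hölder continuous on $[0,1]$. Then every $X_t$ belongs to the domain of $D$, the process $\{DX_t\}_{0\le t\le 1}$ has a version whose paths are almost surely $r$-Hölder continuous for every $0\le r<\theta/2$, and for every version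 of $DX$ with almost surely continuous paths the following holds almost surely: the Young integrals $\int_0^t g_r\,dDX_r$ exist in $\mathcal H$ for all $t\in[0,1]$, their norms are bounded in $t$, and $$\Big\|\int_0^1 g_r\,dDX_r\Big\|_{\mathcal H}\ \ge\ \sqrt{\alpha}\;\sup_{t\in[0,1]}\Big\|\int_0^t g_r\,dDX_r\Big\|_{\mathcal H}.$$ -/

import Mathlib

open MeasureTheory ProbabilityTheory Set Filter Topology
open scoped NNReal ENNReal

namespace ChaosProcess

noncomputable section

/-- `W` is an isonormal Gaussian process over the real Hilbert space `H`: a centered (jointly)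
Gaussian family indexed by `H` with `E[W(h) W(g)] = ⟨h, g⟩`. -/
structure IsIsonormal {Ω H : Type*} [MeasurableSpace Ω]
    [NormedAddCommGroup H] [InnerProductSpace ℝ H]
    (W : H → Ω → ℝ) (P : Measure Ω) : Prop where
  gaussian : IsGaussianProcess W P
  centered : ∀ h, ∫ ω, W h ω ∂P = 0
  covariance : ∀ h g, ∫ ω, W h ω * W g ω ∂P = inner ℝ h g

/-- The Hilbert tensor power `H^{⊗ n}`, realised in coordinates with respect to an orthonormal
basis `(e_i)_{i ∈ ι}` of `H`: the family `a ∈ ℓ²(ι^n)` stands for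
`∑ a(i₁,…,iₙ) e_{i₁} ⊗ ⋯ ⊗ e_{iₙ}`, and the norm of `H^{⊗ n}` is the `ℓ²` norm. -/
abbrev TensorPow (ι : Type*) (n : ℕ) : Type _ := lp (fun _ : Fin n → ι => ℝ) 2

/-- `f` lies in the symmetric tensor power. -/
def IsSymmTensor {ι : Type*} {n : ℕ} (f : TensorPow ι n) : Prop :=
  ∀ (σ : Equiv.Perm (Fin n)) (i : Fin n → ι), f (i ∘ σ) = f i

open scoped Classical in
/-- The multiple integral of the symmetrization of `e_{i₁} ⊗ ⋯ ⊗ e_{iₙ}`: the product over the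
distinct indices `j` occurring in `(i₁,…,iₙ)` of `H_{k_j}(W(e_j))`, where `k_j` is the number of
occurrences of `j` and `H_k` is the `k`-th (probabilists') Hermite polynomial. -/
def basisIntegral {Ω H ι : Type*} [NormedAddCommGroup H] [InnerProductSpace ℝ H]
    (W : H → Ω → ℝ) (e : HilbertBasis ι ℝ H) {n : ℕ} (i : Fin n → ι) (ω : Ω) : ℝ :=
  ∏ j ∈ Finset.univ.image i,
    Polynomial.aeval (W (e j) ω)
      (Polynomial.hermite (Finset.univ.filter (fun q => i q = j)).card)

/-- `X = Iₙ(f)` (almost surely): `X` is the `L²(P)`-limit of the multiple integrals of the finite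
partial sums of the expansion of `f` in the basis tensors. -/
def IsMultipleIntegral {Ω H ι : Type*} [MeasurableSpace Ω]
    [NormedAddCommGroup H] [InnerProductSpace ℝ H]
    (W : H → Ω → ℝ) (P : Measure Ω) (e : HilbertBasis ι ℝ H) {n : ℕ}
    (f : TensorPow ι n) (X : Ω → ℝ) : Prop :=
  AEStronglyMeasurable X P ∧
    Tendsto
      (fun S : Finset (Fin n → ι) =>
        eLpNorm (fun ω => X ω - ∑ i ∈ S, f i * basisIntegral W e i ω) 2 P)
      atTop (𝓝 0)

/-- `F` is a cylindrical random variable `φ(W(h₁),…,W(h_m))`, with `φ` smooth and bounded together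
with all its derivatives, and `DF = ∑ ∂ᵢφ(W(h₁),…,W(h_m)) hᵢ`. -/
def IsCylindricalDeriv {Ω H : Type*} [NormedAddCommGroup H] [InnerProductSpace ℝ H]
    (W : H → Ω → ℝ) (F : Ω → ℝ) (DF : Ω → H) : Prop :=
  ∃ (m : ℕ) (h : Fin m → H) (φ : (Fin m → ℝ) → ℝ),
    ContDiff ℝ ((⊤ : ℕ∞) : WithTop ℕ∞) φ ∧
    (∀ q : ℕ, ∃ C : ℝ, ∀ x, ‖iteratedFDeriv ℝ q φ x‖ ≤ C) ∧
    (∀ ω, F ω = φ (fun i => W (h i) ω)) ∧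
    (∀ ω, DF ω = ∑ i, fderiv ℝ φ (fun i => W (h i) ω) (Pi.single i 1) • h i)

/-- `F ∈ 𝔻^{1,2}` with Malliavin derivative `DF`: the pair `(F, DF)` is a limit in
`L²(Ω) × L²(Ω; H)` of pairs given by cylindrical random variables. -/
def IsMalliavinDeriv {Ω H : Type*} [MeasurableSpace Ω]
    [NormedAddCommGroup H] [InnerProductSpace ℝ H]
    (W : H → Ω → ℝ) (P : Measure Ω) (F : Ω → ℝ) (DF : Ω → H) : Prop :=
  AEStronglyMeasurable F P ∧ AEStronglyMeasurable DF P ∧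
  ∃ (G : ℕ → Ω → ℝ) (DG : ℕ → Ω → H),
    (∀ k, IsCylindricalDeriv W (G k) (DG k)) ∧
    Tendsto (fun k => eLpNorm (fun ω => F ω - G k ω) 2 P) atTop (𝓝 0) ∧
    Tendsto (fun k => eLpNorm (fun ω => DF ω - DG k ω) 2 P) atTop (𝓝 0)

/-- The closed linear span in `H` of all contractions of `f` with the `(n-1)`-fold tensors of basis
vectors. In slot `a` the contraction is the vector `∑_j f(k₁,…,j,…,kₙ) e_j`, with `j` in place `a`;
for symmetric `f` all slots give the same vectors. -/
def contractionSpace {H ι : Type*} [NormedAddCommGroup H] [InnerProductSpace ℝ H]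
    (e : HilbertBasis ι ℝ H) {n : ℕ} (f : TensorPow ι n) : Submodule ℝ H :=
  open scoped Classical in
  (Submodule.span ℝ
    {ξ : H | ∃ (a : Fin n) (k : Fin n → ι),
      ξ = ∑' j : ι, f (Function.update k a j) • e j}).topologicalClosure

/-- The space `F_{s,t}` attached to the kernel increment `f_t - f_s`. -/
abbrev incrementSpace {H ι : Type*} [NormedAddCommGroup H] [InnerProductSpace ℝ H]
    (e : HilbertBasis ι ℝ H) {n : ℕ} (f : ℝ → TensorPow ι n) (s t : ℝ) : Submodule ℝ H :=
  contractionSpace e (f t - f s)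

/-- The regularity assumption on the kernels, with constants `C > 0` and `θ > 1`. -/
def KernelRegularity {ι : Type*} {n : ℕ} (f : ℝ → TensorPow ι n) (C θ : ℝ) : Prop :=
  0 < C ∧ 1 < θ ∧ f 0 = 0 ∧
    ∀ s t : ℝ, 0 ≤ s → s < t → t ≤ 1 →
      0 < ‖f t - f s‖ ∧ ‖f t - f s‖ ≤ C * |t - s| ^ (θ / 2)

/-- The closed span of `F_{s₀,s₁}, …, F_{s_{k-1},s_k}, F_{r₀,r₁}, …, F_{r_{l-1},r_l}`. -/
abbrev outerSpace {H ι : Type*} [NormedAddCommGroup H] [InnerProductSpace ℝ H]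
    (e : HilbertBasis ι ℝ H) {n : ℕ} (f : ℝ → TensorPow ι n) {k l : ℕ}
    (s : Fin (k + 1) → ℝ) (r : Fin (l + 1) → ℝ) : Submodule ℝ H :=
  ((⨆ i : Fin k, incrementSpace e f (s i.castSucc) (s i.succ)) ⊔
    (⨆ i : Fin l, incrementSpace e f (r i.castSucc) (r i.succ))).topologicalClosure

/-- The block-form assumption with constant `α ∈ (0,1)`. Here `t₀ < t₁ < ⋯ < t_m` are points of
`[0,1]`, `0 = s₀ < s₁ < ⋯ < s_k = t₀` is a subdivision of `[0, t₀]`, and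
`t_m = r₀ < r₁ < ⋯ < r_l ≤ 1`. The strict bound is required of every nonzero combination
`v = a₁ ξ_{t₀,t₁} + ⋯ + a_m ξ_{t_{m-1},t_m}` with `ξ_{t_{i-1},t_i} ∈ F_{t_{i-1},t_i}`. -/
def BlockForm {H ι : Type*} [NormedAddCommGroup H] [InnerProductSpace ℝ H] [CompleteSpace H]
    (e : HilbertBasis ι ℝ H) {n : ℕ} (f : ℝ → TensorPow ι n) (α : ℝ) : Prop :=
  0 < α ∧ α < 1 ∧
    ∀ (m k l : ℕ) (t : Fin (m + 1) → ℝ) (s : Fin (k + 1) → ℝ) (r : Fin (l + 1) → ℝ)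
      (a : Fin m → ℝ) (ξ : Fin m → H),
      StrictMono t → 0 ≤ t 0 → t (Fin.last m) ≤ 1 →
      StrictMono s → s 0 = 0 → s (Fin.last k) = t 0 →
      StrictMono r → r 0 = t (Fin.last m) → r (Fin.last l) ≤ 1 →
      (∀ i : Fin m, ξ i ∈ incrementSpace e f (t i.castSucc) (t i.succ)) →
      ∑ i, a i • ξ i ≠ 0 →
      α * ‖∑ i, a i • ξ i‖ ^ 2 <
        ‖∑ i, a i • ξ i - (outerSpace e f s r).starProjection (∑ i, a i • ξ i)‖ ^ 2

/-- `J = ∫_a^b g dY` as a Young (Riemann–Stieltjes) integral: the tagged Riemann sums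
`∑ g(cᵢ) (Y(p_{i+1}) - Y(pᵢ))` over partitions of `[a,b]` converge to `J` as the mesh tends
to zero. -/
def IsYoungIntegral {H : Type*} [NormedAddCommGroup H] [InnerProductSpace ℝ H]
    (g : ℝ → ℝ) (Y : ℝ → H) (a b : ℝ) (J : H) : Prop :=
  ∀ ε > 0, ∃ δ > 0, ∀ (N : ℕ) (p : ℕ → ℝ) (c : ℕ → ℝ),
    Monotone p → p 0 = a → p N = b →
    (∀ i < N, p (i + 1) - p i < δ ∧ c i ∈ Icc (p i) (p (i + 1))) →
    ‖∑ i ∈ Finset.range N, g (c i) • (Y (p (i + 1)) - Y (p i)) - J‖ < ε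

end

end ChaosProcess

namespace ChaosProcess

/-! ### Young integrals -/

/-! The inequality is already visible on Riemann sums. Cut `[0,1]` into `N` equal cells and split
the sum of `g dDX` into `v`, the cells before time `t`, and `w`, the cells after it. Every increment
of `DX` over a cell lies in the space `F` of that cell, so `-w` lies in the space onto which the
block-form assumption projects when the subdivision on the left is trivial (`k = 0`). The distance
from `v` to that space is thus at most `‖v + w‖`, and the assumption gives `α ‖v‖² ≤ ‖v + w‖²`.
Letting `N → ∞` yields `√α ‖∫_0^t‖ ≤ ‖∫_0^1‖` for every `t`, which bounds the norms and their
supremum (`block_riemannSum_le`, `block_youngIntegral_le`).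

Four facts support this argument.

Young integrals exist by the maximal inequality `norm_sum_sub_le_of_almost_additive` applied to
`g(s)(Y(t) - Y(s))`, whose defect of additivity is of order `τ + ρ > 1`.

The Hölder version of `DX` comes from Kolmogorov's theorem (`exists_holder_modification`) and the
bound of all moments of a chaos derivative by the norm of its kernel (`eLpNorm_chaosDeriv_le`). The
moment bound replaces hypercontractivity by a computation with complex Gaussians: a product of
Hermite polynomials in the `G_j(ω)` is the average over an independent `ω'` of the monomial in `Z_j
= G_j(ω) + i G_j(ω')`. Jensen's inequality passes to the polynomial in the `Z_j`. Its `p`-th power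
is again a homogeneous polynomial, with coefficients `c ⊗ ⋯ ⊗ c`, so the moment of order `2p` is a
second moment, and this is controlled because `E[Z^a Z̄^b]` vanishes unless `a = b`.

An increment of the chaos derivative lies almost surely in the contraction space of the kernel
increment (`IsChaosDeriv.ae_mem_contractionSpace`): paired with a vector orthogonal to that space,
the partial sums have coefficients controlled by the tail of the kernel.

Finally `IsMalliavinDeriv.ae_eq`, by Gaussian integration by parts, makes the derivative unique. An
arbitrary continuous version therefore agrees with the Hölder one at all rational times, hence at
all times, and the result applies to it. -/

theorem exists_index_of_mem_Icc {p : ℕ → ℝ} {a b : ℕ} (hab : a < b) {x : ℝ}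
    (ha : p a ≤ x) (hb : x ≤ p b) : ∃ k, a ≤ k ∧ k < b ∧ p k ≤ x ∧ x ≤ p (k + 1) := by
  induction b, hab using Nat.le_induction with
  | base => exact ⟨a, le_rfl, Nat.lt_succ_self a, ha, hb⟩
  | succ b hab ih =>
    rcases le_total x (p b) with h | h
    · obtain ⟨k, h1, h2, h3, h4⟩ := ih h
      exact ⟨k, h1, h2.trans (Nat.lt_succ_self b), h3, h4⟩
    · exact ⟨b, (Nat.le_succ a).trans hab, Nat.lt_succ_self b, h, hb⟩

/-- The maximal inequality of Young and Loève for almost additive functions of intervals. -/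
theorem norm_sum_sub_le_of_almost_additive {H : Type*} [NormedAddCommGroup H]
    {A : ℝ → ℝ → H} {T : Set ℝ} {K β : ℝ} (hβ : 1 < β) (hK : 0 ≤ K) (hA0 : ∀ x, A x x = 0)
    (hA : ∀ s ∈ T, ∀ u ∈ T, ∀ t ∈ T, s ≤ u → u ≤ t →
      ‖A s t - A s u - A u t‖ ≤ K * (t - s) ^ β)
    {p : ℕ → ℝ} (hp : Monotone p) (hpT : ∀ i, p i ∈ T) {a b : ℕ} (hab : a ≤ b) :
    ‖∑ i ∈ Finset.Ico a b, A (p i) (p (i + 1)) - A (p a) (p b)‖ ≤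
      2 * K / (1 - 2 ^ (1 - β)) * (p b - p a) ^ β := by
  have h2 : (2 : ℝ) ^ (1 - β) < 1 := Real.rpow_lt_one_of_one_lt_of_neg (by norm_num) (by linarith)
  -- `c` solves `c = c * 2 ^ (1 - β) + 2 * K`: two half-length blocks plus two additivity defects
  -- must reproduce the same constant.
  set c : ℝ := 2 * K / (1 - 2 ^ (1 - β)) with hc
  have hc0 : 0 ≤ c := div_nonneg (by linarith) (by linarith)
  have hcK : c * 2 ^ (1 - β) + 2 * K = c := by
    have : c * (1 - 2 ^ (1 - β)) = 2 * K := by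
      rw [hc]; exact div_mul_cancel₀ _ (by linarith)
    linarith
  -- Induction on an upper bound for the number of cells makes the hypothesis available for both
  -- shorter blocks.
  obtain ⟨d, hd⟩ : ∃ d, b - a ≤ d := ⟨_, le_rfl⟩
  induction d generalizing a b with
  | zero =>
    obtain rfl : a = b := by omega
    simp only [Finset.Ico_self, Finset.sum_empty, hA0, sub_self, norm_zero]
    exact mul_nonneg hc0 (Real.rpow_nonneg le_rfl _)
  | succ d ih =>
    rcases hab.eq_or_lt with rfl | hlt
    · simp only [Finset.Ico_self, Finset.sum_empty, hA0, sub_self, norm_zero]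
      exact mul_nonneg hc0 (Real.rpow_nonneg le_rfl _)
    have hpab := hp hab
    -- Cell `k` contains the midpoint, so the blocks to its left and to its right both have at most
    -- half the length. Detaching this cell costs two applications of almost additivity.
    obtain ⟨k, hak, hkb, hk1, hk2⟩ := exists_index_of_mem_Icc (p := p) hlt
      (x := (p a + p b) / 2) (by linarith) (by linarith)
    have e1 := ih hak (by omega)
    have e2 := ih (a := k + 1) (b := b) hkb (by omega)
    have d1 := hA _ (hpT a) _ (hpT k) _ (hpT b) (hp hak) (hp hkb.le)
    have d2 := hA _ (hpT k) _ (hpT (k + 1)) _ (hpT b) (hp k.le_succ) (hp hkb)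
    have hL : (0 : ℝ) ≤ p b - p a := by linarith
    have hhalf : ((p b - p a) / 2) ^ β = 2 ^ (1 - β) * (p b - p a) ^ β / 2 := by
      rw [Real.div_rpow hL (by norm_num), Real.rpow_sub (by norm_num), Real.rpow_one]
      field_simp
    have f1 : (p k - p a) ^ β ≤ ((p b - p a) / 2) ^ β :=
      Real.rpow_le_rpow (by linarith [hp hak]) (by linarith) (by linarith)
    have f2 : (p b - p (k + 1)) ^ β ≤ ((p b - p a) / 2) ^ β :=
      Real.rpow_le_rpow (by linarith [hp hkb]) (by linarith) (by linarith)
    have f3 : (p b - p k) ^ β ≤ (p b - p a) ^ β :=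
      Real.rpow_le_rpow (by linarith [hp hkb.le]) (by linarith [hp hak]) (by linarith)
    have hsum : ∑ i ∈ Finset.Ico a b, A (p i) (p (i + 1)) =
        ∑ i ∈ Finset.Ico a k, A (p i) (p (i + 1)) + A (p k) (p (k + 1)) +
          ∑ i ∈ Finset.Ico (k + 1) b, A (p i) (p (i + 1)) := by
      rw [← Finset.sum_Ico_consecutive _ hak hkb.le, Finset.sum_eq_sum_Ico_succ_bot hkb, add_assoc]
    have hdec : ∑ i ∈ Finset.Ico a b, A (p i) (p (i + 1)) - A (p a) (p b) =
        (∑ i ∈ Finset.Ico a k, A (p i) (p (i + 1)) - A (p a) (p k)) +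
        (∑ i ∈ Finset.Ico (k + 1) b, A (p i) (p (i + 1)) - A (p (k + 1)) (p b)) -
        (A (p a) (p b) - A (p a) (p k) - A (p k) (p b)) -
        (A (p k) (p b) - A (p k) (p (k + 1)) - A (p (k + 1)) (p b)) := by
      rw [hsum]; abel
    rw [hdec]
    refine (norm_sub_le _ _).trans ((add_le_add ((norm_sub_le _ _).trans
      (add_le_add ((norm_add_le _ _).trans (add_le_add e1 e2)) d1)) d2).trans ?_)
    have g1 := mul_le_mul_of_nonneg_left f1 hc0
    have g2 := mul_le_mul_of_nonneg_left f2 hc0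
    have g3 := mul_le_mul_of_nonneg_left f3 hK
    rw [hhalf] at g1 g2
    have : c * (p b - p a) ^ β =
        (c * 2 ^ (1 - β)) * (p b - p a) ^ β + 2 * K * (p b - p a) ^ β := by
      rw [← add_mul, hcK]
    rw [this]
    linarith

open scoped Classical in
/-- The value of a function of intervals on the intersection of `[a, b]` and `[c, d]`. -/
noncomputable def onInter {H : Type*} [Zero H] (A : ℝ → ℝ → H) (a b c d : ℝ) : H :=
  if max a c ≤ min b d then A (max a c) (min b d) else 0

theorem onInter_comm {H : Type*} [Zero H] (A : ℝ → ℝ → H) (a b c d : ℝ) :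
    onInter A a b c d = onInter A c d a b := by
  simp only [onInter, max_comm a c, min_comm b d]

/-- The symmetric form lets two partitions share one double sum. The clipped form is what the
maximal inequality needs: for fixed `a`, `b` the clipped points of a monotone sequence are again
monotone. Disjoint intervals clip to a single point, where `A` vanishes. -/
theorem onInter_eq_clip {H : Type*} [Zero H] {A : ℝ → ℝ → H} (hA0 : ∀ x, A x x = 0)
    {a b c d : ℝ} (hab : a ≤ b) (hcd : c ≤ d) :
    onInter A a b c d = A (max a (min c b)) (max a (min d b)) := by
  unfold onInter
  split_ifs with h
  · simp only [le_min_iff, max_le_iff] at h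
    rw [min_eq_left h.1.2, min_comm b d, max_eq_right (le_min h.2.1 h.1.1)]
  · rcases lt_or_ge d a with h1 | h1
    · rw [max_eq_left ((min_le_left _ _).trans (hcd.trans h1.le)),
        max_eq_left ((min_le_left _ _).trans h1.le), hA0]
    · have h2 : b < c := by
        by_contra! h2
        exact h (le_min (max_le hab h2) (max_le h1 hcd))
      rw [min_eq_right h2.le, min_eq_right (h2.le.trans hcd), hA0]

/-- Clipping the partition `q` to one cell of `p` partitions that cell, so the maximal inequality
applies cell by cell. This is the cost of passing from `p` to the common refinement, with no need to
enumerate the refinement. -/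
theorem norm_sum_onInter_sub_le {H : Type*} [NormedAddCommGroup H]
    {A : ℝ → ℝ → H} {T : ℝ} {K β : ℝ} (hβ : 1 < β) (hK : 0 ≤ K) (hA0 : ∀ x, A x x = 0)
    (hA : ∀ s ∈ Icc 0 T, ∀ u ∈ Icc 0 T, ∀ t ∈ Icc 0 T, s ≤ u → u ≤ t →
      ‖A s t - A s u - A u t‖ ≤ K * (t - s) ^ β)
    {p q : ℕ → ℝ} (hp : Monotone p) (hq : Monotone q) {N M : ℕ}
    (hp0 : p 0 = 0) (hpN : p N = T) (hq0 : q 0 = 0) (hqM : q M = T) :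
    ‖∑ i ∈ Finset.range N, A (p i) (p (i + 1)) -
      ∑ i ∈ Finset.range N, ∑ j ∈ Finset.range M, onInter A (p i) (p (i + 1)) (q j) (q (j + 1))‖ ≤
      2 * K / (1 - 2 ^ (1 - β)) * ∑ i ∈ Finset.range N, (p (i + 1) - p i) ^ β := by
  rw [← Finset.sum_sub_distrib, Finset.mul_sum]
  refine norm_sum_le_of_le _ fun i hi => ?_
  have hi := Finset.mem_range.1 hi
  have h0 : 0 ≤ p i := hp0 ▸ hp i.zero_le
  have h1 : p (i + 1) ≤ T := hpN ▸ hp hi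
  have h2 : p i ≤ p (i + 1) := hp i.le_succ
  have hmono : Monotone fun j => max (p i) (min (q j) (p (i + 1))) := fun j k hjk =>
    max_le_max le_rfl (min_le_min (hq hjk) le_rfl)
  have := norm_sum_sub_le_of_almost_additive hβ hK hA0 hA hmono
    (fun j => ⟨h0.trans (le_max_left _ _), max_le (h2.trans h1) ((min_le_right _ _).trans h1)⟩)
    M.zero_le
  rw [norm_sub_rev]
  simp only [hq0, hqM, min_eq_right h1, max_eq_right h2, min_eq_left (h0.trans h2),
    max_eq_left h0] at this
  rw [Finset.sum_congr rfl fun j _ => onInter_eq_clip hA0 h2 (hq j.le_succ), Finset.range_eq_Ico]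
  exact this

/-- Both sums are compared with the same double sum over intersections of cells. -/
theorem norm_sum_sub_sum_le {H : Type*} [NormedAddCommGroup H]
    {A : ℝ → ℝ → H} {T : ℝ} {K β : ℝ} (hβ : 1 < β) (hK : 0 ≤ K) (hA0 : ∀ x, A x x = 0)
    (hA : ∀ s ∈ Icc 0 T, ∀ u ∈ Icc 0 T, ∀ t ∈ Icc 0 T, s ≤ u → u ≤ t →
      ‖A s t - A s u - A u t‖ ≤ K * (t - s) ^ β)
    {p q : ℕ → ℝ} (hp : Monotone p) (hq : Monotone q) {N M : ℕ}
    (hp0 : p 0 = 0) (hpN : p N = T) (hq0 : q 0 = 0) (hqM : q M = T) :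
    ‖∑ i ∈ Finset.range N, A (p i) (p (i + 1)) - ∑ i ∈ Finset.range M, A (q i) (q (i + 1))‖ ≤
      2 * K / (1 - 2 ^ (1 - β)) * (∑ i ∈ Finset.range N, (p (i + 1) - p i) ^ β +
        ∑ i ∈ Finset.range M, (q (i + 1) - q i) ^ β) := by
  have h1 := norm_sum_onInter_sub_le hβ hK hA0 hA hp hq hp0 hpN hq0 hqM
  have h2 := norm_sum_onInter_sub_le hβ hK hA0 hA hq hp hq0 hqM hp0 hpN
  rw [Finset.sum_comm] at h2
  simp only [onInter_comm A (q _)] at h2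
  rw [norm_sub_rev] at h2
  rw [mul_add]
  exact (norm_sub_le_norm_sub_add_norm_sub _ _ _).trans (add_le_add h1 h2)

/-- A factor `δ ^ (β - 1)` comes out of each term and the remaining lengths telescope. As `β > 1`,
this makes the refinement cost vanish with the mesh. -/
theorem sum_rpow_le_of_mesh {β δ : ℝ} (hβ : 1 < β) {p : ℕ → ℝ} (hp : Monotone p) {N : ℕ}
    (hδ : ∀ i < N, p (i + 1) - p i ≤ δ) :
    ∑ i ∈ Finset.range N, (p (i + 1) - p i) ^ β ≤ δ ^ (β - 1) * (p N - p 0) := by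
  rw [← Finset.sum_range_sub, Finset.mul_sum]
  refine Finset.sum_le_sum fun i hi => ?_
  have h0 : 0 ≤ p (i + 1) - p i := sub_nonneg.2 (hp i.le_succ)
  have : (p (i + 1) - p i) ^ β = (p (i + 1) - p i) ^ (β - 1) * (p (i + 1) - p i) := by
    conv_rhs => rw [← Real.rpow_add_one' h0 (by linarith)]
    rw [sub_add_cancel]
  rw [this]
  exact mul_le_mul_of_nonneg_right
    (Real.rpow_le_rpow h0 (hδ i (Finset.mem_range.1 hi)) (by linarith)) h0

/-- Young's theorem: existence of the integral for Hölder continuous paths. -/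
theorem exists_isYoungIntegral {H : Type*} [NormedAddCommGroup H] [InnerProductSpace ℝ H]
    [CompleteSpace H] {g : ℝ → ℝ} {Y : ℝ → H} {K₁ K₂ τ ρ T : ℝ} (hK₁ : 0 ≤ K₁)
    (hK₂ : 0 ≤ K₂) (hτ : 0 ≤ τ) (hρ : 0 ≤ ρ) (hτρ : 1 < τ + ρ) (hT : 0 ≤ T)
    (hg : ∀ x ∈ Icc 0 T, ∀ y ∈ Icc 0 T, |g x - g y| ≤ K₁ * |x - y| ^ τ)
    (hY : ∀ x ∈ Icc 0 T, ∀ y ∈ Icc 0 T, ‖Y x - Y y‖ ≤ K₂ * |x - y| ^ ρ) :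
    ∃ J, IsYoungIntegral g Y 0 T J := by
  set β := τ + ρ with hβ
  set A : ℝ → ℝ → H := fun s t => g s • (Y t - Y s) with hAdef
  set K := K₁ * K₂ with hKdef
  have hK : 0 ≤ K := mul_nonneg hK₁ hK₂
  have hA0 : ∀ x, A x x = 0 := fun x => by simp [A]
  have hprod : ∀ s ∈ Icc 0 T, ∀ u ∈ Icc 0 T, ∀ v ∈ Icc 0 T, ∀ w ∈ Icc 0 T, ∀ d,
      |s - u| ≤ d → |v - w| ≤ d → ‖(g s - g u) • (Y v - Y w)‖ ≤ K * d ^ β := by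
    intro s hs u hu v hv w hw d h1 h2
    have hd : 0 ≤ d := (abs_nonneg _).trans h1
    rw [norm_smul, Real.norm_eq_abs, hβ, Real.rpow_add_of_nonneg hd hτ hρ]
    calc |g s - g u| * ‖Y v - Y w‖ ≤ (K₁ * |s - u| ^ τ) * (K₂ * |v - w| ^ ρ) :=
          mul_le_mul (hg s hs u hu) (hY v hv w hw) (norm_nonneg _) (by positivity)
      _ ≤ (K₁ * d ^ τ) * (K₂ * d ^ ρ) := by gcongr
      _ = K * (d ^ τ * d ^ ρ) := by rw [hKdef]; ring
  have hA : ∀ s ∈ Icc 0 T, ∀ u ∈ Icc 0 T, ∀ t ∈ Icc 0 T, s ≤ u → u ≤ t →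
      ‖A s t - A s u - A u t‖ ≤ K * (t - s) ^ β := by
    intro s hs u hu t ht hsu hut
    have : A s t - A s u - A u t = (g s - g u) • (Y t - Y u) := by
      simp only [A, smul_sub, sub_smul]; abel
    rw [this]
    exact hprod s hs u hu t ht u hu _ (by rw [abs_sub_comm, abs_of_nonneg] <;> linarith)
      (by rw [abs_of_nonneg] <;> linarith)
  set c : ℝ := 2 * K / (1 - 2 ^ (1 - β)) with hc
  have h2 : (2 : ℝ) ^ (1 - β) < 1 := Real.rpow_lt_one_of_one_lt_of_neg (by norm_num) (by linarith)
  have hc0 : 0 ≤ c := div_nonneg (by linarith) (by linarith)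
  -- The integral is constructed as the limit along uniform partitions; every other partition is
  -- then compared with these.
  set q : ℕ → ℕ → ℝ := fun n i => i * (T / (n + 1)) with hq
  have hqm : ∀ n, Monotone (q n) := fun n i j hij => by simp only [q]; gcongr
  have hq0 : ∀ n, q n 0 = 0 := fun n => by simp [q]
  have hqT : ∀ n, q n (n + 1) = T := fun n => by
    simp only [q]; push_cast; field_simp
  have hqd : ∀ n i, q n (i + 1) - q n i = T / (n + 1) := fun n i => by
    simp only [q]; push_cast; ring
  set R : ℕ → H := fun n => ∑ i ∈ Finset.range (n + 1), A (q n i) (q n (i + 1)) with hR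
  have hqs : ∀ n m, n ≤ m → ∑ i ∈ Finset.range (m + 1), (q m (i + 1) - q m i) ^ β ≤
      (T / (n + 1)) ^ (β - 1) * T := fun n m hnm => by
    have := sum_rpow_le_of_mesh (δ := T / (n + 1)) hτρ (hqm m) (N := m + 1) (fun i _ => by
      rw [hqd]; gcongr)
    rwa [hq0, hqT, sub_zero] at this
  have hlim : Tendsto (fun n : ℕ => T / ((n : ℝ) + 1)) atTop (𝓝 0) := by
    have := (tendsto_one_div_add_atTop_nhds_zero_nat (𝕜 := ℝ)).const_mul T
    simpa [div_eq_mul_inv] using this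
  have hlim2 : Tendsto (fun n : ℕ => c * (2 * ((T / ((n : ℝ) + 1)) ^ (β - 1) * T))) atTop
      (𝓝 0) := by
    have := (((hlim.rpow_const (p := β - 1) (Or.inr (by linarith))).mul_const T).const_mul
      2).const_mul c
    rwa [Real.zero_rpow (by linarith), zero_mul, mul_zero, mul_zero] at this
  have hcauchy : CauchySeq R := by
    refine cauchySeq_of_le_tendsto_0' (fun n : ℕ => c * (2 * ((T / ((n : ℝ) + 1)) ^ (β - 1) * T)))
      (fun n m hnm => ?_) hlim2
    rw [dist_eq_norm]
    refine (norm_sum_sub_sum_le hτρ hK hA0 hA (hqm n) (hqm m) (hq0 n) (hqT n) (hq0 m)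
      (hqT m)).trans (mul_le_mul_of_nonneg_left ?_ hc0)
    linarith [hqs n n le_rfl, hqs n m hnm]
  obtain ⟨J, hJ⟩ := cauchySeq_tendsto_of_complete hcauchy
  refine ⟨J, fun ε hε => ?_⟩
  have hlim3 : Tendsto (fun δ : ℝ => (K + c) * (δ ^ (β - 1) * T)) (𝓝[>] 0) (𝓝 0) := by
    have := ((((continuous_id.tendsto (0 : ℝ)).rpow_const (p := β - 1)
      (Or.inr (by linarith))).mul_const T).const_mul (K + c))
    simp only [id, Real.zero_rpow (sub_pos.2 hτρ).ne', zero_mul, mul_zero] at this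
    exact this.mono_left nhdsWithin_le_nhds
  obtain ⟨δ, hδε, hδ⟩ := ((hlim3.eventually (gt_mem_nhds (half_pos hε))).and
    self_mem_nhdsWithin).exists
  refine ⟨δ, hδ, fun N p x hp hp0 hpN hpx => ?_⟩
  have hpT : ∀ i ≤ N, p i ∈ Icc 0 T := fun i hi => ⟨hp0 ▸ hp i.zero_le, hpN ▸ hp hi⟩
  have hps := sum_rpow_le_of_mesh (δ := δ) hτρ hp (N := N) (fun i hi => (hpx i hi).1.le)
  rw [hpN, hp0, sub_zero] at hps
  -- Moving the tags to the left endpoints costs `K δ ^ β` per cell at most, in the finer form `K`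
  -- times the length to the power `β`, which is summable in the mesh.
  have e1 : ‖∑ i ∈ Finset.range N, g (x i) • (Y (p (i + 1)) - Y (p i)) -
      ∑ i ∈ Finset.range N, A (p i) (p (i + 1))‖ ≤ K * (δ ^ (β - 1) * T) := by
    rw [← Finset.sum_sub_distrib]
    refine (norm_sum_le_of_le _ (fun i hi => ?_)).trans
      ((Finset.mul_sum _ _ _).symm.le.trans (mul_le_mul_of_nonneg_left hps hK))
    have hi := Finset.mem_range.1 hi
    obtain ⟨-, hx1, hx2⟩ := hpx i hi
    rw [← sub_smul]
    have h3 := hpT i hi.le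
    have h4 := hpT (i + 1) hi
    exact hprod _ ⟨h3.1.trans hx1, hx2.trans h4.2⟩ _ h3 _ h4 _ h3 _
      (by rw [abs_of_nonneg] <;> linarith) (by rw [abs_of_nonneg]; linarith [hp i.le_succ])
  have e2 : ‖∑ i ∈ Finset.range N, A (p i) (p (i + 1)) - J‖ ≤ c * (δ ^ (β - 1) * T) := by
    have hl : Tendsto (fun n : ℕ => c * (δ ^ (β - 1) * T + (T / ((n : ℝ) + 1)) ^ (β - 1) * T))
        atTop (𝓝 (c * (δ ^ (β - 1) * T))) := by
      have := ((((hlim.rpow_const (p := β - 1) (Or.inr (by linarith))).mul_const T).const_add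
        (δ ^ (β - 1) * T))).const_mul c
      rwa [Real.zero_rpow (by linarith), zero_mul, add_zero] at this
    refine le_of_tendsto_of_tendsto' ((tendsto_const_nhds.sub hJ).norm) hl fun n => ?_
    refine (norm_sum_sub_sum_le hτρ hK hA0 hA hp (hqm n) hp0 hpN (hq0 n) (hqT n)).trans
      (mul_le_mul_of_nonneg_left ?_ hc0)
    linarith [hqs n n le_rfl]
  refine (norm_sub_le_norm_sub_add_norm_sub _ _ _).trans_lt ((add_le_add e1 e2).trans_lt ?_)
  rw [← add_mul]
  linarith

/-! ### Non-degeneracy: from Riemann sums to Young integrals -/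

/-- The full sum is `v + w` with `w` in the outer space, so its norm is at least the distance from
`v` to that space, and the block-form assumption bounds this distance below. Only rational times
enter, which keeps the almost sure hypothesis on increments countable. -/
theorem block_riemannSum_le {H ι : Type*} [NormedAddCommGroup H] [InnerProductSpace ℝ H]
    [CompleteSpace H] {e : HilbertBasis ι ℝ H} {n : ℕ} {f : ℝ → TensorPow ι n} {α : ℝ}
    (hblock : BlockForm e f α) {Y : ℝ → H}
    (hY : ∀ s t : ℚ, 0 ≤ s → s ≤ t → t ≤ 1 → Y t - Y s ∈ incrementSpace e f s t)
    (a : ℕ → ℝ) {m N : ℕ} (hm : m ≤ N) (hN : 0 < N) :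
    Real.sqrt α * ‖∑ i ∈ Finset.range m, a i • (Y ((i + 1 : ℕ) / N) - Y (i / N))‖ ≤
      ‖∑ i ∈ Finset.range N, a i • (Y ((i + 1 : ℕ) / N) - Y (i / N))‖ := by
  obtain ⟨hα0, -, hb⟩ := hblock
  have hN' : (0 : ℝ) < N := by exact_mod_cast hN
  have hinc : ∀ i < N, Y ((i + 1 : ℕ) / N) - Y (i / N) ∈
      incrementSpace e f (i / N) ((i + 1 : ℕ) / N) := fun i hi => by
    have hNq : (0 : ℚ) < N := by exact_mod_cast hN
    have := hY (i / N) ((i + 1 : ℕ) / N) (by positivity) (by gcongr; omega)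
      ((div_le_one hNq).2 (by exact_mod_cast hi))
    push_cast at this ⊢
    exact this
  set v := ∑ i ∈ Finset.range m, a i • (Y ((i + 1 : ℕ) / N) - Y (i / N)) with hv
  by_cases hv0 : v = 0
  · rw [hv0, norm_zero, mul_zero]; exact norm_nonneg _
  let t : Fin (m + 1) → ℝ := fun i => (i : ℕ) / N
  -- The block starts at time `0`, so the left subdivision is trivial and the outer space is
  -- generated by the cells after index `m` alone.
  let s : Fin (0 + 1) → ℝ := fun _ => 0
  let r : Fin (N - m + 1) → ℝ := fun i => (m + (i : ℕ) : ℕ) / N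
  have hvt : v = ∑ i : Fin m, a i • (Y ((i + 1 : ℕ) / N) - Y ((i : ℕ) / N)) :=
    Finset.sum_range _
  have key := hb m 0 (N - m) t s r (fun i => a i)
    (fun i => Y ((i + 1 : ℕ) / N) - Y ((i : ℕ) / N))
    (fun i j hij => by simp only [t]; gcongr; exact hij)
    (by simp [t]) ((div_le_one hN').2 (by simpa using hm))
    (fun i j hij => absurd hij (by have := i.2; have := j.2; simp only [Fin.lt_def]; omega)) rfl
    (by simp [t, s])
    (fun i j hij => by simp only [r]; gcongr; exact hij)
    (by simp [t, r]) ((div_le_one hN').2 (by simp [Nat.add_sub_cancel' hm]))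
    (fun i => by simpa [t] using hinc i (i.2.trans_le hm)) (by rwa [← hvt])
  rw [← hvt] at key
  set w := ∑ i ∈ Finset.range (N - m), a (m + i) • (Y ((m + i + 1 : ℕ) / N) - Y ((m + i : ℕ) / N))
    with hw
  have hsum : ∑ i ∈ Finset.range N, a i • (Y ((i + 1 : ℕ) / N) - Y (i / N)) = v + w := by
    have := Finset.sum_range_add (fun i : ℕ => a i • (Y ((i + 1 : ℕ) / N) - Y (i / N))) m (N - m)
    rw [Nat.add_sub_cancel' hm] at this
    exact this
  have hwm : w ∈ outerSpace e f s r := by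
    refine Submodule.le_topologicalClosure _ (Submodule.mem_sup_right ?_)
    rw [hw, Finset.sum_range]
    refine Submodule.sum_mem _ fun i _ => Submodule.smul_mem _ _ ?_
    refine Submodule.mem_iSup_of_mem i ?_
    have := hinc (m + i) (by omega)
    simpa [r, add_assoc] using this
  -- The projection minimizes the distance to the outer space, and `-w` is a competitor.
  have hle : ‖v - (outerSpace e f s r).starProjection v‖ ≤ ‖v + w‖ := by
    rw [Submodule.starProjection_minimal]
    refine (ciInf_le ⟨0, ?_⟩ (⟨-w, Submodule.neg_mem _ hwm⟩ : outerSpace e f s r)).trans ?_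
    · rintro _ ⟨x, rfl⟩; exact norm_nonneg _
    · simp
  rw [hsum]
  refine abs_le_of_sq_le_sq' ?_ (norm_nonneg _) |>.2
  rw [mul_pow, Real.sq_sqrt hα0.le]
  exact key.le.trans (pow_le_pow_left₀ (norm_nonneg _) hle 2)

/-- Non-degeneracy passes from Riemann sums over rational partitions to Young integrals. -/
theorem block_youngIntegral_le {H ι : Type*} [NormedAddCommGroup H] [InnerProductSpace ℝ H]
    [CompleteSpace H] {e : HilbertBasis ι ℝ H} {n : ℕ} {f : ℝ → TensorPow ι n} {α : ℝ}
    (hblock : BlockForm e f α) {g : ℝ → ℝ} {Y : ℝ → H}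
    (hY : ∀ s t : ℚ, 0 ≤ s → s ≤ t → t ≤ 1 → Y t - Y s ∈ incrementSpace e f s t)
    (hYc : ContinuousOn Y (Icc 0 1)) {B : ℝ} (hg : ∀ x ∈ Icc (0 : ℝ) 1, |g x| ≤ B)
    {t : ℝ} (ht : t ∈ Icc (0 : ℝ) 1) {I J : H} (hI : IsYoungIntegral g Y 0 t I)
    (hJ : IsYoungIntegral g Y 0 1 J) : Real.sqrt α * ‖I‖ ≤ ‖J‖ := by
  set S : ℕ → ℕ → H := fun N m =>
    ∑ i ∈ Finset.range m, g (i / N) • (Y ((i + 1 : ℕ) / N) - Y (i / N)) with hS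
  have hinv : Tendsto (fun N : ℕ => ((N : ℝ))⁻¹) atTop (𝓝 0) := tendsto_inv_atTop_nhds_zero_nat
  have hJlim : Tendsto (fun N => S N N) atTop (𝓝 J) := by
    rw [Metric.tendsto_atTop']
    intro ε hε
    obtain ⟨δ, hδ, h⟩ := hJ ε hε
    obtain ⟨N₀, hN₀⟩ := eventually_atTop.1 (hinv.eventually (gt_mem_nhds hδ))
    refine ⟨N₀, fun N hN => ?_⟩
    have hN' : (0 : ℝ) < N := by exact_mod_cast N₀.zero_le.trans_lt hN
    rw [dist_eq_norm]
    refine h N (fun i => i / N) (fun i => i / N) (fun i j hij => by simp only; gcongr)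
      (by simp) (div_self hN'.ne') fun i _ => ⟨?_, le_rfl, by gcongr; simp⟩
    have : ((i + 1 : ℕ) : ℝ) / N - i / N = (N : ℝ)⁻¹ := by push_cast; field_simp; ring
    rw [this]
    exact hN₀ N hN.le
  have hfloor : ∀ N : ℕ, 0 < N → (⌊t * N⌋₊ : ℝ) / N ≤ t ∧ t < (⌊t * N⌋₊ + 1 : ℕ) / N ∧
      (⌊t * N⌋₊ : ℝ) / N ∈ Icc (0 : ℝ) 1 := fun N hN => by
    have hN' : (0 : ℝ) < N := by exact_mod_cast hN
    have h1 : (⌊t * N⌋₊ : ℝ) / N ≤ t :=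
      (div_le_iff₀ hN').2 (Nat.floor_le (mul_nonneg ht.1 hN'.le))
    refine ⟨h1, (lt_div_iff₀ hN').2 (by push_cast; exact Nat.lt_floor_add_one _),
      by positivity, h1.trans ht.2⟩
  have hfl : Tendsto (fun N : ℕ => (⌊t * N⌋₊ : ℝ) / N) atTop (𝓝[Icc 0 1] t) := by
    refine tendsto_nhdsWithin_iff.2 ⟨?_, ?_⟩
    · refine (tendsto_nat_floor_mul_div_atTop ht.1).comp tendsto_natCast_atTop_atTop
    · filter_upwards [eventually_gt_atTop 0] with N hN using (hfloor N hN).2.2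
  have hYlim : Tendsto (fun N : ℕ => ‖Y t - Y (⌊t * N⌋₊ / N)‖) atTop (𝓝 0) := by
    have := (tendsto_const_nhds (x := Y t)).sub ((hYc t ht).tendsto.comp hfl)
    rw [sub_self] at this
    simpa using this.norm
  have hIlim : Tendsto (fun N => S N ⌊t * N⌋₊) atTop (𝓝 I) := by
    rw [Metric.tendsto_atTop']
    intro ε hε
    obtain ⟨δ, hδ, h⟩ := hI (ε / 2) (half_pos hε)
    have hBY := hYlim.const_mul B
    rw [mul_zero] at hBY
    obtain ⟨N₀, hN₀⟩ := eventually_atTop.1 ((hinv.eventually (gt_mem_nhds hδ)).and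
      (hBY.eventually (gt_mem_nhds (half_pos hε))))
    refine ⟨N₀, fun N hN => ?_⟩
    have hNpos : 0 < N := N₀.zero_le.trans_lt hN
    have hN' : (0 : ℝ) < N := by exact_mod_cast hNpos
    obtain ⟨f1, f2, f3⟩ := hfloor N hNpos
    set m := ⌊t * N⌋₊ with hm
    -- The grid capped at `t` is a partition of `[0, t]` with `m + 1` cells. Its last cell `[m/N,
    -- t]` is not a cell of the grid; its contribution tends to zero by continuity of `Y` and
    -- boundedness of `g`.
    set p : ℕ → ℝ := fun i => min (i / N) t with hp
    have hpm : Monotone p := fun i j hij => by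
      simp only [p]; exact min_le_min (by gcongr) le_rfl
    have hpi : ∀ i ≤ m, p i = i / N := fun i hi =>
      min_eq_left (le_trans (by gcongr) f1)
    have hpl : p (m + 1) = t := min_eq_right f2.le
    have key := h (m + 1) p p hpm (by rw [hpi 0 m.zero_le]; simp) hpl fun i hi => ⟨?_, le_rfl,
      hpm i.le_succ⟩
    · rw [Finset.sum_range_succ, hpl, hpi m le_rfl] at key
      have e1 : ∑ i ∈ Finset.range m, g (p i) • (Y (p (i + 1)) - Y (p i)) = S N m := by
        refine Finset.sum_congr rfl fun i hi => ?_
        have hi := Finset.mem_range.1 hi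
        rw [hpi i hi.le, hpi (i + 1) hi]
      rw [e1] at key
      rw [dist_eq_norm]
      have e2 : S N m - I = (S N m + g (m / N) • (Y t - Y (m / N)) - I) -
        g (m / N) • (Y t - Y (m / N)) := by abel
      rw [e2]
      refine (norm_sub_le _ _).trans_lt ?_
      have e3 : ‖g (m / N) • (Y t - Y (m / N))‖ < ε / 2 := by
        rw [norm_smul, Real.norm_eq_abs]
        exact (mul_le_mul_of_nonneg_right (hg _ f3) (norm_nonneg _)).trans_lt (hN₀ N hN.le).2
      linarith
    · have hi' : i ≤ m := Nat.lt_succ_iff.1 hi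
      rw [hpi i hi']
      have e4 : p (i + 1) ≤ (i + 1 : ℕ) / N := min_le_left _ _
      have : ((i + 1 : ℕ) : ℝ) / N - i / N = (N : ℝ)⁻¹ := by push_cast; field_simp; ring
      linarith [(hN₀ N hN.le).1]
  refine le_of_tendsto_of_tendsto (hIlim.norm.const_mul _) hJlim.norm ?_
  filter_upwards [eventually_gt_atTop 0] with N hN
  refine block_riemannSum_le hblock hY (fun i => g (i / N)) ?_ hN
  have h1 : (⌊t * N⌋₊ : ℝ) ≤ N := (Nat.floor_le (mul_nonneg ht.1 N.cast_nonneg)).trans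
    (mul_le_of_le_one_left N.cast_nonneg ht.2)
  exact_mod_cast h1

/-! ### Hölder continuous modifications -/

theorem holderOnWith_of_dist_le {H : Type*} [NormedAddCommGroup H] {y : ℝ → H} {s : Set ℝ}
    {K : ℝ} (hK : 0 ≤ K) {r : ℝ≥0}
    (h : ∀ a ∈ s, ∀ b ∈ s, ‖y a - y b‖ ≤ K * |a - b| ^ (r : ℝ)) :
    HolderOnWith K.toNNReal r y s := by
  intro a ha b hb
  rw [edist_dist, edist_dist, dist_eq_norm, Real.dist_eq,
    ENNReal.ofReal_rpow_of_nonneg (abs_nonneg _) r.coe_nonneg]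
  exact (ENNReal.ofReal_le_ofReal (h a ha b hb)).trans_eq (ENNReal.ofReal_mul hK)

theorem norm_sub_le_of_holderOnWith {H : Type*} [NormedAddCommGroup H] {y : ℝ → H} {s : Set ℝ}
    {K r : ℝ≥0} (h : HolderOnWith K r y s) {a b : ℝ} (ha : a ∈ s) (hb : b ∈ s) :
    ‖y a - y b‖ ≤ K * |a - b| ^ (r : ℝ) := by
  have := h a ha b hb
  rw [edist_dist, edist_dist, dist_eq_norm, Real.dist_eq,
    ENNReal.ofReal_rpow_of_nonneg (abs_nonneg _) r.coe_nonneg, ← ENNReal.ofReal_coe_nnreal,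
    ← ENNReal.ofReal_mul K.coe_nonneg] at this
  exact (ENNReal.ofReal_le_ofReal_iff (by positivity)).1 this

/-- The dyadic approximation from below of level `n`. -/
noncomputable def dyadicFloor (n : ℕ) (t : ℝ) : ℝ := ⌊t * 2 ^ n⌋₊ / 2 ^ n

theorem dyadicFloor_mem {n : ℕ} {t : ℝ} (ht : t ∈ Icc (0 : ℝ) 1) :
    dyadicFloor n t ∈ Icc (0 : ℝ) 1 ∧ dyadicFloor n t ≤ t ∧ t - dyadicFloor n t ≤ (1 / 2) ^ n := by
  have h0 : (0 : ℝ) < 2 ^ n := by positivity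
  have h1 : dyadicFloor n t ≤ t :=
    (div_le_iff₀ h0).2 (Nat.floor_le (mul_nonneg ht.1 h0.le))
  refine ⟨⟨by unfold dyadicFloor; positivity, h1.trans ht.2⟩, h1, ?_⟩
  have h2 : t ≤ (⌊t * 2 ^ n⌋₊ + 1) / 2 ^ n := (le_div_iff₀ h0).2 (Nat.lt_floor_add_one _).le
  rw [add_div] at h2
  rw [one_div, inv_pow, ← one_div]
  unfold dyadicFloor
  linarith

theorem tendsto_dyadicFloor {t : ℝ} (ht : t ∈ Icc (0 : ℝ) 1) :
    Tendsto (fun n => |dyadicFloor n t - t|) atTop (𝓝 0) := by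
  refine squeeze_zero (fun n => abs_nonneg _) (fun n => ?_)
    (tendsto_pow_atTop_nhds_zero_of_lt_one (r := (1 / 2 : ℝ)) (by norm_num) (by norm_num))
  obtain ⟨-, h1, h2⟩ := dyadicFloor_mem (n := n) ht
  rw [abs_sub_comm, abs_of_nonneg] <;> linarith

/-! ### Chaining along dyadic points -/

section Chaining
variable {H : Type*} [NormedAddCommGroup H] {v : ℝ → H} {S b : ℝ}

/-- Points at distance at most one cell have equal or adjacent dyadic floors. -/
theorem norm_dyadicFloor_sub_le (hb : 0 ≤ b) (hS : 0 ≤ S)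
    (hv : ∀ n k : ℕ, k < 2 ^ n → ‖v ((k + 1 : ℕ) / 2 ^ n) - v (k / 2 ^ n)‖ ≤ S * b ^ n)
    {n : ℕ} {s t : ℝ} (hs : s ∈ Icc (0 : ℝ) 1) (ht : t ∈ Icc (0 : ℝ) 1) (hst : s ≤ t)
    (hd : t - s ≤ (1 / 2) ^ n) :
    ‖v (dyadicFloor n t) - v (dyadicFloor n s)‖ ≤ S * b ^ n := by
  have h0 : (0 : ℝ) < 2 ^ n := by positivity
  have h1 : ⌊s * 2 ^ n⌋₊ ≤ ⌊t * 2 ^ n⌋₊ := by gcongr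
  have h2 : ⌊t * 2 ^ n⌋₊ ≤ ⌊s * 2 ^ n⌋₊ + 1 := by
    rw [← Nat.floor_add_one (mul_nonneg hs.1 h0.le)]
    refine Nat.floor_le_floor ?_
    have : (t - s) * 2 ^ n ≤ 1 := by
      calc (t - s) * 2 ^ n ≤ (1 / 2) ^ n * 2 ^ n := by gcongr
        _ = 1 := by rw [← mul_pow]; norm_num
    linarith
  have h3 : ⌊t * 2 ^ n⌋₊ ≤ 2 ^ n := by
    refine Nat.floor_le_of_le ?_
    push_cast
    exact mul_le_of_le_one_left h0.le ht.2
  unfold dyadicFloor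
  rcases h1.eq_or_lt with h | h
  · rw [h, sub_self, norm_zero]; positivity
  · have h4 : ⌊t * 2 ^ n⌋₊ = ⌊s * 2 ^ n⌋₊ + 1 := by omega
    rw [h4]
    exact hv n _ (by omega)

theorem norm_dyadicFloor_succ_sub_le (hb : 0 ≤ b) (hb1 : b ≤ 1) (hS : 0 ≤ S)
    (hv : ∀ n k : ℕ, k < 2 ^ n → ‖v ((k + 1 : ℕ) / 2 ^ n) - v (k / 2 ^ n)‖ ≤ S * b ^ n)
    {t : ℝ} (ht : t ∈ Icc (0 : ℝ) 1) (n : ℕ) :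
    ‖v (dyadicFloor n t) - v (dyadicFloor (n + 1) t)‖ ≤ S * b ^ n := by
  have h0 : (0 : ℝ) < 2 ^ n := by positivity
  have h4 := dyadicFloor_mem (n := n) ht
  have h5 : dyadicFloor (n + 1) (dyadicFloor n t) = dyadicFloor n t := by
    have : (⌊t * 2 ^ n⌋₊ : ℝ) / 2 ^ n * 2 ^ (n + 1) = (⌊t * 2 ^ n⌋₊ * 2 : ℕ) := by
      push_cast; field_simp; ring
    rw [dyadicFloor, dyadicFloor, this, Nat.floor_natCast]
    push_cast; field_simp; ring
  -- Either `t` lies beyond the midpoint of its cell of level `n`, and its finer floor is that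
  -- midpoint, or `t` is within one finer cell of its coarse floor. In both cases the two floors
  -- differ by at most one cell of level `n + 1`.
  rcases lt_or_ge ((1 / 2 : ℝ) ^ (n + 1)) (t - dyadicFloor n t) with h | h
  · have h6 : dyadicFloor n t + (1 / 2) ^ (n + 1) ∈ Icc (0 : ℝ) 1 :=
      ⟨add_nonneg h4.1.1 (by positivity), by linarith [ht.2]⟩
    have h7 : dyadicFloor (n + 1) (dyadicFloor n t + (1 / 2) ^ (n + 1)) =
        dyadicFloor (n + 1) t := by
      have e1 : (dyadicFloor n t + (1 / 2) ^ (n + 1)) * 2 ^ (n + 1) =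
          (⌊t * 2 ^ n⌋₊ * 2 + 1 : ℕ) := by
        have : (1 / 2 : ℝ) ^ (n + 1) * 2 ^ (n + 1) = 1 := by rw [← mul_pow]; norm_num
        rw [add_mul, this]
        unfold dyadicFloor
        push_cast; field_simp; ring
      have e2 : ⌊t * 2 ^ (n + 1)⌋₊ = ⌊t * 2 ^ n⌋₊ * 2 + 1 := by
        rw [Nat.floor_eq_iff (by have := ht.1; positivity)]
        constructor
        · rw [← e1]; gcongr; linarith
        · have := Nat.lt_floor_add_one (t * 2 ^ n)
          push_cast
          rw [pow_succ]
          linarith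
      rw [dyadicFloor, e1, Nat.floor_natCast, dyadicFloor, e2]
    have h8 := norm_dyadicFloor_sub_le hb hS hv (n := n + 1) h4.1 h6 (by simp) (by simp)
    rw [h5, h7] at h8
    rw [norm_sub_rev]
    exact h8.trans (mul_le_mul_of_nonneg_left (pow_le_pow_of_le_one hb hb1 n.le_succ) hS)
  · have h8 := norm_dyadicFloor_sub_le hb hS hv (n := n + 1) h4.1 ht h4.2.1 h
    rw [h5] at h8
    rw [norm_sub_rev]
    exact h8.trans (mul_le_mul_of_nonneg_left (pow_le_pow_of_le_one hb hb1 n.le_succ) hS)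

theorem tendsto_dyadic_limUnder [CompleteSpace H] (hb : 0 ≤ b) (hb1 : b < 1) (hS : 0 ≤ S)
    (hv : ∀ n k : ℕ, k < 2 ^ n → ‖v ((k + 1 : ℕ) / 2 ^ n) - v (k / 2 ^ n)‖ ≤ S * b ^ n)
    {t : ℝ} (ht : t ∈ Icc (0 : ℝ) 1) :
    Tendsto (fun n => v (dyadicFloor n t)) atTop
      (𝓝 (limUnder atTop fun n => v (dyadicFloor n t))) :=
  (cauchySeq_of_le_geometric b S hb1 fun n => by
    rw [dist_eq_norm]; exact norm_dyadicFloor_succ_sub_le hb hb1.le hS hv ht n).tendsto_limUnder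

theorem norm_dyadic_limUnder_sub_le [CompleteSpace H] {r : ℝ} (hr : 0 < r) (hS : 0 ≤ S)
    (hv : ∀ n k : ℕ, k < 2 ^ n →
      ‖v ((k + 1 : ℕ) / 2 ^ n) - v (k / 2 ^ n)‖ ≤ S * ((1 / 2 : ℝ) ^ r) ^ n) :
    ∃ K, 0 ≤ K ∧ ∀ s ∈ Icc (0 : ℝ) 1, ∀ t ∈ Icc (0 : ℝ) 1,
      ‖limUnder atTop (fun n => v (dyadicFloor n s)) -
        limUnder atTop (fun n => v (dyadicFloor n t))‖ ≤ K * |s - t| ^ r := by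
  set b : ℝ := (1 / 2 : ℝ) ^ r with hb
  have hb0 : 0 < b := Real.rpow_pos_of_pos (by norm_num) _
  have hb1 : b < 1 := Real.rpow_lt_one (by norm_num) (by norm_num) hr
  have h1b : 0 < 1 - b := sub_pos.2 hb1
  set M := (1 + 2 / (1 - b)) * S with hM
  have hM0 : 0 ≤ M := by positivity
  have hK0 : 0 ≤ M / b := by positivity
  refine ⟨M / b, hK0, ?_⟩
  suffices h : ∀ s ∈ Icc (0 : ℝ) 1, ∀ t ∈ Icc (0 : ℝ) 1, s < t →
      ‖limUnder atTop (fun n => v (dyadicFloor n s)) -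
        limUnder atTop (fun n => v (dyadicFloor n t))‖ ≤ M / b * |s - t| ^ r by
    intro s hs t ht
    rcases lt_trichotomy s t with h1 | rfl | h1
    · exact h s hs t ht h1
    · rw [sub_self, norm_zero]; positivity
    · rw [norm_sub_rev, abs_sub_comm]; exact h t ht s hs h1
  intro s hs t ht hst
  -- The level is matched to the distance: `2^{-(n+1)} < t - s ≤ 2^{-n}`. The constant `M` collects
  -- one step at level `n` and two geometric tails; dividing by `b` pays for passing from `b ^ n` to
  -- `b ^ (n + 1)`.
  obtain ⟨n, hn1, hn2⟩ := exists_nat_pow_near_of_lt_one (x := t - s) (y := (1 / 2 : ℝ))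
    (by linarith) (by linarith [hs.1, ht.2]) (by norm_num) (by norm_num)
  have tail : ∀ x ∈ Icc (0 : ℝ) 1, dist (v (dyadicFloor n x))
      (limUnder atTop (fun n => v (dyadicFloor n x))) ≤ S * b ^ n / (1 - b) := fun x hx =>
    dist_le_of_le_geometric_of_tendsto b S hb1 (fun n => by
      rw [dist_eq_norm]; exact norm_dyadicFloor_succ_sub_le hb0.le hb1.le hS hv hx n)
      (tendsto_dyadic_limUnder hb0.le hb1 hS hv hx) n
  have hmid := norm_dyadicFloor_sub_le hb0.le hS hv (n := n) hs ht hst.le hn2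
  rw [← dist_eq_norm] at hmid
  have htot := (dist_triangle4 (limUnder atTop fun n => v (dyadicFloor n t)) (v (dyadicFloor n t))
    (v (dyadicFloor n s)) (limUnder atTop fun n => v (dyadicFloor n s))).trans
    (add_le_add (add_le_add ((dist_comm _ _).trans_le (tail t ht)) hmid) (tail s hs))
  rw [norm_sub_rev, ← dist_eq_norm, abs_sub_comm, abs_of_pos (sub_pos.2 hst)]
  have hbn : b ^ (n + 1) ≤ (t - s) ^ r := by
    rw [hb, ← Real.rpow_mul_natCast (by norm_num), mul_comm, Real.rpow_natCast_mul (by norm_num)]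
    exact Real.rpow_le_rpow (by positivity) hn1.le hr.le
  calc _ ≤ S * b ^ n / (1 - b) + S * b ^ n + S * b ^ n / (1 - b) := htot
    _ = M / b * b ^ (n + 1) := by rw [hM]; field_simp; ring
    _ ≤ M / b * (t - s) ^ r := by gcongr

end Chaining

/-- There are `2 ^ n` increments at level `n`. For `p` large enough each one, normalized by `b ^ n`,
has its moment of order `2p` at most a constant times `4 ^ (-n)`, so the sum of all normalized
powers has finite expectation and is almost surely finite. -/
theorem ae_exists_dyadic_bound {Ω : Type*} [MeasurableSpace Ω] {P : Measure Ω}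
    {H : Type*} [NormedAddCommGroup H] {V : ℝ → Ω → H} {κ : ℝ}
    (hV : ∀ t ∈ Icc (0 : ℝ) 1, AEStronglyMeasurable (V t) P)
    (hmom : ∀ p : ℕ, 0 < p → ∃ C : ℝ, 0 ≤ C ∧ ∀ s ∈ Icc (0 : ℝ) 1, ∀ t ∈ Icc (0 : ℝ) 1, s < t →
      eLpNorm (fun ω => V t ω - V s ω) (2 * p : ℕ) P ≤ ENNReal.ofReal (C * (t - s) ^ κ))
    {r : ℝ} (hr : r < κ) :
    ∀ᵐ ω ∂P, ∃ S : ℝ, 0 ≤ S ∧ ∀ n k : ℕ, k < 2 ^ n →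
      ‖V ((k + 1 : ℕ) / 2 ^ n) ω - V (k / 2 ^ n) ω‖ ≤ S * ((1 / 2 : ℝ) ^ r) ^ n := by
  set a : ℝ := (1 / 2 : ℝ) ^ (κ - r) with ha
  have ha0 : 0 < a := Real.rpow_pos_of_pos (by norm_num) _
  have ha1 : a < 1 := Real.rpow_lt_one (by norm_num) (by norm_num) (by linarith)
  set b : ℝ := (1 / 2 : ℝ) ^ r with hb
  have hb0 : 0 < b := Real.rpow_pos_of_pos (by norm_num) _
  obtain ⟨q, hq⟩ := exists_pow_lt_of_lt_one (show (0 : ℝ) < 1 / 4 by norm_num) ha1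
  set p := q + 1 with hp
  have hq' : a ^ (2 * p) ≤ 1 / 4 :=
    (pow_le_pow_of_le_one ha0.le ha1.le (by omega : q ≤ 2 * p)).trans hq.le
  obtain ⟨C, hC, hCV⟩ := hmom p q.succ_pos
  have hmem : ∀ n k : ℕ, k ≤ 2 ^ n → ((k : ℝ) / 2 ^ n) ∈ Icc (0 : ℝ) 1 := fun n k hk =>
    ⟨by positivity, (div_le_one (by positivity)).2 (by exact_mod_cast hk)⟩
  set F : ℕ → ℕ → Ω → ℝ≥0∞ := fun n k ω => (ENNReal.ofReal ((b ^ n)⁻¹) *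
    ‖V ((k + 1 : ℕ) / 2 ^ n) ω - V (k / 2 ^ n) ω‖ₑ) ^ (2 * p) with hF
  have hFm : ∀ n k, k < 2 ^ n → AEMeasurable (F n k) P := fun n k hk =>
    ((((hV _ (hmem n _ hk)).sub (hV _ (hmem n _ hk.le))).enorm).const_mul _).pow_const _
  have hFi : ∀ n k, k < 2 ^ n → ∫⁻ ω, F n k ω ∂P ≤ ENNReal.ofReal (C ^ (2 * p) * (1 / 4) ^ n) := by
    intro n k hk
    have h1 := hCV _ (hmem n _ hk.le) _ (hmem n (k + 1) hk) (by gcongr; simp)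
    have h2 : ((k + 1 : ℕ) : ℝ) / 2 ^ n - k / 2 ^ n = (1 / 2) ^ n := by
      rw [one_div, inv_pow]; push_cast; field_simp; ring
    rw [h2] at h1
    have h3 : ((1 / 2 : ℝ) ^ n) ^ κ = b ^ n * a ^ n := by
      rw [hb, ha, ← mul_pow, ← Real.rpow_add (by norm_num), add_sub_cancel,
        ← Real.rpow_mul_natCast (by norm_num), ← Real.rpow_natCast_mul (by norm_num), mul_comm]
    rw [h3] at h1
    simp only [hF, mul_pow]
    rw [lintegral_const_mul' _ _ (by finiteness)]
    have h4 : ∫⁻ ω, ‖V ((k + 1 : ℕ) / 2 ^ n) ω - V (k / 2 ^ n) ω‖ₑ ^ (2 * p) ∂P =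
        eLpNorm (fun ω => V ((k + 1 : ℕ) / 2 ^ n) ω - V (k / 2 ^ n) ω) (2 * p : ℕ) P ^ (2 * p) := by
      have := eLpNorm_nnreal_pow_eq_lintegral (μ := P) (p := ((2 * p : ℕ) : ℝ≥0))
        (f := fun ω => V ((k + 1 : ℕ) / 2 ^ n) ω - V (k / 2 ^ n) ω) (by positivity)
      simp only [NNReal.coe_natCast, ENNReal.rpow_natCast, ENNReal.coe_natCast] at this
      exact this.symm
    rw [h4, ← mul_pow]
    calc _ ≤ (ENNReal.ofReal ((b ^ n)⁻¹) * ENNReal.ofReal (C * (b ^ n * a ^ n))) ^ (2 * p) := by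
          gcongr
      _ = ENNReal.ofReal ((C * a ^ n) ^ (2 * p)) := by
          rw [← ENNReal.ofReal_mul (by positivity), ← ENNReal.ofReal_pow (by positivity)]
          congr 2
          field_simp
      _ ≤ _ := by
          refine ENNReal.ofReal_le_ofReal ?_
          rw [mul_pow, ← pow_mul, mul_comm n, pow_mul a]
          gcongr
  have hint : ∫⁻ ω, ∑' n, ∑ k ∈ Finset.range (2 ^ n), F n k ω ∂P < ∞ := by
    rw [lintegral_tsum fun n => Finset.aemeasurable_fun_sum _ fun k hk =>
      hFm n k (Finset.mem_range.1 hk)]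
    have hle : ∀ n, ∫⁻ ω, ∑ k ∈ Finset.range (2 ^ n), F n k ω ∂P ≤
        ENNReal.ofReal (C ^ (2 * p) * (1 / 2) ^ n) := fun n => by
      rw [lintegral_finsetSum' _ fun k hk => hFm n k (Finset.mem_range.1 hk)]
      refine (Finset.sum_le_sum fun k hk => hFi n k (Finset.mem_range.1 hk)).trans_eq ?_
      rw [Finset.sum_const, Finset.card_range, nsmul_eq_mul, ← ENNReal.ofReal_natCast,
        ← ENNReal.ofReal_mul (by positivity)]
      congr 1
      push_cast
      rw [mul_left_comm, ← mul_pow]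
      norm_num
    refine (ENNReal.tsum_le_tsum hle).trans_lt ?_
    have hs : Summable fun n : ℕ => C ^ (2 * p) * (1 / 2 : ℝ) ^ n :=
      (summable_geometric_of_lt_one (by norm_num) (by norm_num)).mul_left _
    rw [← ENNReal.ofReal_tsum_of_nonneg (fun n => by positivity) hs]
    exact ENNReal.ofReal_lt_top
  have hmeas : AEMeasurable (fun ω => ∑' n, ∑ k ∈ Finset.range (2 ^ n), F n k ω) P :=
    AEMeasurable.tsum fun n => Finset.aemeasurable_fun_sum _ fun k hk =>
      hFm n k (Finset.mem_range.1 hk)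
  filter_upwards [ae_lt_top' hmeas hint.ne] with ω hω
  set Q := ∑' n, ∑ k ∈ Finset.range (2 ^ n), F n k ω with hQ
  -- `1 + Q` avoids a root: a number whose power of order `2p` is at most `Q` is at most `1` or at
  -- most `Q`.
  refine ⟨1 + Q.toReal, by positivity, fun n k hk => ?_⟩
  have h1 : F n k ω ≤ Q :=
    (Finset.single_le_sum (f := fun k => F n k ω) (fun _ _ => zero_le)
      (Finset.mem_range.2 hk)).trans (ENNReal.le_tsum n)
  have h2 : ((b ^ n)⁻¹ * ‖V ((k + 1 : ℕ) / 2 ^ n) ω - V (k / 2 ^ n) ω‖) ^ (2 * p) ≤ Q.toReal := by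
    rw [← ENNReal.ofReal_le_iff_le_toReal hω.ne]
    refine le_trans (le_of_eq ?_) h1
    rw [hF, ENNReal.ofReal_pow (by positivity), ENNReal.ofReal_mul (by positivity),
      ofReal_norm]
  have h3 : (b ^ n)⁻¹ * ‖V ((k + 1 : ℕ) / 2 ^ n) ω - V (k / 2 ^ n) ω‖ ≤ 1 + Q.toReal := by
    rcases le_total ((b ^ n)⁻¹ * ‖V ((k + 1 : ℕ) / 2 ^ n) ω - V (k / 2 ^ n) ω‖) 1 with h | h
    · linarith [ENNReal.toReal_nonneg (a := Q)]
    · linarith [le_self_pow₀ h (show 2 * p ≠ 0 by omega)]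
  rwa [inv_mul_le_iff₀ (by positivity), mul_comm] at h3

/-- Kolmogorov's continuity theorem for processes whose increments have moments of all orders. -/
theorem exists_holder_modification {Ω : Type*} [MeasurableSpace Ω] {P : Measure Ω}
    [IsProbabilityMeasure P] {H : Type*} [NormedAddCommGroup H] [CompleteSpace H]
    {V : ℝ → Ω → H} {κ : ℝ} (hκ : 0 < κ)
    (hV : ∀ t ∈ Icc (0 : ℝ) 1, AEStronglyMeasurable (V t) P)
    (hmom : ∀ p : ℕ, 0 < p → ∃ C : ℝ, 0 ≤ C ∧ ∀ s ∈ Icc (0 : ℝ) 1, ∀ t ∈ Icc (0 : ℝ) 1, s < t →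
      eLpNorm (fun ω => V t ω - V s ω) (2 * p : ℕ) P ≤ ENNReal.ofReal (C * (t - s) ^ κ)) :
    ∃ U : ℝ → Ω → H, (∀ t ∈ Icc (0 : ℝ) 1, U t =ᵐ[P] V t) ∧
      ∀ r : ℝ≥0, (r : ℝ) < κ →
        ∀ᵐ ω ∂P, ∃ K : ℝ≥0, HolderOnWith K r (fun t => U t ω) (Icc 0 1) := by
  -- The candidate does not depend on the exponent, so one process serves for all `r`. Where the
  -- limit fails to exist the value is arbitrary; this happens only on a null set.
  refine ⟨fun t ω => limUnder atTop fun n => V (dyadicFloor n t) ω, fun t ht => ?_, fun r hr => ?_⟩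
  · have hlim : Tendsto (fun n => eLpNorm (V (dyadicFloor n t) - V t) (2 * 1 : ℕ) P) atTop
        (𝓝 0) := by
      obtain ⟨C, hC, h⟩ := hmom 1 one_pos
      have hz : Tendsto (fun n => ENNReal.ofReal (C * |dyadicFloor n t - t| ^ κ)) atTop (𝓝 0) := by
        have := ((tendsto_dyadicFloor ht).rpow_const (p := κ) (Or.inr hκ.le)).const_mul C
        rw [Real.zero_rpow hκ.ne', mul_zero] at this
        simpa using ENNReal.tendsto_ofReal this
      refine tendsto_of_tendsto_of_tendsto_of_le_of_le tendsto_const_nhds hz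
        (fun _ => zero_le) fun n => ?_
      obtain ⟨h1, h2, -⟩ := dyadicFloor_mem (n := n) ht
      rcases h2.eq_or_lt with h2 | h2
      · rw [h2]; simp
      · rw [eLpNorm_sub_comm, abs_sub_comm, abs_of_pos (sub_pos.2 h2)]
        exact h _ h1 _ ht h2
    obtain ⟨ns, hns, hae⟩ := (tendstoInMeasure_of_tendsto_eLpNorm (by norm_num)
      (fun n => hV _ (dyadicFloor_mem (n := n) ht).1) (hV t ht) hlim).exists_seq_tendsto_ae
    filter_upwards [hae, ae_exists_dyadic_bound hV hmom (half_lt_self hκ)] with ω h1 h2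
    obtain ⟨S, hS, h2⟩ := h2
    exact tendsto_nhds_unique ((tendsto_dyadic_limUnder (v := fun t => V t ω) (by positivity)
      (Real.rpow_lt_one (by norm_num) (by norm_num) (half_pos hκ)) hS h2 ht).comp
        hns.tendsto_atTop) h1
  · obtain ⟨r', hr1, hr2⟩ := exists_between hr
    have hr0 : 0 < r' := r.2.trans_lt hr1
    filter_upwards [ae_exists_dyadic_bound hV hmom hr2] with ω h2
    obtain ⟨S, hS, h2⟩ := h2
    obtain ⟨K, hK, h3⟩ := norm_dyadic_limUnder_sub_le (v := fun t => V t ω) hr0 hS h2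
    refine ⟨K.toNNReal, holderOnWith_of_dist_le hK fun s hs t ht => (h3 s hs t ht).trans ?_⟩
    refine mul_le_mul_of_nonneg_left ?_ hK
    have hst : |s - t| ≤ 1 := abs_le.2 ⟨by linarith [hs.1, ht.2], by linarith [hs.2, ht.1]⟩
    rcases (abs_nonneg (s - t)).eq_or_lt with h | h
    · rw [← h, Real.zero_rpow hr0.ne']
      exact Real.rpow_nonneg le_rfl _
    · exact Real.rpow_le_rpow_of_exponent_ge h hst hr1.le

/-! ### Random variables with moments of all orders -/

/-- All moments of `F` are finite. -/
def AllMoments {Ω E : Type*} [MeasurableSpace Ω] [NormedAddCommGroup E] (F : Ω → E)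
    (P : Measure Ω) : Prop :=
  ∀ p : ℕ, MemLp F p P

namespace AllMoments

set_option linter.unusedSectionVars false

variable {Ω Ω' E : Type*} [MeasurableSpace Ω] [MeasurableSpace Ω'] [NormedAddCommGroup E]
  {P : Measure Ω} [IsProbabilityMeasure P] {Q : Measure Ω'} [IsProbabilityMeasure Q]

theorem integrable {F : Ω → E} (h : AllMoments F P) : Integrable F P :=
  memLp_one_iff_integrable.1 (by simpa using h 1)

theorem memLp_two {F : Ω → E} (h : AllMoments F P) : MemLp F 2 P := by simpa using h 2

theorem const (c : E) : AllMoments (fun _ : Ω => c) P := fun _ => memLp_const c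

theorem add {F G : Ω → E} (hF : AllMoments F P) (hG : AllMoments G P) :
    AllMoments (fun ω => F ω + G ω) P := fun p => (hF p).add (hG p)

theorem sub {F G : Ω → E} (hF : AllMoments F P) (hG : AllMoments G P) :
    AllMoments (fun ω => F ω - G ω) P := fun p => (hF p).sub (hG p)

theorem smul {𝕜 : Type*} [NormedField 𝕜] [NormedSpace 𝕜 E] {F : Ω → 𝕜} {G : Ω → E}
    (hF : AllMoments F P) (hG : AllMoments G P) : AllMoments (fun ω => F ω • G ω) P := fun p => by
  have : ENNReal.HolderTriple (2 * p : ℕ) (2 * p : ℕ) (p : ℝ≥0∞) := ⟨by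
    push_cast
    rw [ENNReal.mul_inv (Or.inl (by norm_num)) (Or.inl (by norm_num)), ← add_mul,
      ENNReal.inv_two_add_inv_two, one_mul]⟩
  exact (hG (2 * p)).smul (hF (2 * p))

theorem mul {𝕜 : Type*} [NormedField 𝕜] {F G : Ω → 𝕜} (hF : AllMoments F P) (hG : AllMoments G P) :
    AllMoments (fun ω => F ω * G ω) P := hF.smul hG

theorem const_mul {𝕜 : Type*} [NormedField 𝕜] {F : Ω → 𝕜} (c : 𝕜) (hF : AllMoments F P) :
    AllMoments (fun ω => c * F ω) P := (const c).mul hF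

theorem sum {κ : Type*} (s : Finset κ) {F : κ → Ω → E} (h : ∀ i ∈ s, AllMoments (F i) P) :
    AllMoments (fun ω => ∑ i ∈ s, F i ω) P := fun p => memLp_finsetSum s fun i hi => h i hi p

theorem prod {𝕜 κ : Type*} [NormedField 𝕜] (s : Finset κ) {F : κ → Ω → 𝕜}
    (h : ∀ i ∈ s, AllMoments (F i) P) :
    AllMoments (fun ω => ∏ i ∈ s, F i ω) P := by
  classical
  induction s using Finset.induction_on with
  | empty => simpa using const (1 : 𝕜)
  | insert a s ha ih =>
    simp only [Finset.prod_insert ha]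
    exact (h a (Finset.mem_insert_self _ _)).mul
      (ih fun i hi => h i (Finset.mem_insert_of_mem hi))

theorem pow {𝕜 : Type*} [NormedField 𝕜] {F : Ω → 𝕜} (h : AllMoments F P) (n : ℕ) :
    AllMoments (fun ω => F ω ^ n) P := by
  simpa using prod (Finset.range n) (F := fun _ => F) fun _ _ => h

theorem ofReal {F : Ω → ℝ} (h : AllMoments F P) : AllMoments (fun ω => (F ω : ℂ)) P :=
  fun p => (h p).ofReal

theorem star {F : Ω → ℂ} (h : AllMoments F P) :
    AllMoments (fun ω => (starRingEnd ℂ) (F ω)) P :=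
  fun p => (h p).star

theorem comp_fst {F : Ω → E} (h : AllMoments F P) :
    AllMoments (fun z : Ω × Ω' => F z.1) (P.prod Q) := fun p => (h p).comp_fst Q

theorem comp_snd {F : Ω' → E} (h : AllMoments F Q) :
    AllMoments (fun z : Ω × Ω' => F z.2) (P.prod Q) := fun p => (h p).comp_snd P

theorem aeval {F : Ω → ℝ} (h : AllMoments F P) (p : Polynomial ℤ) :
    AllMoments (fun ω => Polynomial.aeval (F ω) p) P := by
  simp only [Polynomial.aeval_eq_sum_range, zsmul_eq_mul]
  exact sum _ fun i _ => (const _).mul (h.pow i)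

end AllMoments

theorem allMoments_gaussianReal (v : ℝ≥0) :
    AllMoments (fun x : ℝ => x) (gaussianReal 0 v) :=
  fun p => memLp_id_gaussianReal' p (ENNReal.natCast_ne_top p)

/-! ### Integration by parts for the Gaussian measure on the line -/

theorem hasDerivAt_gaussianPDFReal {v : ℝ≥0} (hv : v ≠ 0) (x : ℝ) :
    HasDerivAt (gaussianPDFReal 0 v) (-(x / v) * gaussianPDFReal 0 v x) x := by
  have hv' : (v : ℝ) ≠ 0 := by exact_mod_cast hv
  have h1 : HasDerivAt (fun x : ℝ => -(x - 0) ^ 2 / (2 * v)) (-(x / v)) x := by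
    have := (((hasDerivAt_id x).sub_const 0).pow 2).neg.div_const (2 * (v : ℝ))
    convert! this using 1
    simp; field_simp
  have h2 := h1.exp.const_mul (√(2 * Real.pi * v))⁻¹
  rw [gaussianPDFReal_def]
  convert! h2 using 1
  ring

theorem integrable_gaussianReal_iff {E : Type*} [NormedAddCommGroup E] [NormedSpace ℝ E]
    {v : ℝ≥0} (hv : v ≠ 0) {f : ℝ → E} :
    Integrable f (gaussianReal 0 v) ↔ Integrable fun x => gaussianPDFReal 0 v x • f x := by
  rw [gaussianReal_of_var_ne_zero _ hv, integrable_withDensity_iff_integrable_smul'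
    (measurable_gaussianPDF _ _) (ae_of_all _ fun _ => gaussianPDF_lt_top)]
  simp only [toReal_gaussianPDF]

/-- Stein's identity. -/
theorem integral_smul_gaussianReal {E : Type*} [NormedAddCommGroup E] [NormedSpace ℝ E]
    {v : ℝ≥0} (hv : v ≠ 0) {f f' : ℝ → E} (hff' : ∀ x, HasDerivAt f (f' x) x)
    (hf : Integrable f (gaussianReal 0 v)) (hxf : Integrable (fun x => x • f x) (gaussianReal 0 v))
    (hf' : Integrable f' (gaussianReal 0 v)) :
    ∫ x, x • f x ∂gaussianReal 0 v = (v : ℝ) • ∫ x, f' x ∂gaussianReal 0 v := by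
  have hv' : (v : ℝ) ≠ 0 := by exact_mod_cast hv
  rw [integral_gaussianReal_eq_integral_smul hv, integral_gaussianReal_eq_integral_smul hv,
    ← integral_smul, ← sub_eq_zero]
  rw [integrable_gaussianReal_iff hv] at hf hxf hf'
  rw [← integral_sub hxf (show Integrable (fun x => (v : ℝ) • gaussianPDFReal 0 v x • f' x) from
    hf'.smul (v : ℝ))]
  -- The integrand is `-v` times the derivative of the density times `f`, an integrable function
  -- with integrable derivative, so its integral is zero.
  have key : ∫ x, (-(v : ℝ)) • (gaussianPDFReal 0 v x • f' x +
      (-(x / v) * gaussianPDFReal 0 v x) • f x) = 0 := by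
    rw [integral_smul, integral_eq_zero_of_hasDerivAt_of_integrable
      (f := fun x => gaussianPDFReal 0 v x • f x)
      (fun x => (hasDerivAt_gaussianPDFReal hv x).smul (hff' x)) ?_ hf, smul_zero]
    refine hf'.add ((hxf.smul (-(v : ℝ)⁻¹)).congr (ae_of_all _ fun x => ?_))
    simp only [Pi.smul_apply, smul_smul]
    congr 1
    ring
  rw [← key]
  refine integral_congr_ae (ae_of_all _ fun x => ?_)
  simp only [smul_smul, smul_add]
  have : -(v : ℝ) * (-(x / v) * gaussianPDFReal 0 v x) = gaussianPDFReal 0 v x * x := by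
    field_simp
  rw [this, neg_mul, neg_smul]
  abel

/-- Stein's identity for complex functions and the standard Gaussian measure. -/
theorem integral_mul_gaussianReal {f f' : ℝ → ℂ} (hff' : ∀ x, HasDerivAt f (f' x) x)
    (hf : AllMoments f (gaussianReal 0 1)) (hf' : AllMoments f' (gaussianReal 0 1)) :
    ∫ x, (x : ℂ) * f x ∂gaussianReal 0 1 = ∫ x, f' x ∂gaussianReal 0 1 := by
  have := integral_smul_gaussianReal one_ne_zero hff' hf.integrable
    ((allMoments_gaussianReal 1).smul hf).integrable hf'.integrable
  simpa using this

/-! ### Hermite polynomials as Gaussian averages -/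

theorem derivative_hermite_succ (n : ℕ) :
    Polynomial.derivative (Polynomial.hermite (n + 1)) =
      ((n : Polynomial ℤ) + 1) * Polynomial.hermite n := by
  induction n with
  | zero => simp
  | succ n ih =>
    rw [Polynomial.hermite_succ (n + 1), Polynomial.derivative_sub, Polynomial.derivative_mul,
      Polynomial.derivative_X, one_mul, ih, Polynomial.derivative_mul]
    simp only [Polynomial.derivative_add, Polynomial.derivative_natCast, Polynomial.derivative_one,
      add_zero, zero_mul, zero_add]
    rw [Polynomial.hermite_succ n]
    push_cast
    ring

theorem allMoments_linear_pow (c d : ℂ) (n : ℕ) :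
    AllMoments (fun y : ℝ => (c + d * y) ^ n) (gaussianReal 0 1) :=
  ((AllMoments.const c).add ((allMoments_gaussianReal 1).ofReal.const_mul d)).pow n

theorem hasDerivAt_linear_pow (c d : ℂ) (n : ℕ) (y : ℝ) :
    HasDerivAt (fun y : ℝ => (c + d * y) ^ n) (n * (c + d * y) ^ (n - 1) * d) y := by
  have h1 : HasDerivAt (fun y : ℝ => c + d * (y : ℂ)) d y := by
    simpa using ((Complex.ofRealCLM.hasDerivAt (x := y)).const_mul d).const_add c
  exact h1.pow n

/-- Stein's identity turns the factor `iY` into `-n` times the power of order `n - 1`, so the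
averages satisfy the Hermite recursion `H_{n+1} = x H_n - n H_{n-1}`. -/
theorem aeval_hermite_eq_integral (x : ℝ) (n : ℕ) :
    ((Polynomial.aeval x (Polynomial.hermite n) : ℝ) : ℂ) =
      ∫ y : ℝ, ((x : ℂ) + Complex.I * y) ^ n ∂gaussianReal 0 1 := by
  have hrec : ∀ n : ℕ, ∫ y : ℝ, ((x : ℂ) + Complex.I * y) ^ (n + 1) ∂gaussianReal 0 1 =
      x * ∫ y : ℝ, ((x : ℂ) + Complex.I * y) ^ n ∂gaussianReal 0 1 -
        n * ∫ y : ℝ, ((x : ℂ) + Complex.I * y) ^ (n - 1) ∂gaussianReal 0 1 := fun n => by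
    have hs := integral_mul_gaussianReal (hasDerivAt_linear_pow x Complex.I n)
      (allMoments_linear_pow _ _ n) (((AllMoments.const _).mul
        (allMoments_linear_pow _ _ (n - 1))).mul (AllMoments.const _))
    rw [integral_mul_const, integral_const_mul] at hs
    have h1 : ∀ y : ℝ, ((x : ℂ) + Complex.I * y) ^ (n + 1) =
        x * ((x : ℂ) + Complex.I * y) ^ n + Complex.I * (y * ((x : ℂ) + Complex.I * y) ^ n) :=
      fun y => by ring
    simp only [h1]
    rw [integral_add ((allMoments_linear_pow _ _ n).const_mul _).integrable
      (((allMoments_gaussianReal 1).ofReal.mul (allMoments_linear_pow _ _ n)).const_mul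
        _).integrable, integral_const_mul, integral_const_mul, hs]
    linear_combination (n * ∫ y : ℝ, ((x : ℂ) + Complex.I * y) ^ (n - 1) ∂gaussianReal 0 1) *
      Complex.I_mul_I
  induction n using Nat.strong_induction_on with
  | _ n ih =>
    match n with
    | 0 => simp
    | 1 =>
      have := hrec 0
      simp only [zero_add, Nat.cast_zero, zero_mul, sub_zero, pow_zero, integral_const,
        probReal_univ, one_smul, mul_one] at this
      rw [this]
      simp
    | n + 2 =>
      rw [hrec (n + 1), ← ih (n + 1) (by omega), Nat.add_sub_cancel, ← ih n (by omega),
        Polynomial.hermite_succ (n + 1), derivative_hermite_succ]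
      simp

/-! ### Moments of a standard complex Gaussian variable -/

/-- The mixed moments of the standard complex Gaussian variable. -/
noncomputable def complexMoment (a b : ℕ) : ℂ :=
  ∫ z : ℝ × ℝ, ((z.1 : ℂ) + Complex.I * z.2) ^ a * ((z.1 : ℂ) - Complex.I * z.2) ^ b
    ∂(gaussianReal 0 1).prod (gaussianReal 0 1)

theorem allMoments_complexMoment (a b : ℕ) :
    AllMoments (fun z : ℝ × ℝ => ((z.1 : ℂ) + Complex.I * z.2) ^ a *
      ((z.1 : ℂ) - Complex.I * z.2) ^ b) ((gaussianReal 0 1).prod (gaussianReal 0 1)) := by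
  have h1 : AllMoments (fun z : ℝ × ℝ => (z.1 : ℂ))
      ((gaussianReal 0 1).prod (gaussianReal 0 1)) := (allMoments_gaussianReal 1).ofReal.comp_fst
  have h2 : AllMoments (fun z : ℝ × ℝ => (z.2 : ℂ))
      ((gaussianReal 0 1).prod (gaussianReal 0 1)) := (allMoments_gaussianReal 1).ofReal.comp_snd
  exact ((h1.add (h2.const_mul _)).pow a).mul ((h1.sub (h2.const_mul _)).pow b)

/-- Gaussian integration by parts replaces one factor `z = x + iy` by the operator `∂_x + i ∂_y`,
which kills powers of `z` and sends `z̄ ^ b` to `2 b z̄ ^ (b-1)`. For `b = 0` the truncated exponent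
is harmless because of the factor `b`. -/
theorem complexMoment_succ (a b : ℕ) :
    complexMoment (a + 1) b = 2 * b * complexMoment a (b - 1) := by
  set γ := gaussianReal 0 1 with hγ
  have m1 : AllMoments (fun z : ℝ × ℝ => (z.1 : ℂ)) (γ.prod γ) :=
    (allMoments_gaussianReal 1).ofReal.comp_fst
  have m2 : AllMoments (fun z : ℝ × ℝ => (z.2 : ℂ)) (γ.prod γ) :=
    (allMoments_gaussianReal 1).ofReal.comp_snd
  have mab := fun a b => allMoments_complexMoment a b
  have lin : ∀ (c d c' d' : ℂ) (k l : ℕ),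
      ∫ y : ℝ, (y : ℂ) * ((c + d * y) ^ k * (c' + d' * y) ^ l) ∂γ =
      ∫ y : ℝ, k * (c + d * y) ^ (k - 1) * d * (c' + d' * y) ^ l +
        (c + d * y) ^ k * (l * (c' + d' * y) ^ (l - 1) * d') ∂γ := fun c d c' d' k l =>
    integral_mul_gaussianReal
      (fun y => (hasDerivAt_linear_pow c d k y).mul (hasDerivAt_linear_pow c' d' l y))
      ((allMoments_linear_pow _ _ _).mul (allMoments_linear_pow _ _ _))
      (((((AllMoments.const _).mul (allMoments_linear_pow _ _ _)).mul (AllMoments.const _)).mul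
        (allMoments_linear_pow _ _ _)).add ((allMoments_linear_pow _ _ _).mul
        (((AllMoments.const _).mul (allMoments_linear_pow _ _ _)).mul (AllMoments.const _))))
  have hx : ∫ z : ℝ × ℝ, (z.1 : ℂ) * (((z.1 : ℂ) + Complex.I * z.2) ^ a *
      ((z.1 : ℂ) - Complex.I * z.2) ^ b) ∂γ.prod γ =
      a * complexMoment (a - 1) b + b * complexMoment a (b - 1) := by
    rw [complexMoment, complexMoment, ← integral_const_mul, ← integral_const_mul,
      ← integral_add ((mab _ _).const_mul _).integrable ((mab _ _).const_mul _).integrable,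
      integral_prod_symm _ (m1.mul (mab a b)).integrable,
      integral_prod_symm _ (((mab _ _).const_mul _).add ((mab _ _).const_mul _)).integrable]
    refine integral_congr_ae (ae_of_all _ fun y => ?_)
    have := lin (Complex.I * y) 1 (-(Complex.I * y)) 1 a b
    convert! this using 2 <;> ext x <;> ring
  have hy : ∫ z : ℝ × ℝ, (z.2 : ℂ) * (((z.1 : ℂ) + Complex.I * z.2) ^ a *
      ((z.1 : ℂ) - Complex.I * z.2) ^ b) ∂γ.prod γ =
      (a * Complex.I) * complexMoment (a - 1) b - (b * Complex.I) * complexMoment a (b - 1) := by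
    rw [complexMoment, complexMoment, ← integral_const_mul, ← integral_const_mul,
      ← integral_sub ((mab _ _).const_mul _).integrable ((mab _ _).const_mul _).integrable,
      integral_prod _ (m2.mul (mab a b)).integrable,
      integral_prod _ (((mab _ _).const_mul _).sub ((mab _ _).const_mul _)).integrable]
    refine integral_congr_ae (ae_of_all _ fun x => ?_)
    have := lin x Complex.I x (-Complex.I) a b
    convert! this using 2 <;> ext x <;> ring
  have hdec : complexMoment (a + 1) b =
      ∫ z : ℝ × ℝ, (z.1 : ℂ) * (((z.1 : ℂ) + Complex.I * z.2) ^ a *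
      ((z.1 : ℂ) - Complex.I * z.2) ^ b) ∂γ.prod γ +
      Complex.I * ∫ z : ℝ × ℝ, (z.2 : ℂ) * (((z.1 : ℂ) + Complex.I * z.2) ^ a *
      ((z.1 : ℂ) - Complex.I * z.2) ^ b) ∂γ.prod γ := by
    rw [complexMoment, ← integral_const_mul, ← integral_add (m1.mul (mab a b)).integrable
      ((m2.mul (mab a b)).const_mul _).integrable]
    refine integral_congr_ae (ae_of_all _ fun z => ?_)
    simp only
    ring
  rw [hdec, hx, hy]
  linear_combination (a * complexMoment (a - 1) b - b * complexMoment a (b - 1)) * Complex.I_mul_I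

theorem complexMoment_eq (a b : ℕ) :
    complexMoment a b = if a = b then ((2 ^ a * a.factorial : ℕ) : ℂ) else 0 := by
  induction a generalizing b with
  | zero =>
    cases b with
    | zero => simp [complexMoment]
    | succ b =>
      -- The recursion lowers only through the first index, so conjugation exchanges the two.
      have h1 : complexMoment 0 (b + 1) = (starRingEnd ℂ) (complexMoment (b + 1) 0) := by
        rw [complexMoment, complexMoment, ← integral_conj]
        refine integral_congr_ae (ae_of_all _ fun z => ?_)
        simp [sub_eq_add_neg]
      rw [h1, complexMoment_succ]
      simp
  | succ a ih =>
    rw [complexMoment_succ]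
    cases b with
    | zero => simp
    | succ b =>
      rw [Nat.add_sub_cancel, ih]
      by_cases h : a = b
      · subst h
        simp only [if_true, Nat.factorial_succ]
        push_cast
        ring
      · simp [h]

/-! ### Homogeneous polynomials in independent standard Gaussian variables -/

section Wick

set_option linter.unusedSectionVars false

variable {Ω ι : Type*} [MeasurableSpace Ω]

open scoped Classical in
/-- The number of occurrences of `j` in the family `k`. -/
noncomputable def mult {Q : Type*} [Fintype Q] (k : Q → ι) (j : ι) : ℕ :=
  (Finset.univ.filter fun q => k q = j).card

/-- The complex variable `G_j(ω) + i G_j(ω')`. -/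
noncomputable def complexify (G : ι → Ω → ℝ) (j : ι) (z : Ω × Ω) : ℂ :=
  (G j z.1 : ℂ) + Complex.I * G j z.2

variable {Q : Type*} [Fintype Q]

theorem prod_comp_eq_prod_pow_mult {M : Type*} [CommMonoid M] {T : Finset ι} {k : Q → ι}
    (hk : ∀ q, k q ∈ T) (x : ι → M) : ∏ q, x (k q) = ∏ j ∈ T, x j ^ mult k j := by
  classical
  rw [← Finset.prod_fiberwise_of_maps_to (t := T) (g := k) fun q _ => hk q]
  refine Finset.prod_congr rfl fun j _ => ?_
  rw [Finset.prod_congr rfl (g := fun _ => x j) fun q hq => by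
    rw [(Finset.mem_filter.1 hq).2], Finset.prod_const, mult]

theorem sum_mult {T : Finset ι} {k : Q → ι} (hk : ∀ q, k q ∈ T) :
    ∑ j ∈ T, mult k j = Fintype.card Q := by
  classical
  rw [← Finset.card_univ, Finset.card_eq_sum_card_fiberwise (t := T) (f := k) fun q _ => hk q]
  refine Finset.sum_congr rfl fun j _ => ?_
  rw [mult]

theorem exists_eq_of_mult_ne_zero {k : Q → ι} {j : ι} (h : mult k j ≠ 0) : ∃ q, k q = j := by
  classical
  rw [mult, Finset.card_ne_zero] at h
  obtain ⟨q, hq⟩ := h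
  exact ⟨q, (Finset.mem_filter.1 hq).2⟩

theorem mult_apply_ne_zero (k : Q → ι) (q : Q) : mult k (k q) ≠ 0 := by
  classical
  rw [mult, Finset.card_ne_zero]
  exact ⟨q, by simp⟩

variable {P : Measure Ω} [IsProbabilityMeasure P] {G : ι → Ω → ℝ}

theorem allMoments_of_hasLaw {X : Ω → ℝ} {v : ℝ≥0} (h : HasLaw X (gaussianReal 0 v) P) :
    AllMoments X P := fun p => by
  have := allMoments_gaussianReal v p
  rw [← h.map_eq] at this
  exact (memLp_map_measure_iff this.1 h.aemeasurable).1 this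

theorem allMoments_complexify (hlaw : ∀ j, HasLaw (G j) (gaussianReal 0 1) P) (j : ι) :
    AllMoments (complexify G j) (P.prod P) :=
  (allMoments_of_hasLaw (hlaw j)).ofReal.comp_fst.add
    ((allMoments_of_hasLaw (hlaw j)).ofReal.comp_snd.const_mul _)

/-- Fubini, then independence on the second copy of `Ω` with `ω` frozen, then independence on the
first copy. -/
theorem integral_prod_complexify (hind : iIndepFun G P)
    (hlaw : ∀ j, HasLaw (G j) (gaussianReal 0 1) P) (T : Finset ι) (a b : ι → ℕ) :
    ∫ z, ∏ j ∈ T, (complexify G j z ^ a j * (starRingEnd ℂ) (complexify G j z) ^ b j)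
      ∂P.prod P = ∏ j ∈ T, complexMoment (a j) (b j) := by
  set φ : ι → ℝ → ℝ → ℂ := fun j x y =>
    ((x : ℂ) + Complex.I * y) ^ a j * ((x : ℂ) - Complex.I * y) ^ b j with hφ
  have hφc : ∀ j, Continuous (Function.uncurry (φ j)) := fun j => by
    simp only [hφ, Function.uncurry_def]; fun_prop
  have hφc' : ∀ j x, Continuous (φ j x) := fun j x =>
    (hφc j).comp (Continuous.prodMk_right x)
  have hz : ∀ j z, complexify G j z ^ a j * (starRingEnd ℂ) (complexify G j z) ^ b j =
      φ j (G j z.1) (G j z.2) := fun j z => by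
    simp [complexify, hφ, sub_eq_add_neg]
  have hmom : AllMoments (fun z => ∏ j ∈ T, (complexify G j z ^ a j *
      (starRingEnd ℂ) (complexify G j z) ^ b j)) (P.prod P) :=
    AllMoments.prod T fun j _ => ((allMoments_complexify hlaw j).pow _).mul
      ((allMoments_complexify hlaw j).star.pow _)
  rw [integral_prod _ hmom.integrable]
  simp only [hz]
  have hind' := hind.restrict T
  have hm : ∀ j : T, AEMeasurable (T.restrict G j) P := fun j => (hlaw j).aemeasurable
  set Φ : ι → ℝ → ℂ := fun j x => ∫ y, φ j x y ∂gaussianReal 0 1 with hΦ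
  have hΦm : ∀ j, StronglyMeasurable (Φ j) := fun j =>
    (hφc j).stronglyMeasurable.integral_prod_right
  have hinner : ∀ j x, ∫ ω', φ j x (G j ω') ∂P = Φ j x := fun j x => by
    change _ = ∫ y, φ j x y ∂gaussianReal 0 1
    rw [← (hlaw j).map_eq, integral_map (hlaw j).aemeasurable
      (hφc' j x).aestronglyMeasurable]
  have h1 : ∀ ω, ∫ ω', ∏ j ∈ T, φ j (G j ω) (G j ω') ∂P = ∏ j ∈ T, Φ j (G j ω) := fun ω => by
    have := hind'.integral_fun_prod_comp (f := fun j : T => φ j (G j ω)) hm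
      fun j => (hφc' j _).aestronglyMeasurable
    simp only [Finset.restrict] at this
    rw [Finset.prod_coe_sort T (fun j => ∫ ω', φ j (G j ω) (G j ω') ∂P)] at this
    simp only [hinner] at this
    rw [← this]
    refine integral_congr_ae (ae_of_all _ fun ω' => ?_)
    exact (Finset.prod_coe_sort T (fun j => φ j (G j ω) (G j ω'))).symm
  simp only [h1]
  have h2 := hind'.integral_fun_prod_comp (f := fun j : T => Φ j) hm
    fun j => (hΦm j).aestronglyMeasurable
  simp only [Finset.restrict] at h2
  rw [Finset.prod_coe_sort T (fun j => ∫ ω, Φ j (G j ω) ∂P)] at h2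
  have h3 : ∀ ω, ∏ j ∈ T, Φ j (G j ω) = ∏ j : T, Φ j (G j ω) := fun ω =>
    (Finset.prod_coe_sort T (fun j => Φ j (G j ω))).symm
  simp only [h3]
  rw [h2]
  refine Finset.prod_congr rfl fun j _ => ?_
  rw [← integral_map (f := Φ j) (hlaw j).aemeasurable (hΦm j).aestronglyMeasurable,
    (hlaw j).map_eq, complexMoment,
    integral_prod _ (allMoments_complexMoment (a j) (b j)).integrable]

/-- The covariance factorizes over the distinct indices and vanishes unless every index has the same
multiplicity in `k` and `k'`. In that case it is a product of `2^m m!`, bounded because the product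
of the factorials divides the factorial of the sum. Of the equality of multiplicities only equality
of the ranges is retained, which suffices for counting. -/
theorem exists_wick_covariance (hind : iIndepFun G P)
    (hlaw : ∀ j, HasLaw (G j) (gaussianReal 0 1) P) (k k' : Q → ι) :
    ∃ r : ℝ, ∫ z, (∏ q, complexify G (k q) z) * (starRingEnd ℂ) (∏ q, complexify G (k' q) z)
        ∂P.prod P = r ∧ 0 ≤ r ∧ r ≤ 2 ^ Fintype.card Q * (Fintype.card Q).factorial ∧
      (r ≠ 0 → (∀ q, ∃ q', k' q = k q') ∧ ∀ q, ∃ q', k q = k' q') := by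
  classical
  set T := Finset.univ.image k ∪ Finset.univ.image k' with hT
  have hk : ∀ q, k q ∈ T := fun q => Finset.mem_union_left _ (by simp)
  have hk' : ∀ q, k' q ∈ T := fun q => Finset.mem_union_right _ (by simp)
  have hI : ∫ z, (∏ q, complexify G (k q) z) * (starRingEnd ℂ) (∏ q, complexify G (k' q) z)
      ∂P.prod P = ∏ j ∈ T, complexMoment (mult k j) (mult k' j) := by
    rw [← integral_prod_complexify hind hlaw]
    refine integral_congr_ae (ae_of_all _ fun z => ?_)
    simp only
    rw [prod_comp_eq_prod_pow_mult hk (fun j => complexify G j z),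
      prod_comp_eq_prod_pow_mult hk' (fun j => complexify G j z), map_prod,
      Finset.prod_mul_distrib]
    simp
  rw [hI]
  by_cases h : ∀ j, mult k j = mult k' j
  · refine ⟨(∏ j ∈ T, (2 ^ mult k j * (mult k j).factorial : ℕ) : ℕ), ?_, by positivity, ?_,
      fun _ => ⟨fun q => ?_, fun q => ?_⟩⟩
    · push_cast
      refine Finset.prod_congr rfl fun j _ => ?_
      rw [complexMoment_eq, if_pos (h j)]
      push_cast
      rfl
    · rw [Finset.prod_mul_distrib, Finset.prod_pow_eq_pow_sum, sum_mult hk]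
      have h1 : ∏ j ∈ T, (mult k j).factorial ≤ (Fintype.card Q).factorial :=
        Nat.le_of_dvd (Nat.factorial_pos _)
          (sum_mult hk ▸ Nat.prod_factorial_dvd_factorial_sum T (mult k))
      exact_mod_cast Nat.mul_le_mul_left _ h1
    · obtain ⟨q', hq'⟩ := exists_eq_of_mult_ne_zero (h (k' q) ▸ mult_apply_ne_zero k' q)
      exact ⟨q', hq'.symm⟩
    · obtain ⟨q', hq'⟩ := exists_eq_of_mult_ne_zero (h (k q) ▸ mult_apply_ne_zero k q)
      exact ⟨q', hq'.symm⟩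
  · push Not at h
    obtain ⟨j, hj⟩ := h
    refine ⟨0, ?_, le_rfl, by positivity, fun h0 => absurd rfl h0⟩
    have hjT : j ∈ T := by
      by_contra hjT
      have e1 : mult k j = 0 := by
        by_contra h0
        obtain ⟨q, rfl⟩ := exists_eq_of_mult_ne_zero h0
        exact hjT (hk q)
      have e2 : mult k' j = 0 := by
        by_contra h0
        obtain ⟨q, rfl⟩ := exists_eq_of_mult_ne_zero h0
        exact hjT (hk' q)
      exact hj (e1.trans e2.symm)
    rw [Finset.prod_eq_zero hjT (by rw [complexMoment_eq, if_neg hj]), Complex.ofReal_zero]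

/-- The homogeneous polynomial with coefficients `c` in the complex variables. -/
noncomputable def complexSum (G : ι → Ω → ℝ) (S : Finset (Q → ι)) (c : (Q → ι) → ℝ)
    (z : Ω × Ω) : ℂ :=
  ∑ k ∈ S, (c k : ℂ) * ∏ q, complexify G (k q) z

theorem allMoments_complexSum (hlaw : ∀ j, HasLaw (G j) (gaussianReal 0 1) P)
    (S : Finset (Q → ι)) (c : (Q → ι) → ℝ) : AllMoments (complexSum G S c) (P.prod P) :=
  AllMoments.sum S fun k _ => (AllMoments.prod _ fun q _ =>
    allMoments_complexify hlaw (k q)).const_mul _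

/-- The constant in the bound of the second moment of a homogeneous polynomial. -/
def wickConst (Q : Type*) [Fintype Q] : ℝ :=
  2 ^ Fintype.card Q * (Fintype.card Q).factorial * (Fintype.card Q) ^ Fintype.card Q

theorem wickConst_nonneg (Q : Type*) [Fintype Q] : 0 ≤ wickConst Q := by
  unfold wickConst; positivity

/-- `c k * c k'` is at most half the sum of the squares; each half is then summed along rows or
columns. -/
theorem schur_test {κ : Type*} (S : Finset κ) (c : κ → ℝ) (r : κ → κ → ℝ) {M : ℝ}
    (hr : ∀ k k', 0 ≤ r k k') (h1 : ∀ k, ∑ k' ∈ S, r k k' ≤ M) (h2 : ∀ k', ∑ k ∈ S, r k k' ≤ M) :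
    ∑ k ∈ S, ∑ k' ∈ S, c k * c k' * r k k' ≤ M * ∑ k ∈ S, c k ^ 2 := by
  calc ∑ k ∈ S, ∑ k' ∈ S, c k * c k' * r k k'
      ≤ ∑ k ∈ S, ∑ k' ∈ S, (c k ^ 2 / 2 * r k k' + c k' ^ 2 / 2 * r k k') := by
        refine Finset.sum_le_sum fun k _ => Finset.sum_le_sum fun k' _ => ?_
        rw [← add_mul]
        exact mul_le_mul_of_nonneg_right (by nlinarith [sq_nonneg (c k - c k')]) (hr k k')
    _ = ∑ k ∈ S, c k ^ 2 / 2 * ∑ k' ∈ S, r k k' + ∑ k' ∈ S, c k' ^ 2 / 2 * ∑ k ∈ S, r k k' := by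
        simp only [Finset.sum_add_distrib, Finset.mul_sum]
        congr 1
        exact Finset.sum_comm
    _ ≤ ∑ k ∈ S, c k ^ 2 / 2 * M + ∑ k ∈ S, c k ^ 2 / 2 * M := by
        gcongr with k _ k _
        · exact h1 k
        · exact h2 k
    _ = M * ∑ k ∈ S, c k ^ 2 := by
        rw [← Finset.sum_add_distrib, Finset.mul_sum]
        exact Finset.sum_congr rfl fun k _ => by ring

/-- A nonzero entry forces `k'` to take values in the range of `k`, leaving at most `|Q| ^ |Q|`
choices. The row sums are therefore bounded independently of `S`. -/
theorem sum_le_wickConst (S : Finset (Q → ι)) {r : (Q → ι) → ℝ} (k : Q → ι)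
    (hr : ∀ k', r k' ≤ 2 ^ Fintype.card Q * (Fintype.card Q).factorial)
    (h : ∀ k', r k' ≠ 0 → ∀ q, ∃ q', k' q = k q') : ∑ k' ∈ S, r k' ≤ wickConst Q := by
  classical
  have hsub : S.filter (fun k' => r k' ≠ 0) ⊆
      Fintype.piFinset fun _ : Q => Finset.univ.image k := fun k' hk' => by
    rw [Fintype.mem_piFinset]
    intro q
    obtain ⟨q', hq'⟩ := h k' (Finset.mem_filter.1 hk').2 q
    exact Finset.mem_image.2 ⟨q', Finset.mem_univ _, hq'.symm⟩
  have hcard : (S.filter fun k' => r k' ≠ 0).card ≤ Fintype.card Q ^ Fintype.card Q := by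
    refine (Finset.card_le_card hsub).trans ?_
    rw [Fintype.card_piFinset, Finset.prod_const, Finset.card_univ]
    exact Nat.pow_le_pow_left Finset.card_image_le _
  rw [← Finset.sum_filter_ne_zero]
  refine (Finset.sum_le_card_nsmul _ _ _ fun k' _ => hr k').trans ?_
  rw [nsmul_eq_mul, wickConst, mul_comm]
  gcongr
  exact_mod_cast hcard

theorem integral_norm_sq_complexSum_le (hind : iIndepFun G P)
    (hlaw : ∀ j, HasLaw (G j) (gaussianReal 0 1) P) (S : Finset (Q → ι)) (c : (Q → ι) → ℝ) :
    ∫ z, ‖complexSum G S c z‖ ^ 2 ∂P.prod P ≤ wickConst Q * ∑ k ∈ S, c k ^ 2 := by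
  choose r hr hr0 hrM hrz using exists_wick_covariance (Q := Q) hind hlaw
  have h1 : ((∫ z, ‖complexSum G S c z‖ ^ 2 ∂P.prod P : ℝ) : ℂ) =
      ((∑ k ∈ S, ∑ k' ∈ S, c k * c k' * r k k' : ℝ) : ℂ) := by
    rw [← integral_complex_ofReal]
    have h2 : ∀ z, ((‖complexSum G S c z‖ ^ 2 : ℝ) : ℂ) = ∑ k ∈ S, ∑ k' ∈ S, ((c k : ℂ) * c k') *
        ((∏ q, complexify G (k q) z) * (starRingEnd ℂ) (∏ q, complexify G (k' q) z)) := fun z => by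
      rw [← Complex.normSq_eq_norm_sq, ← Complex.mul_conj, complexSum, map_sum, Finset.sum_mul_sum]
      refine Finset.sum_congr rfl fun k _ => Finset.sum_congr rfl fun k' _ => ?_
      rw [map_mul, Complex.conj_ofReal]
      ring
    have h3 : ∀ k k', AllMoments (fun z => ((c k : ℂ) * c k') * ((∏ q, complexify G (k q) z) *
        (starRingEnd ℂ) (∏ q, complexify G (k' q) z))) (P.prod P) := fun k k' =>
      ((AllMoments.prod _ fun q _ => allMoments_complexify hlaw (k q)).mul
        (AllMoments.prod _ fun q _ => allMoments_complexify hlaw (k' q)).star).const_mul _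
    rw [integral_congr_ae (ae_of_all _ h2), integral_finsetSum S fun k _ =>
      (AllMoments.sum S fun k' _ => h3 k k').integrable]
    push_cast
    refine Finset.sum_congr rfl fun k _ => ?_
    rw [integral_finsetSum S fun k' _ => (h3 k k').integrable]
    refine Finset.sum_congr rfl fun k' _ => ?_
    rw [integral_const_mul, hr]
  rw [Complex.ofReal_inj.1 h1]
  exact schur_test S c r hr0
    (fun k => sum_le_wickConst S k (hrM k) fun k' h => (hrz k k' h).1)
    (fun k' => sum_le_wickConst S k' (fun k => hrM k k') fun k h => (hrz k k' h).2)

/-- Monomials in the complex variables multiply without lower-order corrections, unlike Hermite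
products. The `p`-th power is thus a homogeneous polynomial indexed by `Fin p × Q` whose
coefficients are products of the old ones, and the second moment bound applies to it. -/
theorem integral_norm_pow_complexSum_le (hind : iIndepFun G P)
    (hlaw : ∀ j, HasLaw (G j) (gaussianReal 0 1) P) (S : Finset (Q → ι)) (c : (Q → ι) → ℝ)
    (p : ℕ) :
    ∫ z, ‖complexSum G S c z‖ ^ (2 * p) ∂P.prod P ≤
      wickConst (Fin p × Q) * (∑ k ∈ S, c k ^ 2) ^ p := by
  classical
  let E : (Fin p × Q → ι) ≃ (Fin p → Q → ι) := Equiv.curry _ _ _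
  set S' : Finset (Fin p × Q → ι) :=
    (Fintype.piFinset fun _ : Fin p => S).map E.symm.toEmbedding with hS'
  set c' : (Fin p × Q → ι) → ℝ := fun κ => ∏ a, c (E κ a) with hc'
  have h1 : ∀ z, complexSum G S c z ^ p = complexSum G S' c' z := fun z => by
    have : complexSum G S c z ^ p = ∏ _a : Fin p, complexSum G S c z := by simp
    rw [this]
    simp only [complexSum]
    rw [Finset.prod_univ_sum, hS', Finset.sum_map]
    refine Finset.sum_congr rfl fun K _ => ?_
    simp only [Equiv.coe_toEmbedding, hc', Equiv.apply_symm_apply]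
    rw [Finset.prod_mul_distrib, Fintype.prod_prod_type, Complex.ofReal_prod]
    rfl
  have h2 : ∑ κ ∈ S', c' κ ^ 2 = (∑ k ∈ S, c k ^ 2) ^ p := by
    have : (∑ k ∈ S, c k ^ 2) ^ p = ∏ _a : Fin p, ∑ k ∈ S, c k ^ 2 := by simp
    rw [this, Finset.prod_univ_sum, hS', Finset.sum_map]
    refine Finset.sum_congr rfl fun K _ => ?_
    simp only [Equiv.coe_toEmbedding, hc', Equiv.apply_symm_apply, Finset.prod_pow]
  have h3 := integral_norm_sq_complexSum_le hind hlaw S' c'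
  rw [h2] at h3
  simpa only [← h1, norm_pow, ← pow_mul, mul_comm p 2] using h3

open scoped Classical in
/-- The Wick product of the variables `G_{k q}`: a product of Hermite polynomials. -/
noncomputable def hermiteProd (G : ι → Ω → ℝ) (k : Q → ι) (ω : Ω) : ℝ :=
  ∏ j ∈ Finset.univ.image k, Polynomial.aeval (G j ω)
    (Polynomial.hermite (Finset.univ.filter fun q => k q = j).card)

theorem hermiteProd_eq {T : Finset ι} {k : Q → ι} (hk : ∀ q, k q ∈ T) (ω : Ω) :
    hermiteProd G k ω = ∏ j ∈ T, Polynomial.aeval (G j ω) (Polynomial.hermite (mult k j)) := by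
  classical
  rw [hermiteProd]
  have hsub : Finset.univ.image k ⊆ T := Finset.image_subset_iff.2 fun q _ => hk q
  rw [← Finset.prod_subset (s₁ := Finset.univ.image k) hsub fun j _ hj => ?_]
  · refine Finset.prod_congr (by congr!) fun j _ => ?_
    rw [mult]
  · have : mult k j = 0 := by
      by_contra h0
      obtain ⟨q, rfl⟩ := exists_eq_of_mult_ne_zero h0
      exact hj (Finset.mem_image_of_mem _ (Finset.mem_univ q))
    rw [this]
    simp

/-- Each Hermite factor is a Gaussian average over the imaginary part, and independence joins these
averages into one. -/
theorem hermiteProd_eq_integral (hind : iIndepFun G P)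
    (hlaw : ∀ j, HasLaw (G j) (gaussianReal 0 1) P) (k : Q → ι) (ω : Ω) :
    (hermiteProd G k ω : ℂ) = ∫ ω', ∏ q, complexify G (k q) (ω, ω') ∂P := by
  classical
  set T := Finset.univ.image k with hT
  have hk : ∀ q, k q ∈ T := fun q => by simp [hT]
  rw [hermiteProd_eq hk]
  have hcont : ∀ (x : ℝ) (n : ℕ), Continuous fun y : ℝ => ((x : ℂ) + Complex.I * y) ^ n :=
    fun x n => by fun_prop
  have := (hind.restrict T).integral_fun_prod_comp
    (f := fun (j : T) (y : ℝ) => ((G j ω : ℂ) + Complex.I * y) ^ mult k j)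
    (fun j => (hlaw j).aemeasurable) fun j => (hcont _ _).aestronglyMeasurable
  simp only [Finset.restrict] at this
  rw [Finset.prod_coe_sort T
    (fun j => ∫ ω', ((G j ω : ℂ) + Complex.I * G j ω') ^ mult k j ∂P)] at this
  rw [Complex.ofReal_prod]
  calc _ = ∏ j ∈ T, ∫ ω', ((G j ω : ℂ) + Complex.I * G j ω') ^ mult k j ∂P := by
        refine Finset.prod_congr rfl fun j _ => ?_
        rw [aeval_hermite_eq_integral, ← (hlaw j).map_eq,
          integral_map (hlaw j).aemeasurable (hcont _ _).aestronglyMeasurable]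
    _ = _ := by
        rw [← this]
        refine integral_congr_ae (ae_of_all _ fun ω' => ?_)
        simp only
        rw [prod_comp_eq_prod_pow_mult hk (fun j => complexify G j (ω, ω')),
          Finset.prod_coe_sort T (fun j => ((G j ω : ℂ) + Complex.I * G j ω') ^ mult k j)]
        rfl

theorem aestronglyMeasurable_hermiteProd (hlaw : ∀ j, HasLaw (G j) (gaussianReal 0 1) P)
    (k : Q → ι) : AEStronglyMeasurable (hermiteProd G k) P := by
  unfold hermiteProd
  refine Finset.aestronglyMeasurable_fun_prod _ fun j _ => ?_
  exact (Polynomial.continuous_aeval _).comp_aestronglyMeasurable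
    (hlaw j).aemeasurable.aestronglyMeasurable

/-- Hypercontractive moment bound for elements of a fixed Wiener chaos. -/
theorem lintegral_enorm_pow_hermite_sum_le (hind : iIndepFun G P)
    (hlaw : ∀ j, HasLaw (G j) (gaussianReal 0 1) P) (S : Finset (Q → ι)) (c : (Q → ι) → ℝ)
    {p : ℕ} (hp : p ≠ 0) :
    ∫⁻ ω, ‖∑ k ∈ S, c k * hermiteProd G k ω‖ₑ ^ (2 * p) ∂P ≤
      ENNReal.ofReal (wickConst (Fin p × Q) * (∑ k ∈ S, c k ^ 2) ^ p) := by
  have hF := allMoments_complexSum hlaw S c (P := P)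
  -- The real chaos element is the partial average of the complex polynomial over `ω'`, so
  -- monotonicity of `L^p` norms on a probability space (Jensen) dominates its power by the averaged
  -- power.
  have hpt : ∀ᵐ ω ∂P, ‖∑ k ∈ S, c k * hermiteProd G k ω‖ₑ ^ (2 * p) ≤
      ∫⁻ ω', ‖complexSum G S c (ω, ω')‖ₑ ^ (2 * p) ∂P := by
    have hint : ∀ᵐ ω ∂P, ∀ k ∈ S, Integrable (fun ω' => ∏ q, complexify G (k q) (ω, ω')) P := by
      rw [Filter.eventually_all_finset]
      exact fun k _ => (AllMoments.prod Finset.univ fun q _ =>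
        allMoments_complexify hlaw (k q)).integrable.prod_right_ae
    filter_upwards [hint, (hF.integrable).1.prodMk_left] with ω hω hm
    have h1 : ((∑ k ∈ S, c k * hermiteProd G k ω : ℝ) : ℂ) =
        ∫ ω', complexSum G S c (ω, ω') ∂P := by
      simp only [complexSum]
      rw [integral_finsetSum S fun k hk => (hω k hk).const_mul _]
      push_cast
      refine Finset.sum_congr rfl fun k _ => ?_
      rw [integral_const_mul, hermiteProd_eq_integral hind hlaw]
    have h2 : ‖∑ k ∈ S, c k * hermiteProd G k ω‖ₑ = ‖∫ ω', complexSum G S c (ω, ω') ∂P‖ₑ := by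
      rw [← h1, ← ofReal_norm, ← ofReal_norm, Complex.norm_real]
    have h3 : ‖∫ ω', complexSum G S c (ω, ω') ∂P‖ₑ ≤
        eLpNorm (fun ω' => complexSum G S c (ω, ω')) (2 * p : ℕ) P := by
      refine (enorm_integral_le_lintegral_enorm _).trans ?_
      rw [← eLpNorm_one_eq_lintegral_enorm]
      refine eLpNorm_le_eLpNorm_of_exponent_le ?_ hm
      exact_mod_cast Nat.one_le_iff_ne_zero.2 (by omega)
    rw [h2]
    refine (pow_le_pow_left' h3 _).trans_eq ?_
    have := eLpNorm_nnreal_pow_eq_lintegral (μ := P) (p := ((2 * p : ℕ) : ℝ≥0))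
      (f := fun ω' => complexSum G S c (ω, ω')) (by positivity)
    simpa only [NNReal.coe_natCast, ENNReal.rpow_natCast, ENNReal.coe_natCast] using this
  refine (lintegral_mono_ae hpt).trans ?_
  rw [← lintegral_prod (fun z => ‖complexSum G S c z‖ₑ ^ (2 * p))
    ((hF.integrable).1.enorm.pow_const _)]
  have h4 : Integrable (fun z => ‖complexSum G S c z‖ ^ (2 * p)) (P.prod P) := by
    have := (hF (2 * p)).integrable_norm_pow (by omega)
    exact_mod_cast this
  have h5 : ∀ z, ‖complexSum G S c z‖ₑ ^ (2 * p) =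
      ENNReal.ofReal (‖complexSum G S c z‖ ^ (2 * p)) := fun z => by
    rw [ENNReal.ofReal_pow (norm_nonneg _), ofReal_norm]
  simp only [h5]
  rw [← ofReal_integral_eq_lintegral_ofReal h4 (ae_of_all _ fun z => by positivity)]
  exact ENNReal.ofReal_le_ofReal (integral_norm_pow_complexSum_le hind hlaw S c p)

end Wick

/-! ### Integration by parts and uniqueness of the Malliavin derivative -/

section Malliavin

set_option linter.unusedSectionVars false

variable {Ω H : Type*} [MeasurableSpace Ω] [NormedAddCommGroup H] [InnerProductSpace ℝ H]
  {W : H → Ω → ℝ} {P : Measure Ω} [IsProbabilityMeasure P]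

theorem IsIsonormal.hasLaw (hW : IsIsonormal W P) (h : H) :
    HasLaw (W h) (gaussianReal 0 (‖h‖₊ ^ 2)) P where
  aemeasurable := hW.gaussian.aemeasurable h
  map_eq := by
    rw [(hW.gaussian.hasGaussianLaw_eval h).map_eq_gaussianReal, hW.centered,
      variance_of_integral_eq_zero (hW.gaussian.aemeasurable h) (hW.centered h)]
    congr 1
    have : ∫ ω, W h ω ^ 2 ∂P = ‖h‖ ^ 2 := by
      rw [← real_inner_self_eq_norm_sq, ← hW.covariance]
      simp only [pow_two]
    ext
    rw [this, Real.coe_toNNReal _ (by positivity)]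
    simp

theorem IsIsonormal.allMoments (hW : IsIsonormal W P) (h : H) : AllMoments (W h) P :=
  allMoments_of_hasLaw (hW.hasLaw h)

theorem IsIsonormal.covariance_eq (hW : IsIsonormal W P) (h g : H) :
    cov[W h, W g; P] = inner ℝ h g := by
  rw [covariance_eq_sub (hW.allMoments h).memLp_two (hW.allMoments g).memLp_two, hW.centered,
    zero_mul, sub_zero, ← hW.covariance]
  rfl

theorem IsIsonormal.hasLaw_basis (hW : IsIsonormal W P) {ι : Type*} (e : HilbertBasis ι ℝ H)
    (j : ι) : HasLaw (W (e j)) (gaussianReal 0 1) P := by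
  have := hW.hasLaw (e j)
  have h1 : ‖e j‖₊ = 1 := by ext; simpa using e.orthonormal.1 j
  rwa [h1, one_pow] at this

theorem IsIsonormal.iIndepFun_basis (hW : IsIsonormal W P) {ι : Type*} (e : HilbertBasis ι ℝ H) :
    iIndepFun (fun j => W (e j)) P := by
  rw [iIndepFun_iff_finset]
  intro T
  refine HasGaussianLaw.iIndepFun_of_covariance_eq_zero
    ((hW.gaussian.comp_right e).hasGaussianLaw T) fun i j hij => ?_
  change cov[W (e i), W (e j); P] = 0
  rw [hW.covariance_eq]
  exact e.orthonormal.2 fun h => hij (Subtype.ext h)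

/-- Subtracting the regression on `W h₀` makes the covariances with `W h₀` zero, and for jointly
Gaussian variables this is independence. -/
theorem IsIsonormal.indepFun_residual (hW : IsIsonormal W P) {κ : Type*} [Fintype κ] (h : κ → H)
    {h₀ : H} (h0 : h₀ ≠ 0) :
    IndepFun (W h₀) (fun ω i => W (h i) ω - inner ℝ (h i) h₀ / ‖h₀‖ ^ 2 * W h₀ ω) P := by
  classical
  set c : κ → ℝ := fun i => inner ℝ (h i) h₀ / ‖h₀‖ ^ 2 with hc
  set U : κ → Ω → ℝ := fun i ω => W (h i) ω - c i * W h₀ ω with hU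
  let I : Finset H := insert h₀ (Finset.univ.image h)
  have hI0 : h₀ ∈ I := Finset.mem_insert_self _ _
  have hIi : ∀ i, h i ∈ I := fun i => Finset.mem_insert_of_mem (by simp)
  let L : (I → ℝ) →L[ℝ] (Unit → ℝ) × (κ → ℝ) :=
    (ContinuousLinearMap.pi fun _ => ContinuousLinearMap.proj (⟨h₀, hI0⟩ : I)).prod
      (ContinuousLinearMap.pi fun i => ContinuousLinearMap.proj (⟨h i, hIi i⟩ : I) -
        c i • ContinuousLinearMap.proj (⟨h₀, hI0⟩ : I))
  have hlaw : HasGaussianLaw (fun ω => (fun _ : Unit => W h₀ ω, fun i => U i ω)) P :=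
    (hW.gaussian.hasGaussianLaw I).map_fun L
  have hind := hlaw.indepFun_of_covariance_eval (X := fun _ : Unit => W h₀) (Y := U)
    fun _ i => by
      have m := fun g => (hW.allMoments g).memLp_two
      have e1 : U i = W (h i) - c i • W h₀ := rfl
      rw [e1, covariance_sub_right (m h₀) (m (h i)) ((m h₀).const_smul _),
        covariance_smul_right, hW.covariance_eq, hW.covariance_eq, real_inner_self_eq_norm_sq, hc]
      have : ‖h₀‖ ^ 2 ≠ 0 := by positivity
      simp only
      rw [div_mul_cancel₀ _ this, real_inner_comm, sub_self]
  exact hind.comp (φ := fun x : Unit → ℝ => x ()) (measurable_pi_apply _) measurable_id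

/-- Gaussian integration by parts. -/
theorem IsIsonormal.integral_fderiv_eq (hW : IsIsonormal W P) {κ : Type*} [Fintype κ]
    (h : κ → H) {h₀ : H} (h0 : h₀ ≠ 0) {φ : (κ → ℝ) → ℝ} (hφ : ContDiff ℝ 1 φ) {B B' : ℝ}
    (hB : ∀ x, |φ x| ≤ B) (hB' : ∀ x, ‖fderiv ℝ φ x‖ ≤ B') :
    ∫ ω, fderiv ℝ φ (fun i => W (h i) ω) (fun i => inner ℝ (h i) h₀) ∂P =
      ∫ ω, φ (fun i => W (h i) ω) * W h₀ ω ∂P := by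
  set v : ℝ≥0 := ‖h₀‖₊ ^ 2 with hv
  have hv0 : v ≠ 0 := by simpa [hv] using h0
  have hvr : (v : ℝ) = ‖h₀‖ ^ 2 := by simp [hv]
  set c : κ → ℝ := fun i => inner ℝ (h i) h₀ / ‖h₀‖ ^ 2 with hc
  set U : Ω → κ → ℝ := fun ω i => W (h i) ω - c i * W h₀ ω with hU
  have hWm := fun g => (hW.hasLaw g).aemeasurable
  have hUm : AEMeasurable U P :=
    aemeasurable_pi_lambda _ fun i => (hWm _).sub ((hWm _).const_mul _)
  have : IsProbabilityMeasure (P.map U) := Measure.isProbabilityMeasure_map hUm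
  have hmap : P.map (fun ω => (W h₀ ω, U ω)) = (gaussianReal 0 v).prod (P.map U) := by
    rw [(indepFun_iff_map_prod_eq_prod_map_map (hWm _) hUm).1 (hW.indepFun_residual h h0),
      (hW.hasLaw h₀).map_eq]
  have hrec : ∀ ω, U ω + W h₀ ω • c = fun i => W (h i) ω := fun ω => by
    ext i; simp [hU]; ring
  have hfd : Continuous (fderiv ℝ φ) := hφ.continuous_fderiv one_ne_zero
  have c1 : Continuous fun z : ℝ × (κ → ℝ) => φ (z.2 + z.1 • c) :=
    hφ.continuous.comp (by fun_prop)
  have c2 : Continuous fun z : ℝ × (κ → ℝ) => fderiv ℝ φ (z.2 + z.1 • c) c :=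
    (hfd.comp (by fun_prop)).clm_apply continuous_const
  have mpair : AEMeasurable (fun ω => (W h₀ ω, U ω)) P := (hWm _).prodMk hUm
  have i1 : Integrable (fun z : ℝ × (κ → ℝ) => z.1 * φ (z.2 + z.1 • c))
      ((gaussianReal 0 v).prod (P.map U)) := by
    refine Integrable.mono' (((allMoments_gaussianReal v).comp_fst
      (Q := P.map U)).integrable.norm.mul_const B)
      (continuous_fst.mul c1).aestronglyMeasurable (ae_of_all _ fun z => ?_)
    rw [norm_mul]
    exact mul_le_mul_of_nonneg_left (hB _) (norm_nonneg _)
  have i2 : Integrable (fun z : ℝ × (κ → ℝ) => fderiv ℝ φ (z.2 + z.1 • c) c)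
      ((gaussianReal 0 v).prod (P.map U)) :=
    Integrable.mono' (integrable_const (B' * ‖c‖)) c2.aestronglyMeasurable (ae_of_all _ fun z =>
      (ContinuousLinearMap.le_opNorm _ _).trans
        (mul_le_mul_of_nonneg_right (hB' _) (norm_nonneg _)))
  have e1 : ∫ ω, φ (fun i => W (h i) ω) * W h₀ ω ∂P =
      ∫ z, z.1 * φ (z.2 + z.1 • c) ∂(gaussianReal 0 v).prod (P.map U) := by
    rw [← hmap, integral_map (f := fun z : ℝ × (κ → ℝ) => z.1 * φ (z.2 + z.1 • c)) mpair
      (continuous_fst.mul c1).aestronglyMeasurable]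
    refine integral_congr_ae (ae_of_all _ fun ω => ?_)
    simp only [hrec]
    ring
  have e2 : ∫ ω, fderiv ℝ φ (fun i => W (h i) ω) (fun i => inner ℝ (h i) h₀) ∂P =
      v * ∫ z, fderiv ℝ φ (z.2 + z.1 • c) c ∂(gaussianReal 0 v).prod (P.map U) := by
    rw [← hmap, integral_map mpair c2.aestronglyMeasurable, ← integral_const_mul]
    refine integral_congr_ae (ae_of_all _ fun ω => ?_)
    simp only [hrec]
    rw [← smul_eq_mul, ← map_smul]
    congr 1
    ext i
    have : ‖h₀‖ ^ 2 ≠ 0 := by positivity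
    simp only [Pi.smul_apply, smul_eq_mul, hc, hvr]
    field_simp
  -- With the residual fixed at `u` the Gaussian vector runs along the line `u + x • c`, and the
  -- claim is Stein's identity in `x`.
  rw [e1, e2, integral_prod_symm _ i1, integral_prod_symm _ i2, ← integral_const_mul]
  refine integral_congr_ae (ae_of_all _ fun u => ?_)
  have hder : ∀ x : ℝ, HasDerivAt (fun x : ℝ => φ (u + x • c)) (fderiv ℝ φ (u + x • c) c) x :=
    fun x => by
      have h1 : HasDerivAt (fun x : ℝ => u + x • c) c x := by
        simpa using ((hasDerivAt_id x).smul_const c).const_add u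
      exact ((hφ.differentiable one_ne_zero _).hasFDerivAt).comp_hasDerivAt x h1
  have cu : Continuous fun x : ℝ => φ (u + x • c) := c1.comp (Continuous.prodMk_left u)
  have := integral_smul_gaussianReal hv0 hder
    (Integrable.mono' (integrable_const B) cu.aestronglyMeasurable (ae_of_all _ fun x => hB _))
    (Integrable.mono' ((allMoments_gaussianReal v).integrable.norm.mul_const B)
      (continuous_id.smul cu).aestronglyMeasurable (ae_of_all _ fun x => by
        rw [norm_smul]; exact mul_le_mul_of_nonneg_left (hB _) (norm_nonneg _)))
    (Integrable.mono' (integrable_const (B' * ‖c‖))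
      (c2.comp (Continuous.prodMk_left u)).aestronglyMeasurable (ae_of_all _ fun z =>
      (ContinuousLinearMap.le_opNorm _ _).trans
        (mul_le_mul_of_nonneg_right (hB' _) (norm_nonneg _))))
  simp only [smul_eq_mul] at this
  exact this.symm

/-- A `C¹` function of finitely many `W(h_i)`, bounded with its derivative. -/
structure TestFunction (κ : Type*) [Fintype κ] where
  /-- the function -/
  toFun : (κ → ℝ) → ℝ
  contDiff : ContDiff ℝ 1 toFun
  /-- the bound -/
  bound : ℝ
  bdd : ∀ x, |toFun x| ≤ bound
  bdd_fderiv : ∀ x, ‖fderiv ℝ toFun x‖ ≤ bound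

/-- Product of test functions in different variables. -/
theorem TestFunction.exists_prod {κ κ' : Type*} [Fintype κ] [Fintype κ'] (φ : TestFunction κ)
    (ψ : TestFunction κ') : ∃ θ : TestFunction (κ ⊕ κ'),
      (∀ x, θ.toFun x = φ.toFun (x ∘ Sum.inl) * ψ.toFun (x ∘ Sum.inr)) ∧
      ∀ x y, fderiv ℝ θ.toFun x y =
        φ.toFun (x ∘ Sum.inl) * fderiv ℝ ψ.toFun (x ∘ Sum.inr) (y ∘ Sum.inr) +
        ψ.toFun (x ∘ Sum.inr) * fderiv ℝ φ.toFun (x ∘ Sum.inl) (y ∘ Sum.inl) := by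
  let L₁ : (κ ⊕ κ' → ℝ) →L[ℝ] (κ → ℝ) :=
    ContinuousLinearMap.pi fun i => ContinuousLinearMap.proj (Sum.inl i)
  let L₂ : (κ ⊕ κ' → ℝ) →L[ℝ] (κ' → ℝ) :=
    ContinuousLinearMap.pi fun i => ContinuousLinearMap.proj (Sum.inr i)
  have hd : ∀ x, HasFDerivAt (fun x => φ.toFun (L₁ x) * ψ.toFun (L₂ x))
      (φ.toFun (L₁ x) • (fderiv ℝ ψ.toFun (L₂ x)).comp L₂ +
        ψ.toFun (L₂ x) • (fderiv ℝ φ.toFun (L₁ x)).comp L₁) x := fun x =>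
    ((φ.contDiff.differentiable one_ne_zero _).hasFDerivAt.comp x L₁.hasFDerivAt).mul
      ((ψ.contDiff.differentiable one_ne_zero _).hasFDerivAt.comp x L₂.hasFDerivAt)
  have hφ0 : 0 ≤ φ.bound := (abs_nonneg _).trans (φ.bdd 0)
  have hψ0 : 0 ≤ ψ.bound := (abs_nonneg _).trans (ψ.bdd 0)
  refine ⟨⟨fun x => φ.toFun (L₁ x) * ψ.toFun (L₂ x),
    (φ.contDiff.comp L₁.contDiff).mul (ψ.contDiff.comp L₂.contDiff),
    max (φ.bound * ψ.bound) (φ.bound * (ψ.bound * ‖L₂‖) + ψ.bound * (φ.bound * ‖L₁‖)),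
    fun x => ?_, fun x => ?_⟩, fun x => rfl, fun x y => ?_⟩
  · rw [abs_mul]
    exact (mul_le_mul (φ.bdd _) (ψ.bdd _) (abs_nonneg _) hφ0).trans (le_max_left _ _)
  · rw [(hd x).fderiv]
    refine (norm_add_le _ _).trans (le_trans ?_ (le_max_right _ _))
    rw [norm_smul, norm_smul]
    refine add_le_add (mul_le_mul (φ.bdd _) ?_ (norm_nonneg _) hφ0)
      (mul_le_mul (ψ.bdd _) ?_ (norm_nonneg _) hψ0)
    · exact (ContinuousLinearMap.opNorm_comp_le _ _).trans
        (mul_le_mul_of_nonneg_right (ψ.bdd_fderiv _) (norm_nonneg _))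
    · exact (ContinuousLinearMap.opNorm_comp_le _ _).trans
        (mul_le_mul_of_nonneg_right (φ.bdd_fderiv _) (norm_nonneg _))
  · simp only
    rw [(hd x).fderiv]
    rfl

/-- The value of a test function at the Gaussian vector. -/
def TestFunction.eval {κ : Type*} [Fintype κ] (φ : TestFunction κ) (W : H → Ω → ℝ) (h : κ → H)
    (ω : Ω) : ℝ := φ.toFun fun i => W (h i) ω

/-- The derivative of the value of a test function in the direction `h₀`. -/
noncomputable def TestFunction.dir {κ : Type*} [Fintype κ] (φ : TestFunction κ) (W : H → Ω → ℝ)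
    (h : κ → H) (h₀ : H) (ω : Ω) : ℝ :=
  fderiv ℝ φ.toFun (fun i => W (h i) ω) fun i => inner ℝ (h i) h₀

theorem IsIsonormal.aemeasurable_pi (hW : IsIsonormal W P) {κ : Type*} [Fintype κ] (h : κ → H) :
    AEMeasurable (fun ω i => W (h i) ω) P :=
  aemeasurable_pi_lambda _ fun i => (hW.hasLaw (h i)).aemeasurable

theorem TestFunction.memLp_eval (hW : IsIsonormal W P) {κ : Type*} [Fintype κ]
    (φ : TestFunction κ) (h : κ → H) (p : ℝ≥0∞) : MemLp (φ.eval W h) p P :=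
  MemLp.of_bound (φ.contDiff.continuous.comp_aestronglyMeasurable
    (hW.aemeasurable_pi h).aestronglyMeasurable) φ.bound (ae_of_all _ fun _ => φ.bdd _)

theorem TestFunction.memLp_dir (hW : IsIsonormal W P) {κ : Type*} [Fintype κ]
    (φ : TestFunction κ) (h : κ → H) (h₀ : H) (p : ℝ≥0∞) : MemLp (φ.dir W h h₀) p P :=
  MemLp.of_bound (((φ.contDiff.continuous_fderiv one_ne_zero).clm_apply
    continuous_const).comp_aestronglyMeasurable (hW.aemeasurable_pi h).aestronglyMeasurable)
    (φ.bound * ‖fun i => inner ℝ (h i) h₀‖) (ae_of_all _ fun _ =>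
    (ContinuousLinearMap.le_opNorm _ _).trans
      (mul_le_mul_of_nonneg_right (φ.bdd_fderiv _) (norm_nonneg _)))

/-- Integration by parts is applied to the product of the two test functions and the product rule is
rearranged. This shifts the derivative off `φ`, the form that survives `L²` limits in `φ`. -/
theorem IsIsonormal.integral_dir_mul (hW : IsIsonormal W P) {κ κ' : Type*} [Fintype κ] [Fintype κ']
    (φ : TestFunction κ) (h : κ → H) (ψ : TestFunction κ') (h' : κ' → H) {h₀ : H} (h0 : h₀ ≠ 0) :
    ∫ ω, φ.dir W h h₀ ω * ψ.eval W h' ω ∂P =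
      ∫ ω, φ.eval W h ω * (ψ.eval W h' ω * W h₀ ω - ψ.dir W h' h₀ ω) ∂P := by
  obtain ⟨θ, hθ, hθ'⟩ := φ.exists_prod ψ
  have key := hW.integral_fderiv_eq (Sum.elim h h') h0 θ.contDiff θ.bdd θ.bdd_fderiv
  have e1 : ∀ ω, fderiv ℝ θ.toFun (fun i => W (Sum.elim h h' i) ω)
      (fun i => inner ℝ (Sum.elim h h' i) h₀) =
      φ.eval W h ω * ψ.dir W h' h₀ ω + φ.dir W h h₀ ω * ψ.eval W h' ω := fun ω => by
    rw [hθ', mul_comm (φ.dir W h h₀ ω)]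
    rfl
  have e2 : ∀ ω, θ.toFun (fun i => W (Sum.elim h h' i) ω) * W h₀ ω =
      φ.eval W h ω * (ψ.eval W h' ω * W h₀ ω) := fun ω => by
    rw [hθ, mul_assoc]
    rfl
  simp only [e1, e2] at key
  have mφ := φ.memLp_eval hW h ∞
  have i1 : Integrable (fun ω => φ.eval W h ω * ψ.dir W h' h₀ ω) P :=
    memLp_one_iff_integrable.1 ((ψ.memLp_dir hW h' h₀ 1).mul mφ)
  have i2 : Integrable (fun ω => φ.dir W h h₀ ω * ψ.eval W h' ω) P :=
    memLp_one_iff_integrable.1 ((ψ.memLp_eval hW h' 1).mul (φ.memLp_dir hW h h₀ ∞))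
  have i3 : Integrable (fun ω => φ.eval W h ω * (ψ.eval W h' ω * W h₀ ω)) P :=
    memLp_one_iff_integrable.1 (MemLp.mul (p := ∞) (q := 1) (MemLp.mul (p := ∞) (q := 1)
      (memLp_one_iff_integrable.2 (hW.allMoments h₀).integrable) (ψ.memLp_eval hW h' ∞)) mφ)
  rw [integral_add i1 i2] at key
  simp only [mul_sub]
  rw [integral_sub i3 i1, ← key]
  ring

theorem IsCylindricalDeriv.exists_testFunction {F : Ω → ℝ} {DF : Ω → H}
    (h : IsCylindricalDeriv W F DF) : ∃ (m : ℕ) (k : Fin m → H) (φ : TestFunction (Fin m)),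
      F = φ.eval W k ∧ ∀ h₀, (fun ω => inner ℝ (DF ω) h₀) = φ.dir W k h₀ := by
  obtain ⟨m, k, φ, hφ, hb, hF, hDF⟩ := h
  obtain ⟨C₀, h0⟩ := hb 0
  obtain ⟨C₁, h1⟩ := hb 1
  refine ⟨m, k, ⟨φ, hφ.of_le (by exact_mod_cast le_top), max C₀ C₁, fun x => ?_, fun x => ?_⟩,
    funext hF, fun h₀ => funext fun ω => ?_⟩
  · have := h0 x
    rw [norm_iteratedFDeriv_zero] at this
    exact this.trans (le_max_left _ _)
  · have := h1 x
    rw [norm_iteratedFDeriv_one] at this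
    exact this.trans (le_max_right _ _)
  · rw [hDF, TestFunction.dir, sum_inner]
    simp only [real_inner_smul_left]
    conv_rhs => rw [pi_eq_sum_univ' (fun i => inner ℝ (k i) h₀)]
    rw [map_sum]
    refine Finset.sum_congr rfl fun i _ => ?_
    rw [map_smul, smul_eq_mul, mul_comm]

/-- Bounded second derivatives make the directional derivative itself a test function. The
uniqueness proof tests the difference of two derivatives against such functions. -/
theorem IsCylindricalDeriv.exists_testFunction_dir {F : Ω → ℝ} {DF : Ω → H}
    (h : IsCylindricalDeriv W F DF) (h₀ : H) :
    ∃ (m : ℕ) (k : Fin m → H) (ψ : TestFunction (Fin m)),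
      (fun ω => inner ℝ (DF ω) h₀) = ψ.eval W k := by
  have h' := h
  obtain ⟨m, k, φ, hφ, hb, hF, hDF⟩ := h'
  obtain ⟨C₁, h1⟩ := hb 1
  obtain ⟨C₂, h2⟩ := hb 2
  set c : Fin m → ℝ := fun i => inner ℝ (k i) h₀ with hc
  have hf1 : ContDiff ℝ 1 (fderiv ℝ φ) := hφ.fderiv_right
    (WithTop.coe_le_coe.2 (le_top : (1 + 1 : ℕ∞) ≤ ⊤))
  have hder : ∀ x, HasFDerivAt (fun x => fderiv ℝ φ x c)
      ((ContinuousLinearMap.apply ℝ ℝ c).comp (fderiv ℝ (fderiv ℝ φ) x)) x := fun x =>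
    (ContinuousLinearMap.apply ℝ ℝ c).hasFDerivAt.comp x
      (hf1.differentiable one_ne_zero x).hasFDerivAt
  refine ⟨m, k, ⟨fun x => fderiv ℝ φ x c, hf1.clm_apply contDiff_const,
    max (C₁ * ‖c‖) (‖ContinuousLinearMap.apply ℝ ℝ c‖ * C₂), fun x => ?_, fun x => ?_⟩, ?_⟩
  · have := h1 x
    rw [norm_iteratedFDeriv_one] at this
    exact ((ContinuousLinearMap.le_opNorm _ _).trans
      (mul_le_mul_of_nonneg_right this (norm_nonneg _))).trans (le_max_left _ _)
  · have := h2 x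
    rw [← norm_iteratedFDeriv_fderiv, norm_iteratedFDeriv_one] at this
    rw [(hder x).fderiv]
    exact ((ContinuousLinearMap.opNorm_comp_le _ _).trans
      (mul_le_mul_of_nonneg_left this (norm_nonneg _))).trans (le_max_right _ _)
  · funext ω
    rw [hDF, sum_inner, TestFunction.eval]
    simp only [real_inner_smul_left]
    conv_rhs => rw [hc, pi_eq_sum_univ' (fun i => inner ℝ (k i) h₀)]
    rw [map_sum]
    refine Finset.sum_congr rfl fun i _ => ?_
    rw [map_smul, smul_eq_mul, mul_comm]

theorem integrable_fun_mul {F G : Ω → ℝ} (hF : MemLp F 2 P) (hG : MemLp G 2 P) :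
    Integrable (fun ω => F ω * G ω) P := hF.integrable_mul hG

theorem tendsto_integral_mul_of_eLpNorm {F : Ω → ℝ} {G : ℕ → Ω → ℝ} {Ψ : Ω → ℝ}
    (hF : MemLp F 2 P) (hG : ∀ k, MemLp (G k) 2 P) (hΨ : MemLp Ψ 2 P)
    (h : Tendsto (fun k => eLpNorm (fun ω => F ω - G k ω) 2 P) atTop (𝓝 0)) :
    Tendsto (fun k => ∫ ω, G k ω * Ψ ω ∂P) atTop (𝓝 (∫ ω, F ω * Ψ ω ∂P)) := by
  refine tendsto_integral_of_L1' _ (integrable_fun_mul hF hΨ).aestronglyMeasurable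
    (Eventually.of_forall fun k => (hG k).integrable_mul hΨ) ?_
  have hz := ENNReal.Tendsto.mul_const h (Or.inr hΨ.2.ne)
  rw [zero_mul] at hz
  refine tendsto_of_tendsto_of_tendsto_of_le_of_le tendsto_const_nhds hz (fun _ => zero_le)
    fun k => ?_
  have e1 : (fun ω => G k ω * Ψ ω) - (fun ω => F ω * Ψ ω) =
      -((fun ω => F ω - G k ω) • Ψ) := by
    ext ω; simp; ring
  rw [e1, eLpNorm_neg]
  exact eLpNorm_smul_le_mul_eLpNorm hΨ.1 (hF.1.sub (hG k).1)

theorem memLp_of_tendsto_eLpNorm {E : Type*} [NormedAddCommGroup E] {F : Ω → E} {G : ℕ → Ω → E}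
    (hF : AEStronglyMeasurable F P) (hG : ∀ k, MemLp (G k) 2 P)
    (h : Tendsto (fun k => eLpNorm (fun ω => F ω - G k ω) 2 P) atTop (𝓝 0)) : MemLp F 2 P := by
  obtain ⟨k, hk⟩ := (h.eventually (gt_mem_nhds one_pos)).exists
  have h1 : MemLp (fun ω => F ω - G k ω) 2 P := ⟨hF.sub (hG k).1, hk.trans ENNReal.one_lt_top⟩
  have := h1.add (hG k)
  convert! this using 1
  ext ω
  simp

theorem tendsto_eLpNorm_inner {F : Ω → H} {G : ℕ → Ω → H} (h₀ : H)
    (h : Tendsto (fun k => eLpNorm (fun ω => F ω - G k ω) 2 P) atTop (𝓝 0)) :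
    Tendsto (fun k => eLpNorm (fun ω => inner ℝ (F ω) h₀ - inner ℝ (G k ω) h₀) 2 P) atTop
      (𝓝 0) := by
  have hz := ENNReal.Tendsto.const_mul h (a := ENNReal.ofReal ‖h₀‖) (Or.inr (by finiteness))
  rw [mul_zero] at hz
  refine tendsto_of_tendsto_of_tendsto_of_le_of_le tendsto_const_nhds hz (fun _ => zero_le)
    fun k => ?_
  refine eLpNorm_le_mul_eLpNorm_of_ae_le_mul (ae_of_all _ fun ω => ?_) 2
  rw [← inner_sub_left, mul_comm]
  exact norm_inner_le_norm _ _

theorem IsMalliavinDeriv.memLp_inner (hW : IsIsonormal W P) {F : Ω → ℝ} {DF : Ω → H}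
    (h : IsMalliavinDeriv W P F DF) (h₀ : H) : MemLp (fun ω => inner ℝ (DF ω) h₀) 2 P := by
  obtain ⟨-, hDm, G, DG, hG, -, hD⟩ := h
  refine memLp_of_tendsto_eLpNorm (G := fun k ω => inner ℝ (DG k ω) h₀)
    (hDm.inner aestronglyMeasurable_const) (fun k => ?_) (tendsto_eLpNorm_inner h₀ hD)
  obtain ⟨m, l, φ, -, h2⟩ := (hG k).exists_testFunction
  rw [h2 h₀]
  exact φ.memLp_dir hW l h₀ 2

/-- Both sides are `L²`-continuous in the pair `(F, DF)`, so the identity for cylindrical variables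
passes to the closure. The right side involves `F` alone, whence uniqueness. -/
theorem IsMalliavinDeriv.integral_inner_mul (hW : IsIsonormal W P) {F : Ω → ℝ} {DF : Ω → H}
    (h : IsMalliavinDeriv W P F DF) {κ : Type*} [Fintype κ] (ψ : TestFunction κ) (h' : κ → H)
    {h₀ : H} (h0 : h₀ ≠ 0) :
    ∫ ω, inner ℝ (DF ω) h₀ * ψ.eval W h' ω ∂P =
      ∫ ω, F ω * (ψ.eval W h' ω * W h₀ ω - ψ.dir W h' h₀ ω) ∂P := by
  have hDF := h.memLp_inner hW h₀
  obtain ⟨hFm, hDm, G, DG, hG, hF, hD⟩ := h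
  choose m l φ h1 h2 using fun k => (hG k).exists_testFunction
  have hGm : ∀ k, MemLp (G k) 2 P := fun k => h1 k ▸ (φ k).memLp_eval hW (l k) 2
  have hDGm : ∀ k, MemLp (fun ω => inner ℝ (DG k ω) h₀) 2 P := fun k =>
    h2 k h₀ ▸ (φ k).memLp_dir hW (l k) h₀ 2
  have hΨ : MemLp (fun ω => ψ.eval W h' ω * W h₀ ω - ψ.dir W h' h₀ ω) 2 P :=
    (MemLp.mul (p := ∞) (q := 2) (hW.allMoments h₀).memLp_two (ψ.memLp_eval hW h' ∞)).sub
      (ψ.memLp_dir hW h' h₀ 2)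
  refine tendsto_nhds_unique (tendsto_integral_mul_of_eLpNorm hDF hDGm (ψ.memLp_eval hW h' 2)
    (tendsto_eLpNorm_inner h₀ hD)) ?_
  refine (tendsto_integral_mul_of_eLpNorm (memLp_of_tendsto_eLpNorm hFm hGm hF) hGm hΨ
    hF).congr fun k => ?_
  rw [h1 k, ← hW.integral_dir_mul (φ k) (l k) ψ h' h0]
  refine integral_congr_ae (ae_of_all _ fun ω => ?_)
  simp only
  rw [← h2 k h₀]

/-- The Malliavin derivative is unique. -/
theorem IsMalliavinDeriv.ae_eq (hW : IsIsonormal W P) [SecondCountableTopology H] {F : Ω → ℝ}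
    {D₁ D₂ : Ω → H} (h₁ : IsMalliavinDeriv W P F D₁) (h₂ : IsMalliavinDeriv W P F D₂) :
    D₁ =ᵐ[P] D₂ := by
  rw [← sub_ae_eq_zero]
  refine ae_eq_zero_of_forall_inner (𝕜 := ℝ) fun h₀ => ?_
  rcases eq_or_ne h₀ 0 with rfl | h0
  · exact ae_of_all _ fun ω => by simp
  set V : Ω → ℝ := fun ω => inner ℝ (D₁ ω) h₀ - inner ℝ (D₂ ω) h₀ with hV
  have m1 := h₁.memLp_inner hW h₀
  have m2 := h₂.memLp_inner hW h₀
  have mV : MemLp V 2 P := m1.sub m2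
  have horth : ∀ (m : ℕ) (k : Fin m → H) (ψ : TestFunction (Fin m)),
      ∫ ω, ψ.eval W k ω * V ω ∂P = 0 := fun m k ψ => by
    have e1 := h₁.integral_inner_mul hW ψ k h0
    have e2 := h₂.integral_inner_mul hW ψ k h0
    have m3 := ψ.memLp_eval hW k 2
    have : ∀ ω, ψ.eval W k ω * V ω =
        inner ℝ (D₁ ω) h₀ * ψ.eval W k ω - inner ℝ (D₂ ω) h₀ * ψ.eval W k ω := fun ω => by
      rw [hV]; ring
    simp only [this]
    rw [integral_sub (integrable_fun_mul m1 m3) (integrable_fun_mul m2 m3), e1, e2, sub_self]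
  -- Density of test functions in `L²` is not needed: each derivative is by definition a limit of
  -- test functions in direction `h₀`, so `V` is orthogonal to both terms of which it is the
  -- difference, hence to itself.
  have hzero : ∀ D : Ω → H, IsMalliavinDeriv W P F D →
      ∫ ω, inner ℝ (D ω) h₀ * V ω ∂P = 0 := fun D hD => by
    have mD := hD.memLp_inner hW h₀
    obtain ⟨-, -, G, DG, hG, -, hlim⟩ := hD
    choose m k ψ hψ using fun i => (hG i).exists_testFunction_dir h₀
    refine tendsto_nhds_unique (tendsto_integral_mul_of_eLpNorm mD (fun i => ?_) mV
      (tendsto_eLpNorm_inner h₀ hlim)) (tendsto_const_nhds.congr fun i => ?_)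
    · rw [hψ i]
      exact (ψ i).memLp_eval hW (k i) 2
    · rw [← horth (m i) (k i) (ψ i)]
      refine integral_congr_ae (ae_of_all _ fun ω => ?_)
      simp only
      rw [← hψ i]
  have hsq : ∫ ω, V ω ^ 2 ∂P = 0 := by
    have : ∀ ω, V ω ^ 2 = inner ℝ (D₁ ω) h₀ * V ω - inner ℝ (D₂ ω) h₀ * V ω := fun ω => by
      rw [hV]; ring
    simp only [this]
    rw [integral_sub (integrable_fun_mul m1 mV) (integrable_fun_mul m2 mV), hzero _ h₁, hzero _ h₂,
      sub_self]
  rw [integral_eq_zero_iff_of_nonneg (fun ω => sq_nonneg _) mV.integrable_sq] at hsq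
  filter_upwards [hsq] with ω hω
  have : V ω = 0 := by simpa using hω
  simp only [Pi.sub_apply, Pi.zero_apply, inner_sub_right]
  rw [real_inner_comm (D₁ ω) h₀, real_inner_comm (D₂ ω) h₀]
  exact this

end Malliavin

/-! ### Malliavin derivatives of smooth functions of Gaussian vectors -/

theorem eLpNorm_two_sq {Ω E : Type*} [MeasurableSpace Ω] {P : Measure Ω}
    [NormedAddCommGroup E] (f : Ω → E) : eLpNorm f 2 P ^ 2 = ∫⁻ ω, ‖f ω‖ₑ ^ 2 ∂P := by
  have := eLpNorm_nnreal_pow_eq_lintegral (μ := P) (p := 2) (f := f) two_ne_zero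
  have h2 : ((2 : ℝ≥0) : ℝ) = (2 : ℕ) := by norm_num
  simpa only [h2, ENNReal.rpow_natCast, ENNReal.coe_ofNat] using this

theorem tendsto_eLpNorm_zero_of_dominated {Ω E : Type*} [MeasurableSpace Ω] {P : Measure Ω}
    [NormedAddCommGroup E] {F : ℕ → Ω → E} {g : Ω → ℝ} (hF : ∀ k, AEStronglyMeasurable (F k) P)
    (hg : MemLp g 2 P) (hb : ∀ k ω, ‖F k ω‖ ≤ g ω) (hlim : ∀ ω, ∀ᶠ k in atTop, F k ω = 0) :
    Tendsto (fun k => eLpNorm (F k) 2 P) atTop (𝓝 0) := by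
  have h1 : Tendsto (fun k => ∫⁻ ω, ‖F k ω‖ₑ ^ 2 ∂P) atTop (𝓝 (∫⁻ _ω, 0 ∂P)) := by
    refine tendsto_lintegral_of_dominated_convergence' (fun ω => ‖g ω‖ₑ ^ 2)
      (fun k => (hF k).enorm.pow_const 2) (fun k => ae_of_all _ fun ω => ?_) ?_
      (ae_of_all _ fun ω => ?_)
    · refine pow_le_pow_left' ?_ 2
      rw [enorm_le_iff_norm_le]
      exact (hb k ω).trans (le_abs_self _)
    · rw [← eLpNorm_two_sq]
      exact ENNReal.pow_ne_top hg.2.ne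
    · refine tendsto_const_nhds.congr' ((hlim ω).mono fun k hk => ?_)
      simp [hk]
  rw [lintegral_zero] at h1
  have h2 := h1.ennrpow_const (1 / 2)
  rw [ENNReal.zero_rpow_of_pos (by norm_num)] at h2
  refine h2.congr fun k => ?_
  rw [← eLpNorm_two_sq, ← ENNReal.rpow_natCast, ← ENNReal.rpow_mul]
  norm_num

/-- Multiplication by a bump dilated by `k + 1` gives compact support, hence bounded derivatives of
all orders. The derivative of the bump stays below a fixed `M`, which provides a dominating
function, and near any given point the bump is eventually `1`. -/
theorem exists_cutoff {m : ℕ} {φ : (Fin m → ℝ) → ℝ}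
    (hφ : ContDiff ℝ ((⊤ : ℕ∞) : WithTop ℕ∞) φ) :
    ∃ (φk : ℕ → (Fin m → ℝ) → ℝ) (M : ℝ), 0 ≤ M ∧
      (∀ k, ContDiff ℝ ((⊤ : ℕ∞) : WithTop ℕ∞) (φk k)) ∧
      (∀ k q, ∃ C, ∀ x, ‖iteratedFDeriv ℝ q (φk k) x‖ ≤ C) ∧
      (∀ k x, |φk k x| ≤ |φ x|) ∧
      (∀ k x, ‖fderiv ℝ (φk k) x‖ ≤ ‖fderiv ℝ φ x‖ + M * |φ x|) ∧
      ∀ x, ∀ᶠ k in atTop, φk k x = φ x ∧ fderiv ℝ (φk k) x = fderiv ℝ φ x := by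
  let b : ContDiffBump (0 : Fin m → ℝ) := ⟨1, 2, one_pos, one_lt_two⟩
  have hb : ContDiff ℝ ((⊤ : ℕ∞) : WithTop ℕ∞) b := b.contDiff
  obtain ⟨M, hM⟩ := (b.hasCompactSupport.fderiv (𝕜 := ℝ)).exists_bound_of_continuous
    (hb.continuous_fderiv (by simp))
  have hM0 : 0 ≤ M := (norm_nonneg _).trans (hM 0)
  set s : ℕ → ℝ := fun k => ((k : ℝ) + 1)⁻¹ with hs
  have hs0 : ∀ k, 0 < s k := fun k => by positivity
  have hs1 : ∀ k, s k ≤ 1 := fun k => inv_le_one_of_one_le₀ (by simp)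
  set φk : ℕ → (Fin m → ℝ) → ℝ := fun k x => b (s k • x) * φ x with hφk
  have hsm : ∀ k, ContDiff ℝ ((⊤ : ℕ∞) : WithTop ℕ∞) (fun x : Fin m → ℝ => b (s k • x)) :=
    fun k => hb.comp (contDiff_const_smul (s k))
  have hc : ∀ k, ContDiff ℝ ((⊤ : ℕ∞) : WithTop ℕ∞) (φk k) := fun k => (hsm k).mul hφ
  have hder : ∀ k x, HasFDerivAt (φk k)
      (b (s k • x) • fderiv ℝ φ x + φ x • s k • fderiv ℝ b (s k • x)) x := fun k x => by
    have h1 : HasFDerivAt (fun x : Fin m → ℝ => b (s k • x)) (s k • fderiv ℝ b (s k • x)) x := by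
      have := ((hb.differentiable (by simp) (s k • x)).hasFDerivAt).comp x
        ((hasFDerivAt_id x).const_smul (s k))
      convert! this using 1
      ext y
      simp
    exact h1.mul (hφ.differentiable (by simp) x).hasFDerivAt
  refine ⟨φk, M, hM0, hc, fun k q => ?_, fun k x => ?_, fun k x => ?_, fun x => ?_⟩
  · have hcs : HasCompactSupport (φk k) :=
      (b.hasCompactSupport.comp_smul (hs0 k).ne').mul_right
    exact (hcs.iteratedFDeriv (𝕜 := ℝ) q).exists_bound_of_continuous
      ((hc k).continuous_iteratedFDeriv (by exact_mod_cast le_top))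
  · rw [hφk, abs_mul, abs_of_nonneg b.nonneg]
    exact mul_le_of_le_one_left (abs_nonneg _) b.le_one
  · rw [(hder k x).fderiv]
    refine (norm_add_le _ _).trans (add_le_add ?_ ?_)
    · rw [norm_smul, Real.norm_eq_abs, abs_of_nonneg b.nonneg]
      exact mul_le_of_le_one_left (norm_nonneg _) b.le_one
    · rw [norm_smul, norm_smul, Real.norm_eq_abs, Real.norm_eq_abs, abs_of_pos (hs0 k), mul_comm]
      refine mul_le_mul_of_nonneg_right ?_ (abs_nonneg _)
      exact (mul_le_of_le_one_left (norm_nonneg _) (hs1 k)).trans (hM _)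
  · have hlim : Tendsto (fun k => s k • x) atTop (𝓝 0) := by
      have : Tendsto s atTop (𝓝 0) := by
        simpa [hs] using tendsto_one_div_add_atTop_nhds_zero_nat (𝕜 := ℝ)
      simpa using this.smul_const x
    filter_upwards [hlim.eventually b.eventuallyEq_one.eventually_nhds] with k hk
    replace hk : b =ᶠ[𝓝 (s k • x)] 1 := hk
    have h1 : b (s k • x) = 1 := hk.self_of_nhds
    have h2 : fderiv ℝ b (s k • x) = 0 := by
      rw [hk.fderiv_eq]
      exact fderiv_const_apply _
    refine ⟨by rw [hφk]; simp [h1], ?_⟩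
    rw [(hder k x).fderiv, h1, h2]
    simp

section Closure

set_option linter.unusedSectionVars false

variable {Ω H : Type*} [MeasurableSpace Ω] [NormedAddCommGroup H] [InnerProductSpace ℝ H]
  {W : H → Ω → ℝ} {P : Measure Ω} [IsProbabilityMeasure P]

theorem IsIsonormal.aestronglyMeasurable_cylindrical (hW : IsIsonormal W P) {F : Ω → ℝ}
    {DF : Ω → H} (h : IsCylindricalDeriv W F DF) :
    AEStronglyMeasurable F P ∧ AEStronglyMeasurable DF P := by
  obtain ⟨m, k, φ, hφ, -, hF, hDF⟩ := h
  have hm := (hW.aemeasurable_pi k).aestronglyMeasurable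
  constructor
  · rw [funext hF]
    exact hφ.continuous.comp_aestronglyMeasurable hm
  · rw [funext hDF]
    refine Finset.aestronglyMeasurable_fun_sum _ fun i _ => ?_
    exact (((hφ.continuous_fderiv (by simp)).clm_apply
      continuous_const).comp_aestronglyMeasurable hm).smul aestronglyMeasurable_const

theorem isMalliavinDeriv_of_forall_pos {F : Ω → ℝ} {DF : Ω → H}
    (hF : AEStronglyMeasurable F P) (hDF : AEStronglyMeasurable DF P)
    (h : ∀ ε : ℝ≥0∞, 0 < ε → ∃ (G : Ω → ℝ) (DG : Ω → H), IsCylindricalDeriv W G DG ∧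
      eLpNorm (fun ω => F ω - G ω) 2 P ≤ ε ∧ eLpNorm (fun ω => DF ω - DG ω) 2 P ≤ ε) :
    IsMalliavinDeriv W P F DF := by
  have hpos : ∀ k : ℕ, (0 : ℝ≥0∞) < ((k : ℝ≥0∞) + 1)⁻¹ := fun k =>
    ENNReal.inv_pos.2 (by finiteness)
  choose G DG h1 h2 h3 using fun k : ℕ => h _ (hpos k)
  have hlim : Tendsto (fun k : ℕ => ((k : ℝ≥0∞) + 1)⁻¹) atTop (𝓝 0) := by
    have := (tendsto_add_atTop_iff_nat 1).2 ENNReal.tendsto_inv_nat_nhds_zero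
    simpa using this
  exact ⟨hF, hDF, G, DG, h1,
    tendsto_of_tendsto_of_tendsto_of_le_of_le tendsto_const_nhds hlim (fun _ => zero_le) h2,
    tendsto_of_tendsto_of_tendsto_of_le_of_le tendsto_const_nhds hlim (fun _ => zero_le) h3⟩

theorem IsMalliavinDeriv.exists_cylindrical {F : Ω → ℝ} {DF : Ω → H}
    (h : IsMalliavinDeriv W P F DF) {ε : ℝ≥0∞} (hε : 0 < ε) :
    ∃ (G : Ω → ℝ) (DG : Ω → H), IsCylindricalDeriv W G DG ∧
      eLpNorm (fun ω => F ω - G ω) 2 P ≤ ε ∧ eLpNorm (fun ω => DF ω - DG ω) 2 P ≤ ε := by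
  obtain ⟨-, -, G, DG, hG, hF, hD⟩ := h
  obtain ⟨k, h1, h2⟩ := ((hF.eventually (gt_mem_nhds hε)).and
    (hD.eventually (gt_mem_nhds hε))).exists
  exact ⟨G k, DG k, hG k, h1.le, h2.le⟩

theorem eLpNorm_sub_le_add {E : Type*} [NormedAddCommGroup E] {f g h : Ω → E}
    (hf : AEStronglyMeasurable f P) (hg : AEStronglyMeasurable g P)
    (hh : AEStronglyMeasurable h P) {p : ℝ≥0∞} (hp : 1 ≤ p) :
    eLpNorm (fun ω => f ω - h ω) p P ≤
      eLpNorm (fun ω => f ω - g ω) p P + eLpNorm (fun ω => g ω - h ω) p P := by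
  have : (fun ω => f ω - h ω) = (fun ω => f ω - g ω) + fun ω => g ω - h ω := by
    ext ω; simp
  rw [this]
  exact eLpNorm_add_le (hf.sub hg) (hg.sub hh) hp

/-- The Malliavin derivative is a closed operator. -/
theorem IsIsonormal.isMalliavinDeriv_of_approx (hW : IsIsonormal W P) {F : Ω → ℝ} {DF : Ω → H}
    (hF : AEStronglyMeasurable F P) (hDF : AEStronglyMeasurable DF P)
    (h : ∀ ε : ℝ≥0∞, 0 < ε → ∃ (G : Ω → ℝ) (DG : Ω → H), IsMalliavinDeriv W P G DG ∧
      eLpNorm (fun ω => F ω - G ω) 2 P ≤ ε ∧ eLpNorm (fun ω => DF ω - DG ω) 2 P ≤ ε) :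
    IsMalliavinDeriv W P F DF := by
  refine isMalliavinDeriv_of_forall_pos hF hDF fun ε hε => ?_
  have hε2 : 0 < ε / 2 := ENNReal.half_pos hε.ne'
  obtain ⟨G, DG, hG, h1, h2⟩ := h (ε / 2) hε2
  obtain ⟨G', DG', hG', h3, h4⟩ := hG.exists_cylindrical hε2
  obtain ⟨m1, m2⟩ := hW.aestronglyMeasurable_cylindrical hG'
  refine ⟨G', DG', hG', ?_, ?_⟩
  · exact (eLpNorm_sub_le_add hF hG.1 m1 one_le_two).trans
      ((add_le_add h1 h3).trans_eq (ENNReal.add_halves ε))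
  · exact (eLpNorm_sub_le_add hDF hG.2.1 m2 one_le_two).trans
      ((add_le_add h2 h4).trans_eq (ENNReal.add_halves ε))

theorem fderiv_apply_sum_norm_le {m : ℕ} (L : (Fin m → ℝ) →L[ℝ] ℝ) (h : Fin m → H) :
    ‖∑ i, L (Pi.single i 1) • h i‖ ≤ ‖L‖ * ∑ i, ‖h i‖ := by
  rw [Finset.mul_sum]
  refine norm_sum_le_of_le _ fun i _ => ?_
  rw [norm_smul]
  refine mul_le_mul_of_nonneg_right ((L.le_opNorm _).trans ?_) (norm_nonneg _)
  refine mul_le_of_le_one_right (norm_nonneg _) ?_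
  rw [Pi.norm_single]
  simp

/-- Smooth functions of Gaussian vectors are Malliavin differentiable when they are square
integrable with their gradients. -/
theorem IsIsonormal.isMalliavinDeriv_smooth (hW : IsIsonormal W P) {m : ℕ} (h : Fin m → H)
    {φ : (Fin m → ℝ) → ℝ} (hφ : ContDiff ℝ ((⊤ : ℕ∞) : WithTop ℕ∞) φ)
    (h1 : MemLp (fun ω => φ fun i => W (h i) ω) 2 P)
    (h2 : MemLp (fun ω => ‖fderiv ℝ φ fun i => W (h i) ω‖) 2 P) :
    IsMalliavinDeriv W P (fun ω => φ fun i => W (h i) ω)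
      (fun ω => ∑ i, fderiv ℝ φ (fun i => W (h i) ω) (Pi.single i 1) • h i) := by
  obtain ⟨φk, M, hM, hc, hbd, hle, hle', hev⟩ := exists_cutoff hφ
  have hm := (hW.aemeasurable_pi h).aestronglyMeasurable
  have hcyl : ∀ k, IsCylindricalDeriv W (fun ω => φk k fun i => W (h i) ω)
      (fun ω => ∑ i, fderiv ℝ (φk k) (fun i => W (h i) ω) (Pi.single i 1) • h i) := fun k =>
    ⟨m, h, φk k, hc k, hbd k, fun _ => rfl, fun _ => rfl⟩
  have hDm : AEStronglyMeasurable
      (fun ω => ∑ i, fderiv ℝ φ (fun i => W (h i) ω) (Pi.single i 1) • h i) P := by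
    refine Finset.aestronglyMeasurable_fun_sum _ fun i _ => ?_
    exact (((hφ.continuous_fderiv (by simp)).clm_apply
      continuous_const).comp_aestronglyMeasurable hm).smul aestronglyMeasurable_const
  refine ⟨h1.1, hDm, _, _, hcyl, ?_, ?_⟩
  · refine tendsto_eLpNorm_zero_of_dominated
      (fun k => h1.1.sub (hW.aestronglyMeasurable_cylindrical (hcyl k)).1)
      (h1.norm.const_mul 2) (fun k ω => ?_) fun ω => (hev _).mono fun k hk => by
        rw [hk.1, sub_self]
    refine (norm_sub_le _ _).trans ?_
    have := hle k fun i => W (h i) ω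
    simp only [Real.norm_eq_abs] at this ⊢
    linarith
  · refine tendsto_eLpNorm_zero_of_dominated
      (g := fun ω => (∑ i, ‖h i‖) * (2 * ‖fderiv ℝ φ fun i => W (h i) ω‖ +
        M * ‖φ fun i => W (h i) ω‖))
      (fun k => hDm.sub (hW.aestronglyMeasurable_cylindrical (hcyl k)).2)
      (((h2.const_mul 2).add (h1.norm.const_mul M)).const_mul _) (fun k ω => ?_)
      fun ω => (hev _).mono fun k hk => by rw [hk.2, sub_self]
    simp only
    rw [← Finset.sum_sub_distrib]
    simp only [← sub_smul, ← sub_apply]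
    refine (fderiv_apply_sum_norm_le _ h).trans ?_
    rw [mul_comm]
    refine mul_le_mul_of_nonneg_left ?_ (Finset.sum_nonneg fun i _ => norm_nonneg _)
    refine (norm_sub_le _ _).trans ?_
    have := hle' k fun i => W (h i) ω
    simp only [Real.norm_eq_abs] at this ⊢
    linarith

end Closure

/-! ### The Malliavin derivative of a finite chaos expansion -/

theorem hasDerivAt_aeval_hermite (k : ℕ) (x : ℝ) :
    HasDerivAt (fun x : ℝ => Polynomial.aeval x (Polynomial.hermite k))
      (k * Polynomial.aeval x (Polynomial.hermite (k - 1))) x := by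
  have := (Polynomial.hermite k).hasDerivAt_aeval x
  cases k with
  | zero => simpa using this
  | succ k =>
    rw [derivative_hermite_succ] at this
    simpa using this

/-- Only factor `l` is differentiated, by `H_a' = a H_{a-1}`. When `a l = 0` the leading factor
makes the truncated subtraction irrelevant. -/
theorem fderiv_prod_hermite_apply_single {m : ℕ} (a : Fin m → ℕ) (x : Fin m → ℝ) (l : Fin m) :
    fderiv ℝ (fun x : Fin m → ℝ => ∏ l, Polynomial.aeval (x l) (Polynomial.hermite (a l))) x
      (Pi.single l 1) = a l * ∏ l', Polynomial.aeval (x l')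
        (Polynomial.hermite (a l' - if l' = l then 1 else 0)) := by
  have h := HasFDerivAt.finsetProd (u := Finset.univ) (x := x) fun l' _ =>
    (hasDerivAt_aeval_hermite (a l') (x l')).comp_hasFDerivAt x
      (hasFDerivAt_apply (𝕜 := ℝ) (F' := fun _ : Fin m => ℝ) l' x)
  simp only [Function.comp_def] at h
  rw [h.fderiv, sum_apply, Finset.sum_eq_single l]
  · rw [← Finset.mul_prod_erase Finset.univ _ (Finset.mem_univ l)]
    have : ∀ l' ∈ Finset.univ.erase l, Polynomial.aeval (x l')
        (Polynomial.hermite (a l' - if l' = l then 1 else 0)) =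
        Polynomial.aeval (x l') (Polynomial.hermite (a l')) := fun l' hl' => by
      simp [Finset.ne_of_mem_erase hl']
    rw [Finset.prod_congr rfl this]
    simp
    ring
  · intro l' _ hl'
    simp [Pi.single_eq_of_ne hl']
  · simp

theorem norm_le_sum_apply_single {m : ℕ} (L : (Fin m → ℝ) →L[ℝ] ℝ) :
    ‖L‖ ≤ ∑ l, |L (Pi.single l 1)| := by
  refine L.opNorm_le_bound (Finset.sum_nonneg fun _ _ => abs_nonneg _) fun v => ?_
  have hv : L v = ∑ l, v l * L (Pi.single l 1) := by
    conv_lhs => rw [← Finset.univ_sum_single v]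
    rw [map_sum]
    refine Finset.sum_congr rfl fun l _ => ?_
    rw [← smul_eq_mul, ← map_smul, ← Pi.single_smul, smul_eq_mul, mul_one]
  rw [hv, Finset.sum_mul]
  refine norm_sum_le_of_le _ fun l _ => ?_
  rw [norm_mul, mul_comm]
  exact mul_le_mul_of_nonneg_left (norm_le_pi_norm v l) (abs_nonneg _)

section Derivative

set_option linter.unusedSectionVars false

variable {ι : Type*} {Q : Type*} [Fintype Q]

theorem sum_comp_eq_sum_mult_smul {M : Type*} [AddCommMonoid M] {T : Finset ι} {k : Q → ι}
    (hk : ∀ q, k q ∈ T) (x : ι → M) : ∑ q, x (k q) = ∑ j ∈ T, mult k j • x j :=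
  prod_comp_eq_prod_pow_mult (M := Multiplicative M) hk x

theorem mult_subtype_ne [DecidableEq Q] [DecidableEq ι] (k : Q → ι) (q : Q) (j : ι) :
    mult (fun q' : {q' // q' ≠ q} => k q') j = mult k j - if j = k q then 1 else 0 := by
  classical
  have h : (Finset.univ.filter fun q' : {q' // q' ≠ q} => k q' = j).map
      (Function.Embedding.subtype _) = (Finset.univ.filter fun q' => k q' = j).erase q := by
    ext q'
    simp [and_comm]
  have := congrArg Finset.card h
  rw [Finset.card_map, Finset.card_erase_eq_ite] at this
  have h2 : mult (fun q' : {q' // q' ≠ q} => k q') j =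
      if q ∈ Finset.univ.filter fun q' => k q' = j then mult k j - 1 else mult k j := by
    rw [mult, mult]
    convert! this
  rw [h2]
  by_cases hj : j = k q
  · simp [hj]
  · simp [hj, Ne.symm hj]

variable {Ω H : Type*} [MeasurableSpace Ω] [NormedAddCommGroup H] [InnerProductSpace ℝ H]

/-- The Malliavin derivative of the multiple integral of a basis tensor. -/
noncomputable def basisDeriv (W : H → Ω → ℝ) (e : HilbertBasis ι ℝ H) {n : ℕ} (i : Fin n → ι)
    (ω : Ω) : H :=
  ∑ q : Fin n, hermiteProd (fun j => W (e j)) (fun q' : {q' // q' ≠ q} => i q') ω • e (i q)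

variable {W : H → Ω → ℝ} {P : Measure Ω} [IsProbabilityMeasure P]

/-- Slots carrying the same index contribute equal terms. Grouping them turns the sum over slots
into a gradient in the distinct variables, with the multiplicities coming from `H_a' = a H_{a-1}`.
-/
theorem basisDeriv_eq (e : HilbertBasis ι ℝ H) {n : ℕ} {i : Fin n → ι} {m : ℕ}
    {t : Fin m → ι} (ht : Function.Injective t) (hi : ∀ q, ∃ l, t l = i q) (ω : Ω) :
    basisDeriv W e i ω = ∑ l, (mult i (t l) * ∏ l', Polynomial.aeval (W (e (t l')) ω)
      (Polynomial.hermite (mult i (t l') - if l' = l then 1 else 0))) • e (t l) := by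
  classical
  set T : Finset ι := Finset.univ.map ⟨t, ht⟩ with hT
  have hiT : ∀ q, i q ∈ T := fun q => by
    obtain ⟨l, hl⟩ := hi q
    exact Finset.mem_map.2 ⟨l, Finset.mem_univ _, hl⟩
  have h1 : ∀ q, hermiteProd (fun j => W (e j)) (fun q' : {q' // q' ≠ q} => i q') ω =
      ∏ j ∈ T, Polynomial.aeval (W (e j) ω)
        (Polynomial.hermite (mult i j - if j = i q then 1 else 0)) := fun q => by
    rw [hermiteProd_eq (k := fun q' : {q' // q' ≠ q} => i q') fun q' => hiT q']
    refine Finset.prod_congr rfl fun j _ => ?_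
    rw [mult_subtype_ne]
  simp only [basisDeriv, h1]
  rw [sum_comp_eq_sum_mult_smul hiT fun j' => (∏ j ∈ T, Polynomial.aeval (W (e j) ω)
        (Polynomial.hermite (mult i j - if j = j' then 1 else 0))) • e j']
  rw [hT, Finset.sum_map]
  refine Finset.sum_congr rfl fun l _ => ?_
  rw [Finset.prod_map, mul_smul, Nat.cast_smul_eq_nsmul]
  simp [ht.eq_iff]

/-- All terms are written as polynomials in one common finite list `t` of coordinates, so the sum is
a smooth function of a Gaussian vector and has all moments together with its gradient. -/
theorem isMalliavinDeriv_finset_sum (hW : IsIsonormal W P) (e : HilbertBasis ι ℝ H) {n : ℕ}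
    (S : Finset (Fin n → ι)) (f : (Fin n → ι) → ℝ) :
    IsMalliavinDeriv W P (fun ω => ∑ i ∈ S, f i * basisIntegral W e i ω)
      (fun ω => ∑ i ∈ S, f i • basisDeriv W e i ω) := by
  classical
  set T : Finset ι := S.biUnion fun i => Finset.univ.image i with hT
  have hmem : ∀ i ∈ S, ∀ q, i q ∈ T := fun i hi q =>
    Finset.mem_biUnion.2 ⟨i, hi, Finset.mem_image_of_mem _ (Finset.mem_univ q)⟩
  set t : Fin T.card → ι := fun l => (T.equivFin.symm l : ι) with ht
  have htinj : Function.Injective t := Subtype.val_injective.comp T.equivFin.symm.injective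
  have htsurj : ∀ i ∈ S, ∀ q, ∃ l, t l = i q := fun i hi q =>
    ⟨T.equivFin ⟨i q, hmem i hi q⟩, by simp [ht]⟩
  set ψ : (Fin n → ι) → (Fin T.card → ℝ) → ℝ := fun i x =>
    ∏ l, Polynomial.aeval (x l) (Polynomial.hermite (mult i (t l))) with hψ
  have hψc : ∀ i, ContDiff ℝ ((⊤ : ℕ∞) : WithTop ℕ∞) (ψ i) := fun i =>
    contDiff_prod fun l _ => (Polynomial.contDiff_aeval _ _).comp (contDiff_apply ℝ ℝ l)
  have hc : ContDiff ℝ ((⊤ : ℕ∞) : WithTop ℕ∞) fun x => ∑ i ∈ S, f i * ψ i x :=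
    ContDiff.sum fun i _ => contDiff_const.mul (hψc i)
  have hd : ∀ x l, fderiv ℝ (fun x => ∑ i ∈ S, f i * ψ i x) x (Pi.single l 1) =
      ∑ i ∈ S, f i * (mult i (t l) * ∏ l', Polynomial.aeval (x l')
        (Polynomial.hermite (mult i (t l') - if l' = l then 1 else 0))) := fun x l => by
    have : HasFDerivAt (fun x => ∑ i ∈ S, f i * ψ i x) (∑ i ∈ S, f i • fderiv ℝ (ψ i) x) x :=
      HasFDerivAt.fun_sum fun i _ =>
        (((hψc i).differentiable (by simp)) x).hasFDerivAt.const_mul (f i)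
    rw [this.fderiv, sum_apply]
    refine Finset.sum_congr rfl fun i _ => ?_
    rw [smul_apply, hψ, fderiv_prod_hermite_apply_single, smul_eq_mul]
  have hI : ∀ ω, ∑ i ∈ S, f i * basisIntegral W e i ω =
      ∑ i ∈ S, f i * ψ i (fun l => W (e (t l)) ω) := fun ω => by
    refine Finset.sum_congr rfl fun i hi => ?_
    congr 1
    change hermiteProd (fun j => W (e j)) i ω = _
    rw [hermiteProd_eq (hmem i hi), ← Finset.prod_coe_sort]
    exact (Equiv.prod_comp T.equivFin.symm fun j : T => Polynomial.aeval (W (e j) ω)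
      (Polynomial.hermite (mult i (j : ι)))).symm
  have hD : ∀ ω, ∑ i ∈ S, f i • basisDeriv W e i ω =
      ∑ l, fderiv ℝ (fun x => ∑ i ∈ S, f i * ψ i x) (fun l => W (e (t l)) ω) (Pi.single l 1) •
        e (t l) := fun ω => by
    simp only [hd, Finset.sum_smul]
    rw [Finset.sum_comm]
    refine Finset.sum_congr rfl fun i hi => ?_
    rw [basisDeriv_eq e htinj (htsurj i hi), Finset.smul_sum]
    simp only [smul_smul]
  rw [funext hI, funext hD]
  have hG : ∀ l, AllMoments (fun ω => W (e (t l)) ω) P := fun l => hW.allMoments _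
  refine hW.isMalliavinDeriv_smooth (fun l => e (t l)) hc ?_ ?_
  · exact (AllMoments.sum S fun i _ => (AllMoments.prod Finset.univ fun l _ =>
      (hG l).aeval _).const_mul _).memLp_two
  · refine MemLp.mono (g := fun ω => ∑ l, ‖fderiv ℝ (fun x => ∑ i ∈ S, f i * ψ i x)
      (fun l => W (e (t l)) ω) (Pi.single l 1)‖) ?_
      (((hc.continuous_fderiv (by simp)).comp_aestronglyMeasurable
        (hW.aemeasurable_pi fun l => (e (t l) : H)).aestronglyMeasurable).norm)
      (ae_of_all _ fun ω => ?_)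
    · refine memLp_finsetSum _ fun l _ => MemLp.norm ?_
      simp only [hd]
      exact (AllMoments.sum S fun i _ => ((AllMoments.prod Finset.univ fun l _ =>
        (hG l).aeval _).const_mul _).const_mul _).memLp_two
    · rw [norm_norm]
      exact (norm_le_sum_apply_single _).trans (le_abs_self _)

end Derivative

/-! ### Derivatives of chaos elements -/

section Moments

set_option linter.unusedSectionVars false

variable {Ω ι : Type*} [MeasurableSpace Ω] {P : Measure Ω} [IsProbabilityMeasure P]

/-- The moment bound in norm form, with `K` independent of the variables, the index set and the
coefficients. The injective relabelling `r` allows sums indexed by longer multi-indices from which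
one slot has been removed. -/
theorem eLpNorm_hermite_sum_le (Q κ : Type*) [Fintype Q] {p : ℕ} (hp : p ≠ 0) :
    ∃ K : ℝ, 0 ≤ K ∧ ∀ (G : ι → Ω → ℝ), iIndepFun G P →
      (∀ j, HasLaw (G j) (gaussianReal 0 1) P) →
      ∀ (S : Finset κ) (r : κ → Q → ι), Set.InjOn r S → ∀ c : κ → ℝ,
      eLpNorm (fun ω => ∑ i ∈ S, c i * hermiteProd G (r i) ω) (2 * p : ℕ) P ≤
        ENNReal.ofReal (K * √(∑ i ∈ S, c i ^ 2)) := by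
  classical
  set w := wickConst (Fin p × Q) with hw
  have hw0 : 0 ≤ w := wickConst_nonneg _
  -- `1 + w` replaces a root of order `p`: being at least `1`, it satisfies `w ≤ (1 + w) ^ p`.
  refine ⟨√(1 + w), Real.sqrt_nonneg _, fun G hind hlaw S r hr c => ?_⟩
  rcases S.eq_empty_or_nonempty with rfl | ⟨i₀, hi₀⟩
  · simp
  have : Nonempty κ := ⟨i₀⟩
  set c' : (Q → ι) → ℝ := fun k => c (Function.invFunOn r S k) with hc'
  have hcr : ∀ i ∈ S, c' (r i) = c i := fun i hi => by
    rw [hc']; exact congrArg c (hr.leftInvOn_invFunOn hi)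
  have h1 : ∀ ω, ∑ i ∈ S, c i * hermiteProd G (r i) ω =
      ∑ k ∈ S.image r, c' k * hermiteProd G k ω := fun ω => by
    rw [Finset.sum_image hr]
    exact Finset.sum_congr rfl fun i hi => by rw [hcr i hi]
  have h2 : ∑ k ∈ S.image r, c' k ^ 2 = ∑ i ∈ S, c i ^ 2 := by
    rw [Finset.sum_image hr]
    exact Finset.sum_congr rfl fun i hi => by rw [hcr i hi]
  have h0 : 0 ≤ ∑ i ∈ S, c i ^ 2 := Finset.sum_nonneg fun _ _ => sq_nonneg _
  rw [funext h1, ← ENNReal.pow_le_pow_left_iff (n := 2 * p) (by omega)]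
  have h3 := eLpNorm_nnreal_pow_eq_lintegral (μ := P) (p := ((2 * p : ℕ) : ℝ≥0))
      (f := fun ω => ∑ k ∈ S.image r, c' k * hermiteProd G k ω) (by positivity)
  simp only [NNReal.coe_natCast, ENNReal.rpow_natCast, ENNReal.coe_natCast] at h3
  rw [h3, ← ENNReal.ofReal_pow (by positivity)]
  refine (lintegral_enorm_pow_hermite_sum_le hind hlaw _ c' hp).trans
    (ENNReal.ofReal_le_ofReal ?_)
  rw [h2, mul_pow, pow_mul, pow_mul, Real.sq_sqrt (by positivity), Real.sq_sqrt h0]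
  refine mul_le_mul_of_nonneg_right ?_ (by positivity)
  calc w ≤ 1 + w := by linarith
    _ ≤ (1 + w) ^ p := le_self_pow₀ (by linarith) hp

variable {H : Type*} [NormedAddCommGroup H] [InnerProductSpace ℝ H]

theorem eLpNorm_sq_eq {E : Type*} [NormedAddCommGroup E] (F : Ω → E) (p : ℕ) :
    eLpNorm (fun ω => ‖F ω‖ ^ 2) p P = eLpNorm F (2 * p : ℕ) P ^ 2 := by
  have := eLpNorm_norm_rpow (p := (p : ℝ≥0∞)) (μ := P) F (q := ((2 : ℕ) : ℝ)) (by norm_num)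
  simp only [Real.rpow_natCast, ENNReal.rpow_natCast] at this
  rw [this]
  congr 2
  push_cast
  rw [mul_comm]
  simp

/-- The squared norm of the sum is the sum of the squares of the coefficients, and Minkowski's
inequality in `L^p` is applied to these squares. -/
theorem eLpNorm_sum_orthonormal_sq_le {e : ι → H} (he : Orthonormal ℝ e) (T : Finset ι)
    {A : ι → Ω → ℝ} (hA : ∀ j ∈ T, AEStronglyMeasurable (A j) P) {p : ℕ} (hp : p ≠ 0) :
    eLpNorm (fun ω => ∑ j ∈ T, A j ω • e j) (2 * p : ℕ) P ^ 2 ≤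
      ∑ j ∈ T, eLpNorm (A j) (2 * p : ℕ) P ^ 2 := by
  rw [← eLpNorm_sq_eq]
  have h1 : (fun ω => ‖∑ j ∈ T, A j ω • e j‖ ^ 2) = ∑ j ∈ T, fun ω => ‖A j ω‖ ^ 2 := by
    ext ω
    rw [← real_inner_self_eq_norm_sq, he.inner_sum, Finset.sum_apply]
    refine Finset.sum_congr rfl fun j _ => ?_
    simp [sq]
  rw [h1]
  refine (eLpNorm_sum_le (fun j hj => (hA j hj).norm.pow 2)
    (by exact_mod_cast Nat.one_le_iff_ne_zero.2 hp)).trans_eq ?_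
  exact Finset.sum_congr rfl fun j _ => eLpNorm_sq_eq _ _

end Moments

section ChaosDeriv

set_option linter.unusedSectionVars false

variable {Ω ι H : Type*} [MeasurableSpace Ω] [NormedAddCommGroup H] [InnerProductSpace ℝ H]
  {W : H → Ω → ℝ} {P : Measure Ω} [IsProbabilityMeasure P] {n : ℕ}

/-- Grouping by the index in slot `q` gives coefficients along orthonormal vectors, each a real
chaos sum in the remaining slots. The squared bounds add up to the full `ℓ²` norm, so infinite
dimension costs nothing. -/
theorem eLpNorm_sum_hermite_smul_le (hW : IsIsonormal W P) (e : HilbertBasis ι ℝ H) (q : Fin n)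
    {p : ℕ} (hp : p ≠ 0) :
    ∃ K : ℝ, 0 ≤ K ∧ ∀ (S : Finset (Fin n → ι)) (f : (Fin n → ι) → ℝ),
      eLpNorm (fun ω => ∑ i ∈ S, f i •
        hermiteProd (fun j => W (e j)) (fun q' : {q' // q' ≠ q} => i q') ω • e (i q))
        (2 * p : ℕ) P ≤ ENNReal.ofReal (K * √(∑ i ∈ S, f i ^ 2)) := by
  classical
  obtain ⟨K, hK, h⟩ := eLpNorm_hermite_sum_le (Ω := Ω) (ι := ι) (P := P) {q' // q' ≠ q}
    (Fin n → ι) hp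
  refine ⟨K, hK, fun S f => ?_⟩
  set G : ι → Ω → ℝ := fun j => W (e j) with hG
  have hlaw := hW.hasLaw_basis e
  have hind := hW.iIndepFun_basis e
  set A : ι → Ω → ℝ := fun j ω => ∑ i ∈ S with i q = j, f i *
    hermiteProd G (fun q' : {q' // q' ≠ q} => i q') ω with hA
  have hAm : ∀ j, AEStronglyMeasurable (A j) P := fun j =>
    Finset.aestronglyMeasurable_fun_sum _ fun i _ =>
      (aestronglyMeasurable_hermiteProd hlaw _).const_mul _
  have h1 : ∀ ω, ∑ i ∈ S, f i • hermiteProd G (fun q' : {q' // q' ≠ q} => i q') ω • e (i q) =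
      ∑ j ∈ S.image fun i => i q, A j ω • e j := fun ω => by
    rw [← Finset.sum_fiberwise_of_maps_to (t := S.image fun i => i q) (g := fun i => i q)
      fun i hi => Finset.mem_image_of_mem _ hi]
    refine Finset.sum_congr rfl fun j _ => ?_
    rw [hA, Finset.sum_smul]
    refine Finset.sum_congr rfl fun i hi => ?_
    rw [(Finset.mem_filter.1 hi).2, smul_smul]
  have hs0 : ∀ T : Finset (Fin n → ι), 0 ≤ ∑ i ∈ T, f i ^ 2 := fun T =>
    Finset.sum_nonneg fun _ _ => sq_nonneg _
  rw [funext h1, ← ENNReal.pow_le_pow_left_iff two_ne_zero, ← ENNReal.ofReal_pow (by positivity),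
    mul_pow, Real.sq_sqrt (hs0 S)]
  refine (eLpNorm_sum_orthonormal_sq_le e.orthonormal _ (fun j _ => hAm j) hp).trans ?_
  have h2 : ∀ j, eLpNorm (A j) (2 * p : ℕ) P ^ 2 ≤
      ENNReal.ofReal (K ^ 2 * ∑ i ∈ S with i q = j, f i ^ 2) := fun j => by
    have := pow_le_pow_left' (h G hind hlaw (S.filter fun i => i q = j)
      (fun i (q' : {q' // q' ≠ q}) => i q') (fun i hi i' hi' hii => ?_) f) 2
    · rwa [← ENNReal.ofReal_pow (by positivity), mul_pow, Real.sq_sqrt (hs0 _)] at this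
    -- Within a fibre the index in slot `q` is fixed, so the remaining slots determine `i`; this is
    -- the required injectivity.
    · ext q'
      by_cases hq : q' = q
      · rw [hq, (Finset.mem_filter.1 hi).2, (Finset.mem_filter.1 hi').2]
      · exact congrFun hii ⟨q', hq⟩
  refine (Finset.sum_le_sum fun j _ => h2 j).trans_eq ?_
  rw [← ENNReal.ofReal_sum_of_nonneg fun j _ => mul_nonneg (sq_nonneg K) (hs0 _), ← Finset.mul_sum]
  congr 2
  exact Finset.sum_fiberwise_of_maps_to (t := S.image fun i => i q) (g := fun i => i q)
    (fun i hi => Finset.mem_image_of_mem _ hi) fun i => f i ^ 2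

theorem aestronglyMeasurable_basisDeriv_term (hW : IsIsonormal W P) (e : HilbertBasis ι ℝ H)
    (i : Fin n → ι) (q : Fin n) : AEStronglyMeasurable (fun ω =>
      hermiteProd (fun j => W (e j)) (fun q' : {q' // q' ≠ q} => i q') ω • e (i q)) P :=
  (aestronglyMeasurable_hermiteProd (hW.hasLaw_basis e) _).smul_const _

theorem aestronglyMeasurable_basisDeriv_sum (hW : IsIsonormal W P) (e : HilbertBasis ι ℝ H)
    (S : Finset (Fin n → ι)) (f : (Fin n → ι) → ℝ) :
    AEStronglyMeasurable (fun ω => ∑ i ∈ S, f i • basisDeriv W e i ω) P :=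
  Finset.aestronglyMeasurable_fun_sum _ fun i _ => AEStronglyMeasurable.const_smul
    (Finset.aestronglyMeasurable_fun_sum _ fun q _ =>
      aestronglyMeasurable_basisDeriv_term hW e i q) _

theorem eLpNorm_sum_basisDeriv_le (hW : IsIsonormal W P) (e : HilbertBasis ι ℝ H) (n : ℕ)
    {p : ℕ} (hp : p ≠ 0) :
    ∃ K : ℝ, 0 ≤ K ∧ ∀ (S : Finset (Fin n → ι)) (f : (Fin n → ι) → ℝ),
      eLpNorm (fun ω => ∑ i ∈ S, f i • basisDeriv W e i ω) (2 * p : ℕ) P ≤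
        ENNReal.ofReal (K * √(∑ i ∈ S, f i ^ 2)) := by
  choose K hK h using fun q : Fin n => eLpNorm_sum_hermite_smul_le hW e q hp
  refine ⟨∑ q, K q, Finset.sum_nonneg fun q _ => hK q, fun S f => ?_⟩
  have h1 : (fun ω => ∑ i ∈ S, f i • basisDeriv W e i ω) = ∑ q : Fin n, fun ω => ∑ i ∈ S,
      f i • hermiteProd (fun j => W (e j)) (fun q' : {q' // q' ≠ q} => i q') ω • e (i q) := by
    ext ω
    simp only [basisDeriv, Finset.smul_sum, Finset.sum_apply]
    exact Finset.sum_comm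
  rw [h1, Finset.sum_mul, ENNReal.ofReal_sum_of_nonneg fun q _ =>
    mul_nonneg (hK q) (Real.sqrt_nonneg _)]
  refine (eLpNorm_sum_le (fun q _ => Finset.aestronglyMeasurable_fun_sum _ fun i _ =>
    (aestronglyMeasurable_basisDeriv_term hW e i q).const_smul _) ?_).trans
    (Finset.sum_le_sum fun q _ => h q S f)
  exact_mod_cast (by omega : 1 ≤ 2 * p)

/-- `V` is the `L²`-limit of the derivatives of the partial sums of the chaos expansion
with kernel `f`. -/
def IsChaosDeriv (W : H → Ω → ℝ) (P : Measure Ω) (e : HilbertBasis ι ℝ H)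
    (f : TensorPow ι n) (V : Ω → H) : Prop :=
  AEStronglyMeasurable V P ∧ Tendsto (fun S : Finset (Fin n → ι) =>
    eLpNorm (fun ω => V ω - ∑ i ∈ S, f i • basisDeriv W e i ω) 2 P) atTop (𝓝 0)

theorem hasSum_sq_tensor (f : TensorPow ι n) : HasSum (fun i => f i ^ 2) (‖f‖ ^ 2) := by
  have h := lp.hasSum_norm (p := 2) (by norm_num) f
  simpa using h

/-- The bound by the `ℓ²` norm of the coefficients turns square summability of the kernel into the
Cauchy criterion for the series of derivatives in `L²(Ω; H)`. -/
theorem exists_isChaosDeriv [CompleteSpace H] (hW : IsIsonormal W P) (e : HilbertBasis ι ℝ H)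
    (f : TensorPow ι n) : ∃ V, IsChaosDeriv W P e f V := by
  obtain ⟨K, hK, h⟩ := eLpNorm_sum_basisDeriv_le hW e n one_ne_zero
  have hmem : ∀ S : Finset (Fin n → ι), MemLp (fun ω => ∑ i ∈ S, f i • basisDeriv W e i ω) 2 P :=
    fun S => ⟨aestronglyMeasurable_basisDeriv_sum hW e S f, by
      simpa using (h S f).trans_lt ENNReal.ofReal_lt_top⟩
  have hx : ∀ i, MemLp (fun ω => f i • basisDeriv W e i ω) 2 P := fun i => by
    simpa using hmem {i}
  set x : (Fin n → ι) → Lp H 2 P := fun i => (hx i).toLp _ with hxdef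
  have hsum : ∀ S : Finset (Fin n → ι), ∑ i ∈ S, x i = (hmem S).toLp _ := fun S => by
    classical
    induction S using Finset.induction_on with
    | empty =>
      simp only [Finset.sum_empty]
      exact (MemLp.toLp_zero _).symm
    | insert a S ha ih =>
      rw [Finset.sum_insert ha, ih, hxdef, ← MemLp.toLp_add]
      refine MemLp.toLp_congr _ _ (ae_of_all _ fun ω => ?_)
      simp [Finset.sum_insert ha]
  have hnorm : ∀ S : Finset (Fin n → ι), ‖∑ i ∈ S, x i‖ ≤ K * √(∑ i ∈ S, f i ^ 2) := fun S => by
    rw [hsum, Lp.norm_toLp]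
    refine ENNReal.toReal_le_of_le_ofReal (by positivity) ?_
    simpa using h S f
  have hS : Summable x := by
    rw [summable_iff_vanishing_norm]
    intro ε hε
    -- `K` may be zero, hence `K + 1`.
    have hδ : 0 < (ε / (K + 1)) ^ 2 := by positivity
    obtain ⟨s, hs⟩ := summable_iff_vanishing_norm.1 (hasSum_sq_tensor f).summable _ hδ
    refine ⟨s, fun t ht => (hnorm t).trans_lt ?_⟩
    have h1 : √(∑ i ∈ t, f i ^ 2) < ε / (K + 1) := by
      rw [Real.sqrt_lt' (by positivity)]
      exact (le_abs_self _).trans_lt (hs t ht)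
    calc K * √(∑ i ∈ t, f i ^ 2) ≤ (K + 1) * √(∑ i ∈ t, f i ^ 2) := by
          gcongr; linarith
      _ < (K + 1) * (ε / (K + 1)) := by gcongr
      _ = ε := by field_simp
  obtain ⟨V, hV⟩ := hS
  refine ⟨V, Lp.aestronglyMeasurable V, ?_⟩
  have h1 := (Lp.tendsto_Lp_iff_tendsto_eLpNorm' _ _).1 hV
  refine h1.congr fun S => ?_
  rw [hsum]
  have h2 := (hmem S).coeFn_toLp
  rw [eLpNorm_sub_comm]
  refine eLpNorm_congr_ae ?_
  filter_upwards [h2] with ω hω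
  simp only [Pi.sub_apply, hω]

theorem IsChaosDeriv.sub (hW : IsIsonormal W P) {e : HilbertBasis ι ℝ H} {f f' : TensorPow ι n}
    {V V' : Ω → H} (h : IsChaosDeriv W P e f V) (h' : IsChaosDeriv W P e f' V') :
    IsChaosDeriv W P e (f - f') (fun ω => V ω - V' ω) := by
  refine ⟨h.1.sub h'.1, ?_⟩
  have hlim := h.2.add h'.2
  rw [add_zero] at hlim
  refine tendsto_of_tendsto_of_tendsto_of_le_of_le tendsto_const_nhds hlim
    (fun _ => zero_le) fun S => ?_
  have : (fun ω => V ω - V' ω - ∑ i ∈ S, (f - f') i • basisDeriv W e i ω) =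
      (fun ω => V ω - ∑ i ∈ S, f i • basisDeriv W e i ω) -
        fun ω => V' ω - ∑ i ∈ S, f' i • basisDeriv W e i ω := by
    ext ω
    simp only [lp.coeFn_sub, Pi.sub_apply, sub_smul, Finset.sum_sub_distrib]
    abel
  rw [this]
  exact eLpNorm_sub_le (h.1.sub (aestronglyMeasurable_basisDeriv_sum hW e S f))
    (h'.1.sub (aestronglyMeasurable_basisDeriv_sum hW e S f')) one_le_two

/-- The definition gives only `L²` convergence. An almost surely convergent subsequence and Fatou's
lemma carry the uniform bound of the partial sums to the limit in every `L^{2p}`. Together with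
linearity in the kernel this is the Kolmogorov estimate. -/
theorem eLpNorm_chaosDeriv_le (hW : IsIsonormal W P) (e : HilbertBasis ι ℝ H) (n : ℕ)
    {p : ℕ} (hp : p ≠ 0) :
    ∃ K : ℝ, 0 ≤ K ∧ ∀ (f : TensorPow ι n) (V : Ω → H), IsChaosDeriv W P e f V →
      eLpNorm V (2 * p : ℕ) P ≤ ENNReal.ofReal (K * ‖f‖) := by
  obtain ⟨K, hK, h⟩ := eLpNorm_sum_basisDeriv_le hW e n hp
  refine ⟨K, hK, fun f V hV => ?_⟩
  have hpos : ∀ k : ℕ, (0 : ℝ≥0∞) < ((k : ℝ≥0∞) + 1)⁻¹ := fun k =>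
    ENNReal.inv_pos.2 (by finiteness)
  choose S hS using fun k : ℕ => (hV.2.eventually (gt_mem_nhds (hpos k))).exists
  have hlim : Tendsto (fun k : ℕ => ((k : ℝ≥0∞) + 1)⁻¹) atTop (𝓝 0) := by
    have := (tendsto_add_atTop_iff_nat 1).2 ENNReal.tendsto_inv_nat_nhds_zero
    simpa using this
  set Y : ℕ → Ω → H := fun k ω => ∑ i ∈ S k, f i • basisDeriv W e i ω with hY
  have hYm : ∀ k, AEStronglyMeasurable (Y k) P := fun k =>
    aestronglyMeasurable_basisDeriv_sum hW e (S k) f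
  have hYlim : Tendsto (fun k => eLpNorm (Y k - V) 2 P) atTop (𝓝 0) :=
    tendsto_of_tendsto_of_tendsto_of_le_of_le tendsto_const_nhds hlim (fun _ => zero_le)
      fun k => by rw [eLpNorm_sub_comm]; exact (hS k).le
  obtain ⟨ns, -, hns⟩ := (tendstoInMeasure_of_tendsto_eLpNorm two_ne_zero hYm hV.1
    hYlim).exists_seq_tendsto_ae
  refine (Lp.eLpNorm_lim_le_liminf_eLpNorm (fun k => hYm (ns k)) V hns).trans ?_
  refine liminf_le_of_le (by isBoundedDefault) fun b hb => ?_
  obtain ⟨k, hk⟩ := hb.exists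
  refine hk.trans ((h (S (ns k)) f).trans (ENNReal.ofReal_le_ofReal ?_))
  refine mul_le_mul_of_nonneg_left ?_ hK
  rw [← Real.sqrt_sq (norm_nonneg f)]
  exact Real.sqrt_le_sqrt (sum_le_hasSum _ (fun _ _ => sq_nonneg _) (hasSum_sq_tensor f))

/-- The chaos derivative is the Malliavin derivative of the multiple integral. -/
theorem IsChaosDeriv.isMalliavinDeriv (hW : IsIsonormal W P) {e : HilbertBasis ι ℝ H}
    {f : TensorPow ι n} {X : Ω → ℝ} {V : Ω → H} (hV : IsChaosDeriv W P e f V)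
    (hX : IsMultipleIntegral W P e f X) : IsMalliavinDeriv W P X V := by
  refine hW.isMalliavinDeriv_of_approx hX.1 hV.1 fun ε hε => ?_
  obtain ⟨S, h1, h2⟩ := ((hX.2.eventually (gt_mem_nhds hε)).and
    (hV.2.eventually (gt_mem_nhds hε))).exists
  exact ⟨_, _, isMalliavinDeriv_finset_sum hW e S f, h1.le, h2.le⟩

end ChaosDeriv

/-! ### Chaos derivatives take values in the contraction space -/

section Contraction

set_option linter.unusedSectionVars false

variable {ι H : Type*} [NormedAddCommGroup H] [InnerProductSpace ℝ H] {n : ℕ}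

theorem sum_sq_inner_le (e : HilbertBasis ι ℝ H) (h : H) (J : Finset ι) :
    ∑ j ∈ J, inner ℝ (e j) h ^ 2 ≤ ‖h‖ ^ 2 := by
  simpa using e.orthonormal.sum_inner_products_le h (s := J)

theorem funSplitAt_symm_inj {q : Fin n} {j j' : ι} {k k' : {q' // q' ≠ q} → ι}
    (h : (Equiv.funSplitAt q ι).symm (j, k) = (Equiv.funSplitAt q ι).symm (j', k')) :
    j = j' ∧ k = k' := Prod.mk.inj ((Equiv.funSplitAt q ι).symm.injective h)

/-- The slice of `f` with the other slots fixed is a generator of the contraction space; the series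
is its inner product with `h`. -/
theorem hasSum_slice_inner [CompleteSpace H] (e : HilbertBasis ι ℝ H) (f : TensorPow ι n) {h : H}
    (hh : h ∈ (contractionSpace e f)ᗮ) (q : Fin n) (k : {q' // q' ≠ q} → ι) :
    HasSum (fun j => f ((Equiv.funSplitAt q ι).symm (j, k)) * inner ℝ (e j) h) 0 := by
  classical
  rcases isEmpty_or_nonempty ι with hι | ⟨⟨j₀⟩⟩
  · exact hasSum_empty
  set i₀ := (Equiv.funSplitAt q ι).symm (j₀, k) with hi₀
  have hup : ∀ j, Function.update i₀ q j = (Equiv.funSplitAt q ι).symm (j, k) := fun j => by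
    refine (Equiv.eq_symm_apply _).2 (Prod.ext ?_ ?_)
    · simp [Equiv.funSplitAt]
    · ext q'
      have : i₀ q' = k q' :=
        congrFun (congrArg Prod.snd ((Equiv.funSplitAt q ι).apply_symm_apply (j₀, k))) q'
      simpa [Equiv.funSplitAt, Function.update_of_ne q'.2] using this
  have hsum : Summable fun j => f ((Equiv.funSplitAt q ι).symm (j, k)) • e j := by
    have hsq : Summable fun j => f ((Equiv.funSplitAt q ι).symm (j, k)) ^ 2 :=
      (hasSum_sq_tensor f).summable.comp_injective (i := fun j =>
        (Equiv.funSplitAt q ι).symm (j, k)) fun j j' hjj => (funSplitAt_symm_inj hjj).1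
    have hmem : Memℓp (fun j => f ((Equiv.funSplitAt q ι).symm (j, k))) 2 := by
      refine memℓp_gen ?_
      simpa using hsq
    exact (e.hasSum_repr_symm ⟨_, hmem⟩).summable
  have h0 : inner ℝ (∑' j, f ((Equiv.funSplitAt q ι).symm (j, k)) • e j) h = 0 := by
    refine (Submodule.mem_orthogonal _ _).1 hh _ (Submodule.le_topologicalClosure _
      (Submodule.subset_span ⟨q, i₀, ?_⟩))
    simp only [hup]
  rw [← h0, real_inner_comm]
  have := hsum.hasSum.mapL (innerSL ℝ h)
  simpa [inner_smul_right, real_inner_comm] using this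

open scoped Classical in
/-- The slice sums of a tensor orthogonal to `h` over a finite index set are controlled by the tail
of the tensor. -/
theorem sum_sq_slice_le [CompleteSpace H] (e : HilbertBasis ι ℝ H) (f : TensorPow ι n) {h : H}
    (hh : h ∈ (contractionSpace e f)ᗮ) (q : Fin n) (S : Finset (Fin n → ι))
    (R : Finset ({q' // q' ≠ q} → ι)) :
    ∑ k ∈ R, (∑ i ∈ S with (fun q' : {q' // q' ≠ q} => i q') = k,
      f i * inner ℝ (e (i q)) h) ^ 2 ≤ ‖h‖ ^ 2 * (‖f‖ ^ 2 - ∑ i ∈ S, f i ^ 2) := by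
  set E := (Equiv.funSplitAt q ι).symm with hE
  have hEq : ∀ j k, E (j, k) q = j := fun j k =>
    congrArg Prod.fst ((Equiv.funSplitAt q ι).apply_symm_apply (j, k))
  have hEr : ∀ j k, (fun q' : {q' // q' ≠ q} => E (j, k) q') = k := fun j k =>
    congrArg Prod.snd ((Equiv.funSplitAt q ι).apply_symm_apply (j, k))
  have hEi : ∀ i : Fin n → ι, E (i q, fun q' => i q') = i := fun i =>
    (Equiv.funSplitAt q ι).symm_apply_apply i
  -- `g` is the part of the tensor outside `S`. Since a whole slice pairs to zero with `h`, the sum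
  -- over `S` is minus the sum over `g`, to which Cauchy–Schwarz and Bessel's inequality apply.
  set g : (Fin n → ι) → ℝ := fun i => if i ∈ S then 0 else f i with hg
  have hgsum : HasSum (fun i => g i ^ 2) (‖f‖ ^ 2 - ∑ i ∈ S, f i ^ 2) := by
    have h1 : HasSum (fun i => if i ∈ S then f i ^ 2 else 0) (∑ i ∈ S, f i ^ 2) := by
      have : HasSum _ _ := hasSum_sum_of_ne_finset_zero
        (f := fun i => if i ∈ S then f i ^ 2 else 0) (s := S) fun i hi => if_neg hi
      rwa [Finset.sum_congr rfl fun i hi => if_pos hi] at this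
    convert! (hasSum_sq_tensor f).sub h1 using 2 with i
    by_cases hi : i ∈ S <;> simp [hg, hi]
  have hslice : ∀ k, HasSum (fun j => g (E (j, k)) * inner ℝ (e j) h)
      (-∑ i ∈ S with (fun q' : {q' // q' ≠ q} => i q') = k, f i * inner ℝ (e (i q)) h) :=
    fun k => by
    have h1 : HasSum (fun j => if E (j, k) ∈ S then f (E (j, k)) * inner ℝ (e j) h else 0)
        (∑ i ∈ S with (fun q' : {q' // q' ≠ q} => i q') = k, f i * inner ℝ (e (i q)) h) := by
      set J := (S.filter fun i => (fun q' : {q' // q' ≠ q} => i q') = k).image fun i => i q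
      have hE' : ∀ i ∈ S.filter fun i => (fun q' : {q' // q' ≠ q} => i q') = k,
          E (i q, k) = i := fun i hi => by
        rw [← (Finset.mem_filter.1 hi).2, hEi]
      have : HasSum _ _ := hasSum_sum_of_ne_finset_zero
        (f := fun j => if E (j, k) ∈ S then f (E (j, k)) * inner ℝ (e j) h else 0) (s := J)
        fun j hj => if_neg fun hS => hj (Finset.mem_image.2 ⟨E (j, k),
          Finset.mem_filter.2 ⟨hS, hEr j k⟩, hEq j k⟩)
      rw [Finset.sum_image fun i hi i' hi' hii => by rw [← hE' i hi, ← hE' i' hi', hii]] at this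
      convert! this using 1
      refine Finset.sum_congr rfl fun i hi => ?_
      rw [hE' i hi, if_pos (Finset.mem_filter.1 hi).1]
    have h2 := (hasSum_slice_inner e f hh q k).sub h1
    rw [zero_sub] at h2
    convert! h2 using 2 with j
    change _ = f (E (j, k)) * _ - _
    by_cases hi : E (j, k) ∈ S <;> simp only [hg, hi, if_true, if_false] <;> ring
  have hlim : Tendsto (fun J : Finset ι => ∑ k ∈ R, (∑ j ∈ J, g (E (j, k)) * inner ℝ (e j) h) ^ 2)
      atTop (𝓝 (∑ k ∈ R, (-∑ i ∈ S with (fun q' : {q' // q' ≠ q} => i q') = k,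
        f i * inner ℝ (e (i q)) h) ^ 2)) :=
    tendsto_finsetSum _ fun k _ => (hslice k).pow 2
  simp only [neg_sq] at hlim
  refine le_of_tendsto' hlim fun J => ?_
  calc ∑ k ∈ R, (∑ j ∈ J, g (E (j, k)) * inner ℝ (e j) h) ^ 2
      ≤ ∑ k ∈ R, (∑ j ∈ J, g (E (j, k)) ^ 2) * ‖h‖ ^ 2 := Finset.sum_le_sum fun k _ =>
        (Finset.sum_mul_sq_le_sq_mul_sq _ _ _).trans
          (mul_le_mul_of_nonneg_left (sum_sq_inner_le e h J)
            (Finset.sum_nonneg fun _ _ => sq_nonneg _))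
    _ = ‖h‖ ^ 2 * ∑ i ∈ (J ×ˢ R).image E, g i ^ 2 := by
        rw [← Finset.sum_mul, mul_comm, Finset.sum_image fun _ _ _ _ h => E.injective h,
          Finset.sum_product_right]
    _ ≤ _ := mul_le_mul_of_nonneg_left (sum_le_hasSum _ (fun _ _ => sq_nonneg _) hgsum)
        (sq_nonneg _)

end Contraction

section Values

set_option linter.unusedSectionVars false

variable {Ω ι H : Type*} [MeasurableSpace Ω] [NormedAddCommGroup H] [InnerProductSpace ℝ H]
  [CompleteSpace H] {W : H → Ω → ℝ} {P : Measure Ω} [IsProbabilityMeasure P] {n : ℕ}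

/-- Collecting the terms with equal remaining slots gives a chaos sum whose coefficients are slice
sums, and these are bounded by the tail of `f` outside `S`. -/
theorem eLpNorm_inner_sum_le (hW : IsIsonormal W P) (e : HilbertBasis ι ℝ H) (q : Fin n) :
    ∃ K : ℝ, 0 ≤ K ∧ ∀ (f : TensorPow ι n), ∀ h ∈ (contractionSpace e f)ᗮ,
      ∀ S : Finset (Fin n → ι), eLpNorm (fun ω => ∑ i ∈ S, f i * inner ℝ (e (i q)) h *
        hermiteProd (fun j => W (e j)) (fun q' : {q' // q' ≠ q} => i q') ω) 2 P ≤
        ENNReal.ofReal (K * √(‖h‖ ^ 2 * (‖f‖ ^ 2 - ∑ i ∈ S, f i ^ 2))) := by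
  classical
  obtain ⟨K, hK, hb⟩ := eLpNorm_hermite_sum_le (Ω := Ω) (ι := ι) (P := P) {q' // q' ≠ q}
    ({q' // q' ≠ q} → ι) one_ne_zero
  refine ⟨K, hK, fun f h hh S => ?_⟩
  set r : (Fin n → ι) → {q' // q' ≠ q} → ι := fun i q' => i q' with hr
  have h1 : ∀ ω, ∑ i ∈ S, f i * inner ℝ (e (i q)) h *
      hermiteProd (fun j => W (e j)) (fun q' : {q' // q' ≠ q} => i q') ω =
      ∑ k ∈ S.image r, (∑ i ∈ S with r i = k, f i * inner ℝ (e (i q)) h) *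
        hermiteProd (fun j => W (e j)) k ω := fun ω => by
    rw [← Finset.sum_fiberwise_of_maps_to (t := S.image r) (g := r)
      fun i hi => Finset.mem_image_of_mem _ hi]
    refine Finset.sum_congr rfl fun k _ => ?_
    rw [Finset.sum_mul]
    refine Finset.sum_congr rfl fun i hi => ?_
    rw [← (Finset.mem_filter.1 hi).2]
  rw [funext h1]
  have h2 := hb (fun j => W (e j)) (hW.iIndepFun_basis e) (hW.hasLaw_basis e) (S.image r) id
    (injOn_id _) fun k => ∑ i ∈ S with r i = k, f i * inner ℝ (e (i q)) h
  simp only [mul_one, Nat.cast_ofNat, id_eq] at h2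
  refine h2.trans (ENNReal.ofReal_le_ofReal (mul_le_mul_of_nonneg_left (Real.sqrt_le_sqrt ?_) hK))
  exact sum_sq_slice_le e f hh q S _

/-- The pairing is the pairing with the remainder plus that with the partial sum. The first vanishes
in the limit by definition of `V`, the second because the tail of a square summable tensor vanishes.
-/
theorem IsChaosDeriv.inner_ae_eq_zero (hW : IsIsonormal W P) {e : HilbertBasis ι ℝ H}
    {f : TensorPow ι n} {V : Ω → H} (hV : IsChaosDeriv W P e f V) {h : H}
    (hh : h ∈ (contractionSpace e f)ᗮ) : (fun ω => inner ℝ h (V ω)) =ᵐ[P] 0 := by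
  choose K hK hb using fun q : Fin n => eLpNorm_inner_sum_le hW e q
  have hm : AEStronglyMeasurable (fun ω => inner ℝ h (V ω)) P :=
    aestronglyMeasurable_const.inner hV.1
  rw [← eLpNorm_eq_zero_iff hm two_ne_zero]
  set B : Finset (Fin n → ι) → ℝ≥0∞ := fun S =>
    ENNReal.ofReal ‖h‖ * eLpNorm (fun ω => V ω - ∑ i ∈ S, f i • basisDeriv W e i ω) 2 P +
      ∑ q, ENNReal.ofReal (K q * √(‖h‖ ^ 2 * (‖f‖ ^ 2 - ∑ i ∈ S, f i ^ 2))) with hB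
  have hlim : Tendsto B atTop (𝓝 0) := by
    have h1 := ENNReal.Tendsto.const_mul hV.2 (Or.inr (ENNReal.ofReal_ne_top (r := ‖h‖)))
    have h2 : ∀ q, Tendsto (fun S : Finset (Fin n → ι) =>
        ENNReal.ofReal (K q * √(‖h‖ ^ 2 * (‖f‖ ^ 2 - ∑ i ∈ S, f i ^ 2)))) atTop (𝓝 0) := fun q => by
      have := ENNReal.tendsto_ofReal (((((hasSum_sq_tensor f).const_sub (‖f‖ ^ 2)).const_mul
        (‖h‖ ^ 2)).sqrt).const_mul (K q))
      simpa using this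
    have := h1.add (tendsto_finsetSum Finset.univ fun q _ => h2 q)
    simpa only [mul_zero, add_zero, Finset.sum_const_zero] using this
  refine le_antisymm (ge_of_tendsto' hlim fun S => ?_) zero_le
  have hsum : ∀ ω, inner ℝ h (∑ i ∈ S, f i • basisDeriv W e i ω) =
      ∑ q : Fin n, ∑ i ∈ S, f i * inner ℝ (e (i q)) h *
        hermiteProd (fun j => W (e j)) (fun q' : {q' // q' ≠ q} => i q') ω := fun ω => by
    rw [Finset.sum_comm, inner_sum]
    refine Finset.sum_congr rfl fun i _ => ?_
    rw [basisDeriv, inner_smul_right, inner_sum, Finset.mul_sum]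
    refine Finset.sum_congr rfl fun q _ => ?_
    rw [inner_smul_right, real_inner_comm h]
    ring
  have hdec : (fun ω => inner ℝ h (V ω)) =
      (fun ω => inner ℝ h (V ω - ∑ i ∈ S, f i • basisDeriv W e i ω)) +
      ∑ q : Fin n, fun ω => ∑ i ∈ S, f i * inner ℝ (e (i q)) h *
        hermiteProd (fun j => W (e j)) (fun q' : {q' // q' ≠ q} => i q') ω := by
    ext ω
    rw [Pi.add_apply, Finset.sum_apply, ← hsum, inner_sub_right, sub_add_cancel]
  have hm2 : ∀ q : Fin n, AEStronglyMeasurable (fun ω => ∑ i ∈ S, f i * inner ℝ (e (i q)) h *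
      hermiteProd (fun j => W (e j)) (fun q' : {q' // q' ≠ q} => i q') ω) P := fun q =>
    Finset.aestronglyMeasurable_fun_sum _ fun i _ =>
      (aestronglyMeasurable_hermiteProd (hW.hasLaw_basis e) _).const_mul _
  have hm1 := hV.1.sub (aestronglyMeasurable_basisDeriv_sum hW e S f)
  rw [hdec]
  refine (eLpNorm_add_le (aestronglyMeasurable_const.inner hm1)
    (Finset.aestronglyMeasurable_sum _ fun q _ => hm2 q) one_le_two).trans (add_le_add ?_ ?_)
  · exact eLpNorm_le_mul_eLpNorm_of_ae_le_mul (ae_of_all _ fun ω => norm_inner_le_norm _ _) 2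
  · exact (eLpNorm_sum_le (fun q _ => hm2 q) one_le_two).trans
      (Finset.sum_le_sum fun q _ => hb q f h hh S)

instance (e : HilbertBasis ι ℝ H) (f : TensorPow ι n) : CompleteSpace (contractionSpace e f) :=
  (Submodule.isClosed_topologicalClosure _).completeSpace_coe

/-- For each `c` the component `c - Pc` is orthogonal to the space, so `V - PV` pairs to zero with
`c` almost surely. Separability of `H` turns this into `V = PV` outside a single null set. -/
theorem IsChaosDeriv.ae_mem_contractionSpace [SecondCountableTopology H] (hW : IsIsonormal W P)
    {e : HilbertBasis ι ℝ H} {f : TensorPow ι n} {V : Ω → H} (hV : IsChaosDeriv W P e f V) :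
    ∀ᵐ ω ∂P, V ω ∈ contractionSpace e f := by
  set F := contractionSpace e f with hF
  have h : (fun ω => V ω - F.starProjection (V ω)) =ᵐ[P] 0 := by
    refine ae_eq_zero_of_forall_inner (𝕜 := ℝ) fun c => ?_
    filter_upwards [hV.inner_ae_eq_zero hW (Submodule.sub_starProjection_mem_orthogonal
      (K := F) c)] with ω hω
    rw [Pi.zero_apply] at hω ⊢
    rw [← hω, inner_sub_left, inner_sub_right, Submodule.inner_starProjection_left_eq_right]
  filter_upwards [h] with ω hω
  rw [← Submodule.starProjection_eq_self_iff (K := F)]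
  exact (sub_eq_zero.1 hω).symm

end Values

end ChaosProcess

/-! ### Assembly of the main theorem -/

theorem ChaosProcess.IsMalliavinDeriv.congr_ae {Ω H : Type*} [MeasurableSpace Ω]
    [NormedAddCommGroup H] [InnerProductSpace ℝ H] {W : H → Ω → ℝ} {P : Measure Ω} {F : Ω → ℝ}
    {D D' : Ω → H} (h : ChaosProcess.IsMalliavinDeriv W P F D) (hD : D' =ᵐ[P] D) :
    ChaosProcess.IsMalliavinDeriv W P F D' := by
  obtain ⟨h1, h2, G, DG, h3, h4, h5⟩ := h
  refine ⟨h1, h2.congr hD.symm, G, DG, h3, h4, h5.congr fun k => eLpNorm_congr_ae ?_⟩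
  filter_upwards [hD] with ω hω
  rw [hω]

theorem mainTheorem4
    {Ω : Type*} [MeasurableSpace Ω] (P : Measure Ω) [IsProbabilityMeasure P]
    {H : Type*} [NormedAddCommGroup H] [InnerProductSpace ℝ H] [CompleteSpace H]
    [TopologicalSpace.SeparableSpace H]
    (W : H → Ω → ℝ) (hW : ChaosProcess.IsIsonormal W P)
    {ι : Type*} (e : HilbertBasis ι ℝ H)
    (n : ℕ) (hn : 1 ≤ n)
    (f : ℝ → ChaosProcess.TensorPow ι n)
    (hf : ∀ t ∈ Icc (0 : ℝ) 1, ChaosProcess.IsSymmTensor (f t))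
    (X : ℝ → Ω → ℝ)
    (hX : ∀ t ∈ Icc (0 : ℝ) 1, ChaosProcess.IsMultipleIntegral W P e (f t) (X t))
    (hXcont : ∀ᵐ ω ∂P, ContinuousOn (fun t => X t ω) (Icc 0 1))
    (C θ : ℝ) (hreg : ChaosProcess.KernelRegularity f C θ)
    (α : ℝ) (hblock : ChaosProcess.BlockForm e f α)
    (ρ τ : ℝ≥0) (hρ : (ρ : ℝ) < θ / 2) (hτρ : 1 < τ + ρ)
    (g : ℝ → Ω → ℝ)
    (hg : ∀ᵐ ω ∂P, ∃ K : ℝ≥0, HolderOnWith K τ (fun t => g t ω) (Icc 0 1)) :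
    (∃ DX : ℝ → Ω → H,
      (∀ t ∈ Icc (0 : ℝ) 1, ChaosProcess.IsMalliavinDeriv W P (X t) (DX t)) ∧
      ∀ r : ℝ≥0, (r : ℝ) < θ / 2 →
        ∀ᵐ ω ∂P, ∃ K : ℝ≥0, HolderOnWith K r (fun t => DX t ω) (Icc 0 1)) ∧
    ∀ DX : ℝ → Ω → H,
      (∀ t ∈ Icc (0 : ℝ) 1, ChaosProcess.IsMalliavinDeriv W P (X t) (DX t)) →
      (∀ᵐ ω ∂P, ContinuousOn (fun t => DX t ω) (Icc 0 1)) →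
      ∀ᵐ ω ∂P, ∃ J : ℝ → H,
        (∀ t ∈ Icc (0 : ℝ) 1,
          ChaosProcess.IsYoungIntegral (fun r => g r ω) (fun r => DX r ω) 0 t (J t)) ∧
        BddAbove (range fun t : Icc (0 : ℝ) 1 => ‖J t‖) ∧
        Real.sqrt α * (⨆ t : Icc (0 : ℝ) 1, ‖J t‖) ≤ ‖J 1‖ := by
  have hSC : SecondCountableTopology H := UniformSpace.secondCountable_of_separable H
  obtain ⟨hC, hθ, -, hlip⟩ := hreg
  have hα := hblock.1
  choose V hV using fun t => ChaosProcess.exists_isChaosDeriv hW e (f t)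
  have hmom : ∀ p : ℕ, 0 < p → ∃ C' : ℝ, 0 ≤ C' ∧ ∀ s ∈ Icc (0 : ℝ) 1, ∀ t ∈ Icc (0 : ℝ) 1, s < t →
      eLpNorm (fun ω => V t ω - V s ω) (2 * p : ℕ) P ≤
        ENNReal.ofReal (C' * (t - s) ^ (θ / 2)) := fun p hp => by
    obtain ⟨K, hK, hb⟩ := ChaosProcess.eLpNorm_chaosDeriv_le hW e n hp.ne'
    refine ⟨K * C, by positivity, fun s hs t ht hst => ?_⟩
    refine (hb _ _ ((hV t).sub hW (hV s))).trans (ENNReal.ofReal_le_ofReal ?_)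
    have := (hlip s t hs.1 hst ht.2).2
    rw [abs_of_pos (sub_pos.2 hst)] at this
    rw [mul_assoc]
    exact mul_le_mul_of_nonneg_left this hK
  obtain ⟨U, hUV, hUH⟩ := ChaosProcess.exists_holder_modification (κ := θ / 2) (by linarith)
    (fun t _ => (hV t).1) hmom
  have hUD : ∀ t ∈ Icc (0 : ℝ) 1, ChaosProcess.IsMalliavinDeriv W P (X t) (U t) := fun t ht =>
    ((hV t).isMalliavinDeriv hW (hX t ht)).congr_ae (hUV t ht)
  refine ⟨⟨U, hUD, hUH⟩, fun DX hDX hDXc => ?_⟩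
  -- Uniqueness of the derivative holds outside a null set depending on the time; restriction to
  -- rational times keeps the union of these sets null.
  have hrat : ∀ᵐ ω ∂P, ∀ q : ℚ, (q : ℝ) ∈ Icc (0 : ℝ) 1 → DX q ω = U q ω := by
    refine ae_all_iff.2 fun q => ?_
    by_cases hq : (q : ℝ) ∈ Icc (0 : ℝ) 1
    · filter_upwards [(hDX q hq).ae_eq hW (hUD q hq)] with ω hω _ using hω
    · exact ae_of_all _ fun ω h => absurd h hq
  have hinc : ∀ᵐ ω ∂P, ∀ s t : ℚ, 0 ≤ s → s ≤ t → t ≤ 1 →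
      U t ω - U s ω ∈ ChaosProcess.incrementSpace e f s t := by
    refine ae_all_iff.2 fun s => ae_all_iff.2 fun t => ?_
    by_cases h : 0 ≤ s ∧ s ≤ t ∧ t ≤ 1
    · have hs : (s : ℝ) ∈ Icc (0 : ℝ) 1 :=
        ⟨by exact_mod_cast h.1, by exact_mod_cast h.2.1.trans h.2.2⟩
      have ht : (t : ℝ) ∈ Icc (0 : ℝ) 1 :=
        ⟨by exact_mod_cast h.1.trans h.2.1, by exact_mod_cast h.2.2⟩
      filter_upwards [((hV t).sub hW (hV s)).ae_mem_contractionSpace hW, hUV t ht, hUV s hs]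
        with ω h1 h2 h3 _ _ _
      rw [h2, h3]
      exact h1
    · exact ae_of_all _ fun ω h1 h2 h3 => absurd ⟨h1, h2, h3⟩ h
  -- Since `ρ` may be `0`, its Hölder bound need not give continuity of `U`; the exponent `1/2`,
  -- admissible because `θ > 1`, does.
  have hhalf : ((1 / 2 : ℝ≥0) : ℝ) < θ / 2 := by
    push_cast
    linarith
  filter_upwards [hg, hDXc, hrat, hinc, hUH ρ hρ, hUH (1 / 2) hhalf]
    with ω ⟨K₁, hgω⟩ hcω hratω hincω ⟨K₂, hU₂⟩ ⟨K₃, hU₃⟩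
  have hUc : ContinuousOn (fun t => U t ω) (Icc 0 1) := hU₃.continuousOn (by norm_num)
  -- Two continuous paths agreeing at the rationals of `[0,1]` coincide, so the given version
  -- inherits the Hölder bound of `U`. Density is proved in the open interval and carried to its
  -- closure so as to include the endpoints.
  have hEq : EqOn (fun t => DX t ω) (fun t => U t ω) (Icc 0 1) := by
    have hdense : Icc (0 : ℝ) 1 ⊆ closure (Icc (0 : ℝ) 1 ∩ range ((↑) : ℚ → ℝ)) := by
      have h1 : Ioo (0 : ℝ) 1 ⊆ closure (Ioo (0 : ℝ) 1 ∩ range ((↑) : ℚ → ℝ)) :=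
        Rat.denseRange_cast.open_subset_closure_inter isOpen_Ioo
      rw [← closure_Ioo zero_ne_one]
      exact (closure_minimal h1 isClosed_closure).trans
        (closure_mono (inter_subset_inter_left _ subset_closure))
    refine EqOn.of_subset_closure ?_ hcω hUc inter_subset_left hdense
    rintro _ ⟨ht, q, rfl⟩
    exact hratω q ht
  have hgB : ∀ x ∈ Icc (0 : ℝ) 1, |g x ω| ≤ |g 0 ω| + K₁ := fun x hx => by
    have h1 := ChaosProcess.norm_sub_le_of_holderOnWith hgω hx (left_mem_Icc.2 zero_le_one)
    rw [Real.norm_eq_abs, sub_zero, abs_of_nonneg hx.1] at h1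
    have h2 : (K₁ : ℝ) * x ^ (τ : ℝ) ≤ K₁ :=
      mul_le_of_le_one_right K₁.2 (Real.rpow_le_one hx.1 hx.2 τ.2)
    have h3 := abs_sub_abs_le_abs_sub (g x ω) (g 0 ω)
    linarith
  have hY : ∀ x ∈ Icc (0 : ℝ) 1, ∀ y ∈ Icc (0 : ℝ) 1,
      ‖DX x ω - DX y ω‖ ≤ K₂ * |x - y| ^ (ρ : ℝ) := fun x hx y hy => by
    have h1 : DX x ω = U x ω := hEq hx
    have h2 : DX y ω = U y ω := hEq hy
    rw [h1, h2]
    exact ChaosProcess.norm_sub_le_of_holderOnWith hU₂ hx hy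
  -- The membership is placed inside the existential so that `J` can be chosen as a function on all
  -- of `ℝ`, with value `0` available outside `[0,1]`.
  have hJ : ∀ t : ℝ, ∃ J, t ∈ Icc (0 : ℝ) 1 →
      ChaosProcess.IsYoungIntegral (fun r => g r ω) (fun r => DX r ω) 0 t J := fun t => by
    by_cases ht : t ∈ Icc (0 : ℝ) 1
    · have hsub : Icc 0 t ⊆ Icc (0 : ℝ) 1 := Icc_subset_Icc le_rfl ht.2
      obtain ⟨J, hJ⟩ := ChaosProcess.exists_isYoungIntegral (g := fun r => g r ω)
        (Y := fun r => DX r ω) K₁.2 K₂.2 τ.2 ρ.2 (by exact_mod_cast hτρ) ht.1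
        (fun x hx y hy => ChaosProcess.norm_sub_le_of_holderOnWith hgω (hsub hx) (hsub hy))
        (fun x hx y hy => hY x (hsub hx) y (hsub hy))
      exact ⟨J, fun _ => hJ⟩
    · exact ⟨0, fun h => absurd h ht⟩
  choose J hJ using hJ
  have hle : ∀ t ∈ Icc (0 : ℝ) 1, √α * ‖J t‖ ≤ ‖J 1‖ := fun t ht => by
    refine ChaosProcess.block_youngIntegral_le hblock (fun s t hs hst ht => ?_) hcω hgB ht
      (hJ t ht) (hJ 1 (right_mem_Icc.2 zero_le_one))
    have hs' : (s : ℝ) ∈ Icc (0 : ℝ) 1 :=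
      ⟨by exact_mod_cast hs, by exact_mod_cast hst.trans ht⟩
    have ht' : (t : ℝ) ∈ Icc (0 : ℝ) 1 :=
      ⟨by exact_mod_cast hs.trans hst, by exact_mod_cast ht⟩
    have := hincω s t hs hst ht
    rwa [← hratω s hs', ← hratω t ht'] at this
  have hsα : 0 < √α := Real.sqrt_pos.2 hα
  -- Dividing the pointwise inequality by `√α > 0` bounds all the norms by one number, which gives
  -- both boundedness and the bound on the supremum.
  refine ⟨J, hJ, ⟨‖J 1‖ / √α, ?_⟩, ?_⟩
  · rintro _ ⟨t, rfl⟩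
    rw [le_div_iff₀ hsα, mul_comm]
    exact hle t t.2
  · rw [← le_div_iff₀' hsα]
    refine ciSup_le fun t => ?_
    rw [le_div_iff₀' hsα]
    exact hle t t.2
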